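/- Let $p,d\ge 1$. Let $f,g:\mathbb R^p\times\mathbb R^d\to\mathbb R$ be differentiable, with $\nabla_y g$ differentiable, and write $w=(x,y)$ with the Euclidean norm. Let $\mu_g>0$ and assume: (1) $g(x,\cdot)$ is $\mu_g$-strongly convex for every $x$; (2) $\nabla g$ is $L_g$-Lipschitz in $w$, and $\nabla_y^2 g$ and $\nabla_x\nabla_y g$ are $\rho$- and $\tau$-Lipschitz in $w$ for the Frobenius norm; (3) $f$ is $M$-Lipschitz and $\nabla f$ is $L_f$-Lipschitz in $w$. Put $L=\max\{L_f,L_g\}$, $y^*(x)=\arg\min_y g(x,y)$, $\Phi(x)=f(x,y^*(x))$, and assume that $\Phi^*=\inf_x\Phi(x)>-\infty$. PZOBO: given $x_0\in\mathbb R^p$, $y_0\in\mathbb R^d$, stepsizes $\alpha,\beta>0$, smoothing $\mu>0$ and integers $N,Q\ge1$, let $y^0(x)=y_0$, $y^{t}(x)=y^{t-1}(x)-\alpha\nabla_y g(x,y^{t-1}(x))$. With independent standard Gaussian vectors $u_{k,j}\sim\mathcal N(0,I_p)$ ($k\ge 0$, $1\le j\le Q$) let $\delta_{k,j}=\frac{y^N(x_k+\mu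 u_{k,j})-y^N(x_k)}{\mu}$, $$\widehat\nabla\Phi(x_k)=\nabla_xf(x_k,y^N(x_k))+\frac1Q\sum_{j=1}^Q\big\langle\delta_{k,j},\nabla_yf(x_k,y^N(x_k))\big\rangle u_{k,j},\qquad x_{k+1}=x_k-\beta\widehat\nabla\Phi(x_k).$$ Let $D$ be such that $\|y_0-y^*(x)\|\le D$ for all $x$. Put $L_\Phi=L+\frac{2L^2+\tau M^2}{\mu_g}+\frac{\rho LM+L^3+\tau ML}{\mu_g^2}+\frac{\rho L^2M}{\mu_g^3}$, $M_\Phi=(1+\frac{L_g}{\mu_g})M$, $L_{\mathcal J}=(1+\frac L{\mu_g})(\frac\tau{\mu_g}+\frac{\rho L}{\mu_g^2})$. Let $K,N,Q\ge1$, $0<\alpha\le\frac1L$, $\beta=\frac1{L_\Phi\sqrt K}$ and $0<\mu\le \frac{c_\mu}{\sqrt{Kdp^3}}$. Then $\Phi$ is differentiable, $\|\nabla\Phi(x_k)\|^2$ is integrable for $k<K$, and: (i) $$\frac{1-\frac1{\sqrt K}}{K}\sum_{k=0}^{K-1}\mathbb E\|\nabla\Phi(x_k)\|^2\le\frac{L_\Phi(\Phi(x_0)-\Phi^*)}{\sqrt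 K}+M_\Phi\mathcal D_{bias}+\frac{\mathcal D_{var}}{\sqrt K},$$ where, with $q=1-\alpha\mu_g$ and an absolute real polynomial $\mathcal P_4$ of degree $4$ (independent of all the data), $$\mathcal D_{bias}=LDq^{N/2}+\tfrac\mu2L_{\mathcal J}Md^{1/2}(p+3)^{3/2}+\tfrac{LMq^N}{\mu_g}+\tfrac{2MD(\tau\mu_g+L\rho)}{\mu_g^2}q^{(N-1)/2}+\tfrac{L^2D}{\mu_g}q^{N/2},$$ $$\mathcal D_{var}=2L^2D^2q^N+\tfrac{4L^4}{\mu_g^2}D^2q^N+\tfrac{24(4p+15)L^2M^2}{Q\mu_g^2}+\tfrac{\mu^2}{Q}L_{\mathcal J}^2M^2d\,\mathcal P_4(p)+\tfrac{24L^2M^2q^{2N}}{\mu_g^2}+6\mu^2L_{\mathcal J}^2M^2d(p+3)^3+\tfrac{48M^2(\tau\mu_g+L\rho)^2}{\mu_g^4}q^{N-1}D^2;$$ (ii) $$\frac{1-\frac1{\sqrt K}}{K}\sum_{k=0}^{K-1}\mathbb E\|\nabla\Phi(x_k)\|^2\le C\Big(\frac p{\sqrt K}+(1-\alpha\mu_g)^N\Big),$$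 where $C$ depends only on $L_f,L_g,\mu_g,\rho,\tau,M,D,c_\mu$ and an upper bound $\Delta$ of $\Phi(x_0)-\Phi^*$ (not on $p,d,K,N,Q,\alpha,\mu$, nor otherwise on $f,g,x_0,y_0$). -/

import Mathlib

open MeasureTheory ProbabilityTheory

noncomputable section

namespace PZOBO

/-- `ℝⁿ` with the Euclidean norm. -/
abbrev Vec (n : ℕ) : Type := EuclideanSpace ℝ (Fin n)

/-- The space of pairs `w = (x, y)`, `x ∈ ℝᵖ`, `y ∈ ℝᵈ`, with the Euclidean norm
`‖w‖² = ‖x‖² + ‖y‖²`. -/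
abbrev Joint (p d : ℕ) : Type := WithLp 2 (Vec p × Vec d)

/-- The pair `(x, y)` as a point of the joint space. -/
abbrev pair {p d : ℕ} (x : Vec p) (y : Vec d) : Joint p d := WithLp.toLp 2 (x, y)

/-- The partial gradient `∇ₓ h(x, y) ∈ ℝᵖ`. -/
def gradX {p d : ℕ} (h : Joint p d → ℝ) (x : Vec p) (y : Vec d) : Vec p :=
  gradient (fun x' => h (pair x' y)) x

/-- The partial gradient `∇_y h(x, y) ∈ ℝᵈ`. -/
def gradY {p d : ℕ} (h : Joint p d → ℝ) (x : Vec p) (y : Vec d) : Vec d :=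
  gradient (fun y' => h (pair x y')) y

/-- The partial Hessian `∇_y² h(x, y)`, as a linear map `ℝᵈ → ℝᵈ`. -/
def hessYY {p d : ℕ} (h : Joint p d → ℝ) (x : Vec p) (y : Vec d) : Vec d →L[ℝ] Vec d :=
  fderiv ℝ (fun y' => gradY h x y') y

/-- The mixed second derivative `∇ₓ∇_y h(x, y)`, as a linear map `ℝᵖ → ℝᵈ`
(the derivative of `∇_y h` with respect to `x`). -/
def hessXY {p d : ℕ} (h : Joint p d → ℝ) (x : Vec p) (y : Vec d) : Vec p →L[ℝ] Vec d :=
  fderiv ℝ (fun x' => gradY h x' y) x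

/-- The Frobenius norm of (the matrix of) a linear map: the square root of the sum of the
squared norms of the columns. -/
def frobNorm {m n : ℕ} (A : Vec m →L[ℝ] Vec n) : ℝ :=
  Real.sqrt (∑ i : Fin m, ‖A (EuclideanSpace.single i (1 : ℝ))‖ ^ 2)

/-- Strong convexity of the inner function in `y`, Lipschitz gradient and Lipschitz second
derivatives `∇_y² g`, `∇ₓ∇_y g` of the inner function, Lipschitz values and gradient of the outer
function. -/
structure Assumptions {p d : ℕ} (f g : Joint p d → ℝ) (Lf Lg μg ρ τ M : ℝ) : Prop where
  strongConvex : ∀ x : Vec p, StrongConvexOn Set.univ μg (fun y : Vec d => g (pair x y))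
  g_diff : Differentiable ℝ g
  g_grad_lip : ∀ w₁ w₂ : Joint p d, ‖gradient g w₁ - gradient g w₂‖ ≤ Lg * ‖w₁ - w₂‖
  g_gradY_diff : Differentiable ℝ (fun w : Joint p d => gradY g w.fst w.snd)
  g_hessYY_lip : ∀ w₁ w₂ : Joint p d,
    frobNorm (hessYY g w₁.fst w₁.snd - hessYY g w₂.fst w₂.snd) ≤ ρ * ‖w₁ - w₂‖
  g_hessXY_lip : ∀ w₁ w₂ : Joint p d,
    frobNorm (hessXY g w₁.fst w₁.snd - hessXY g w₂.fst w₂.snd) ≤ τ * ‖w₁ - w₂‖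
  f_diff : Differentiable ℝ f
  f_lip : ∀ w₁ w₂ : Joint p d, |f w₁ - f w₂| ≤ M * ‖w₁ - w₂‖
  f_grad_lip : ∀ w₁ w₂ : Joint p d, ‖gradient f w₁ - gradient f w₂‖ ≤ Lf * ‖w₁ - w₂‖

/-- The inner solution `y*(x) = argmin_y g(x, y)`: a chosen minimizer of `g(x, ·)`
(it exists and is unique when `g(x, ·)` is strongly convex and continuous). -/
def ystar {p d : ℕ} (g : Joint p d → ℝ) (x : Vec p) : Vec d :=
  Classical.epsilon (fun y : Vec d => ∀ z : Vec d, g (pair x y) ≤ g (pair x z))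

/-- The total objective `Φ(x) = f(x, y*(x))`. -/
def Phi {p d : ℕ} (f g : Joint p d → ℝ) (x : Vec p) : ℝ :=
  f (pair x (ystar g x))

/-- The gradient descent path of the inner problem at `x`, started at `y₀`:
`innerGD g α y₀ x t` is `yᵗ(x)`. -/
def innerGD {p d : ℕ} (g : Joint p d → ℝ) (α : ℝ) (y₀ : Vec d) (x : Vec p) : ℕ → Vec d
  | 0 => y₀
  | t + 1 => innerGD g α y₀ x t - α • gradY g x (innerGD g α y₀ x t)

/-- The finite difference `δ(x; u) = (yᴺ(x + μ u) - yᴺ(x)) / μ`. -/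
def delta {p d : ℕ} (g : Joint p d → ℝ) (α μ : ℝ) (y₀ : Vec d) (N : ℕ) (x u : Vec p) : Vec d :=
  μ⁻¹ • (innerGD g α y₀ (x + μ • u) N - innerGD g α y₀ x N)

/-- The hypergradient estimator
`∇ₓ f(x, yᴺ(x)) + (1/Q) ∑ⱼ ⟨δ(x; uⱼ), ∇_y f(x, yᴺ(x))⟩ uⱼ`. -/
def hyperGradEst {p d Q : ℕ} (f g : Joint p d → ℝ) (α μ : ℝ) (y₀ : Vec d) (N : ℕ)
    (x : Vec p) (u : Fin Q → Vec p) : Vec p :=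
  gradX f x (innerGD g α y₀ x N) +
    (Q : ℝ)⁻¹ • ∑ j : Fin Q,
      (inner ℝ (delta g α μ y₀ N x (u j)) (gradY f x (innerGD g α y₀ x N)) : ℝ) • u j

/-- The outer iterates `x_k` of PZOBO, as a function of the sampled directions `u k j`. -/
def iterate {p d Q : ℕ} (f g : Joint p d → ℝ) (α β μ : ℝ) (x₀ : Vec p) (y₀ : Vec d) (N : ℕ)
    (u : ℕ → Fin Q → Vec p) : ℕ → Vec p
  | 0 => x₀
  | k + 1 => iterate f g α β μ x₀ y₀ N u k -
      β • hyperGradEst f g α μ y₀ N (iterate f g α β μ x₀ y₀ N u k) (u k)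

/-- The weighted average `((1 - 1/√K) / K) ∑_{k<K} E ‖∇Φ(x_k)‖²` along the random iterates of PZOBO
driven by the random directions `u k j`. -/
def weightedAvg {p d Q : ℕ} {Ω : Type*} [MeasurableSpace Ω] (P : Measure Ω)
    (f g : Joint p d → ℝ) (α β μ : ℝ) (x₀ : Vec p) (y₀ : Vec d) (N K : ℕ)
    (u : ℕ → Fin Q → Ω → Vec p) : ℝ :=
  (1 - 1 / Real.sqrt K) / K * ∑ k ∈ Finset.range K,
    ∫ ω, ‖gradient (Phi f g) (iterate f g α β μ x₀ y₀ N (fun i j => u i j ω) k)‖ ^ 2 ∂P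

/-- The constant `L_Φ`. -/
def LPhi (L μg ρ τ M : ℝ) : ℝ :=
  L + (2 * L ^ 2 + τ * M ^ 2) / μg + (ρ * L * M + L ^ 3 + τ * M * L) / μg ^ 2
    + ρ * L ^ 2 * M / μg ^ 3

/-- The constant `M_Φ`. -/
def MPhi (Lg μg M : ℝ) : ℝ := (1 + Lg / μg) * M

/-- The constant `L_𝒥`. -/
def LJ (L μg ρ τ : ℝ) : ℝ := (1 + L / μg) * (τ / μg + ρ * L / μg ^ 2)

/-- The bias bound `𝒟_bias`. -/
def Dbias (L μg ρ τ M D α μ : ℝ) (p d N : ℕ) : ℝ :=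
  L * D * (1 - α * μg) ^ ((N : ℝ) / 2)
    + μ / 2 * LJ L μg ρ τ * M * (d : ℝ) ^ ((1 : ℝ) / 2) * ((p : ℝ) + 3) ^ ((3 : ℝ) / 2)
    + L * M * (1 - α * μg) ^ N / μg
    + 2 * M * D * (τ * μg + L * ρ) / μg ^ 2 * (1 - α * μg) ^ (((N : ℝ) - 1) / 2)
    + L ^ 2 * D / μg * (1 - α * μg) ^ ((N : ℝ) / 2)

/-- The variance bound `𝒟_var`; `P₄` is a polynomial evaluated at the dimension `p`. -/
def Dvar (P₄ : Polynomial ℝ) (L μg ρ τ M D α μ : ℝ) (p d N Q : ℕ) : ℝ :=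
  2 * L ^ 2 * D ^ 2 * (1 - α * μg) ^ N
    + 4 * (L ^ 4 / μg ^ 2) * D ^ 2 * (1 - α * μg) ^ N
    + 24 * (4 * (p : ℝ) + 15) * (L ^ 2 * M ^ 2 / (Q * μg ^ 2))
    + μ ^ 2 / Q * LJ L μg ρ τ ^ 2 * M ^ 2 * d * P₄.eval (p : ℝ)
    + 24 * L ^ 2 * M ^ 2 * (1 - α * μg) ^ (2 * N) / μg ^ 2
    + 6 * μ ^ 2 * LJ L μg ρ τ ^ 2 * M ^ 2 * d * ((p : ℝ) + 3) ^ 3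
    + 48 * M ^ 2 * (τ * μg + L * ρ) ^ 2 / μg ^ 4 * (1 - α * μg) ^ (N - 1) * D ^ 2

end PZOBO

end

noncomputable section

namespace PZOBO

/-! PZOBO is stochastic gradient descent on `Phi` with a biased gradient estimate. Three ingredients
suffice: `Phi` is smooth, the estimate has small bias and controlled mean squared error, and the
expected decrease telescopes.

Smoothness. Strong convexity and the Lipschitz gradient make the inner gradient step a contraction
with factor `q = 1 - α * μg`, for points and for derivatives (`norm_step_le`). The Jacobians `jacGD`
obey a linear recursion with this factor; hence they are bounded by `Lg / μg`, Lipschitz with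
constant `LJ Lg μg ρ τ`, and converge uniformly to `jacStar`. The limit gives differentiability of
`ystar` without the implicit function theorem (`hasFDerivAt_ystar`), and then `gradPhi_lip`. The
constant obtained is at most `2 * LPhi`, but may exceed `LPhi`; the factor two is affordable because
the quadratic term of the descent inequality carries a factor 1/2.

Estimator. If yᴺ were affine, ⟨δ, v⟩ u would average to Jᵀv, since E[u uᵀ] = I. Its curvature adds
an error of order μ‖u‖², which Gaussian moments turn into powers of p
(`norm_integral_dirEst_sub_le`, `integral_norm_sq_dirEst_le`). What remains is the error of yᴺ, of
order q^N, and of its Jacobian, of order q^N + αN q^(N-1); the factor αN is absorbed by passing to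
q^((N-1)/2).

Descent. The iterate x_k is a function of earlier directions, hence independent of the k-th block,
so each step can be averaged over `dirLaw` at a fixed x. For (i) the bias is paired with ‖∇Φ‖ ≤
`MPhi` and enters linearly (`expected_descent_bias`). For (ii) that would leave q^(N/2), so Young's
inequality is used and the bias enters squared (`expected_descent_young`). The squared Jacobian
error is then of order q^(N-1), and replacing this by q^N costs 1 / (1 - μg / L). The cost blows up
when L = μg, but in that case the mixed derivative of g vanishes (`hessXY_eq_zero`), and the
Jacobian error with it. -/

open Filter Topology

/-! ### Convexity, symmetric operators and the descent lemma in a Hilbert space. -/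

section Hilbert

variable {E : Type*} [NormedAddCommGroup E] [InnerProductSpace ℝ E]

/-- First-order characterization of strong convexity. -/
theorem strongConvexOn_first_order {φ : E → ℝ} {m : ℝ} (hφ : StrongConvexOn Set.univ m φ)
    {y : E} {A : E →L[ℝ] ℝ} (hA : HasFDerivAt φ A y) (z : E) :
    φ y + A (z - y) + m / 2 * ‖z - y‖ ^ 2 ≤ φ z := by
  have hline : HasDerivAt (fun t : ℝ => φ (y + t • (z - y))) (A (z - y)) 0 := by
    have h1 : HasDerivAt (fun t : ℝ => y + t • (z - y)) (z - y) 0 := by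
      simpa using ((hasDerivAt_id (0 : ℝ)).smul_const (z - y)).const_add y
    have h2 : HasFDerivAt φ A (y + (0 : ℝ) • (z - y)) := by simpa using hA
    exact h2.comp_hasDerivAt (0 : ℝ) h1
  have hslope := (hasDerivAt_iff_tendsto_slope.1 hline).mono_left
    (nhdsWithin_mono 0 (fun t (ht : 0 < t) => ne_of_gt ht) : 𝓝[>] (0 : ℝ) ≤ 𝓝[≠] 0)
  have hrhs : Tendsto (fun t : ℝ => φ z - φ y - (1 - t) * (m / 2 * ‖z - y‖ ^ 2)) (𝓝[>] 0)
      (𝓝 (φ z - φ y - (1 - 0) * (m / 2 * ‖z - y‖ ^ 2))) := by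
    apply Tendsto.mono_left _ nhdsWithin_le_nhds
    exact Continuous.tendsto (by fun_prop) 0
  have hle : A (z - y) ≤ φ z - φ y - (1 - 0) * (m / 2 * ‖z - y‖ ^ 2) := by
    refine le_of_tendsto_of_tendsto hslope hrhs ?_
    have hI : Set.Ioo (0 : ℝ) 1 ∈ 𝓝[>] (0 : ℝ) := Ioo_mem_nhdsGT one_pos
    filter_upwards [hI] with t ht
    have hc := hφ.2 (Set.mem_univ y) (Set.mem_univ z) (sub_nonneg.2 ht.2.le) ht.1.le (by ring)
    have he : (1 - t) • y + t • z = y + t • (z - y) := by module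
    rw [he, norm_sub_rev y z] at hc
    simp only [smul_eq_mul] at hc
    rw [slope_def_field, div_le_iff₀ (by simpa using ht.1)]
    simp only [zero_smul, add_zero, sub_zero]
    nlinarith [hc]
  linarith

/-- The derivative of a strongly monotone map is coercive. -/
theorem coercive_of_strongMono {T : E → E} {m : ℝ} {y : E} {A : E →L[ℝ] E}
    (hA : HasFDerivAt T A y)
    (hT : ∀ z, m * ‖z - y‖ ^ 2 ≤ inner ℝ (T z - T y) (z - y)) (b : E) :
    m * ‖b‖ ^ 2 ≤ inner ℝ (A b) b := by
  have hline : HasDerivAt (fun t : ℝ => T (y + t • b)) (A b) 0 := by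
    have h1 : HasDerivAt (fun t : ℝ => y + t • b) b 0 := by
      simpa using ((hasDerivAt_id (0 : ℝ)).smul_const b).const_add y
    have h2 : HasFDerivAt T A (y + (0 : ℝ) • b) := by simpa using hA
    exact h2.comp_hasDerivAt (0 : ℝ) h1
  have hslope := (hasDerivAt_iff_tendsto_slope.1 hline).mono_left
    (nhdsWithin_mono 0 (fun t (ht : 0 < t) => ne_of_gt ht) : 𝓝[>] (0 : ℝ) ≤ 𝓝[≠] 0)
  refine ge_of_tendsto (hslope.inner (tendsto_const_nhds (x := b))) ?_
  filter_upwards [self_mem_nhdsWithin] with t (ht : 0 < t)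
  have := hT (y + t • b)
  simp only [add_sub_cancel_left, norm_smul, inner_smul_right, Real.norm_eq_abs, mul_pow,
    sq_abs] at this
  rw [slope_def_module]
  simp only [sub_zero, zero_smul, add_zero, inner_smul_left, conj_trivial]
  have h3 : m * ‖b‖ ^ 2 * t ≤ inner ℝ (T (y + t • b) - T y) b := by
    refine le_of_mul_le_mul_left ?_ ht
    linarith
  calc m * ‖b‖ ^ 2 = t⁻¹ * (m * ‖b‖ ^ 2 * t) := by field_simp
    _ ≤ _ := by gcongr

/-- A symmetric operator between `0` and `q` has norm at most `q`. -/
theorem norm_le_of_symmetric {A : E →L[ℝ] E} {q : ℝ} (hq : 0 ≤ q)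
    (hsymm : ∀ a b, inner ℝ (A a) b = inner ℝ a (A b))
    (h0 : ∀ a, 0 ≤ inner ℝ (A a) a) (h1 : ∀ a, inner ℝ (A a) a ≤ q * ‖a‖ ^ 2) : ‖A‖ ≤ q := by
  refine A.opNorm_le_bound hq fun a => ?_
  -- Cauchy–Schwarz for the semi-inner product ⟨A a, b⟩, read off from the discriminant of the
  -- nonnegative quadratic t ↦ ⟨A(a + t A a), a + t A a⟩.
  have key : (inner ℝ (A a) (A a) : ℝ) ^ 2 ≤
      inner ℝ (A a) a * inner ℝ (A (A a)) (A a) := by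
    have hquad : ∀ t : ℝ, 0 ≤ inner ℝ (A (A a)) (A a) * (t * t) +
        (2 * inner ℝ (A a) (A a)) * t + inner ℝ (A a) a := by
      intro t
      have := h0 (a + t • A a)
      simp only [map_add, map_smul, inner_add_left, inner_add_right, inner_smul_left,
        inner_smul_right, conj_trivial] at this
      rw [hsymm (A a) a] at this
      linarith
    have := discrim_le_zero hquad
    rw [discrim] at this
    linarith
  rw [real_inner_self_eq_norm_sq] at key
  have h2 := h1 a
  have h3 := h1 (A a)
  have h5 : ‖A a‖ ^ 2 * ‖A a‖ ^ 2 ≤ (q * ‖a‖) ^ 2 * ‖A a‖ ^ 2 := by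
    have : inner ℝ (A a) a * inner ℝ (A (A a)) (A a) ≤
        (q * ‖a‖ ^ 2) * (q * ‖A a‖ ^ 2) :=
      mul_le_mul h2 h3 (h0 _) (by positivity)
    nlinarith
  rcases eq_or_lt_of_le (norm_nonneg (A a)) with h | h
  · rw [← h]; positivity
  · have := le_of_mul_le_mul_right h5 (by positivity)
    exact (pow_le_pow_iff_left₀ h.le (by positivity) two_ne_zero).1 this

/-- The descent lemma for functions with Lipschitz gradient. -/
theorem descent_lemma {F : E → ℝ} {F' : E → E} {L : ℝ} [CompleteSpace E]
    (hF : ∀ x, HasGradientAt F (F' x) x)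
    (hL : ∀ x z, ‖F' x - F' z‖ ≤ L * ‖x - z‖) (x v : E) :
    F (x + v) ≤ F x + inner ℝ (F' x) v + L / 2 * ‖v‖ ^ 2 := by
  have hd : ∀ t : ℝ, HasDerivAt
      (fun t : ℝ => F (x + t • v) - t * inner ℝ (F' x) v - L / 2 * t ^ 2 * ‖v‖ ^ 2)
      (inner ℝ (F' (x + t • v)) v - inner ℝ (F' x) v - L * t * ‖v‖ ^ 2) t := by
    intro t
    have h1 : HasDerivAt (fun t : ℝ => x + t • v) v t := by
      simpa using ((hasDerivAt_id t).smul_const v).const_add x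
    have h2 := (hF (x + t • v)).hasFDerivAt.comp_hasDerivAt t h1
    simp only [InnerProductSpace.toDual_apply_apply] at h2
    have h3 : HasDerivAt (fun t : ℝ => t * inner ℝ (F' x) v) (inner ℝ (F' x) v) t := by
      simpa using (hasDerivAt_id t).mul_const (inner ℝ (F' x) v)
    have h4 : HasDerivAt (fun t : ℝ => L / 2 * t ^ 2 * ‖v‖ ^ 2) (L * t * ‖v‖ ^ 2) t := by
      have := (((hasDerivAt_pow 2 t).const_mul (L / 2)).mul_const (‖v‖ ^ 2))
      refine this.congr_deriv ?_
      push_cast; ring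
    exact (h2.sub h3).sub h4
  -- The derivative is ⟨F'(x + tv) - F'(x), v⟩ - L t ‖v‖², nonpositive for t ≥ 0; the claim compares
  -- the values at 0 and 1.
  have hanti : AntitoneOn
      (fun t : ℝ => F (x + t • v) - t * inner ℝ (F' x) v - L / 2 * t ^ 2 * ‖v‖ ^ 2)
      (Set.Icc 0 1) := by
    refine antitoneOn_of_deriv_nonpos (convex_Icc 0 1)
      (fun t _ => (hd t).continuousAt.continuousWithinAt)
      (fun t _ => (hd t).differentiableAt.differentiableWithinAt) ?_
    intro t ht
    rw [interior_Icc] at ht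
    rw [(hd t).deriv, ← inner_sub_left]
    have h1 := real_inner_le_norm (F' (x + t • v) - F' x) v
    have h2 := hL (x + t • v) x
    rw [add_sub_cancel_left, norm_smul, Real.norm_of_nonneg ht.1.le] at h2
    nlinarith [mul_le_mul_of_nonneg_right h2 (norm_nonneg v)]
  have := hanti (Set.left_mem_Icc.2 zero_le_one) (Set.right_mem_Icc.2 zero_le_one) zero_le_one
  simp only [one_smul, zero_smul, add_zero] at this
  linarith

end Hilbert

/-- The operator norm is bounded by the Frobenius norm. -/
theorem norm_le_frobNorm {m n : ℕ} (A : Vec m →L[ℝ] Vec n) : ‖A‖ ≤ frobNorm A := by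
  refine A.opNorm_le_bound (Real.sqrt_nonneg _) fun a => ?_
  have ha : A a = ∑ i, a i • A (EuclideanSpace.single i (1 : ℝ)) := by
    conv_lhs => rw [← (EuclideanSpace.basisFun (Fin m) ℝ).sum_repr a]
    simp
  rw [ha, frobNorm, EuclideanSpace.norm_eq a, mul_comm]
  calc ‖∑ i, a i • A (EuclideanSpace.single i (1 : ℝ))‖
      ≤ ∑ i, ‖a i‖ * ‖A (EuclideanSpace.single i (1 : ℝ))‖ := by
        refine (norm_sum_le _ _).trans_eq ?_
        simp [norm_smul]
    _ ≤ _ := Real.sum_mul_le_sqrt_mul_sqrt _ _ _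

/-! ### The joint space and partial gradients. -/

section Partial

variable {p d : ℕ}

/-- The inclusion of the first factor. -/
def inlJ (p d : ℕ) : Vec p →L[ℝ] Joint p d :=
  (WithLp.prodContinuousLinearEquiv 2 ℝ (Vec p) (Vec d)).symm.toContinuousLinearMap ∘L
    ContinuousLinearMap.inl ℝ (Vec p) (Vec d)

/-- The inclusion of the second factor. -/
def inrJ (p d : ℕ) : Vec d →L[ℝ] Joint p d :=
  (WithLp.prodContinuousLinearEquiv 2 ℝ (Vec p) (Vec d)).symm.toContinuousLinearMap ∘L
    ContinuousLinearMap.inr ℝ (Vec p) (Vec d)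

@[simp] theorem inlJ_apply (a : Vec p) : inlJ p d a = pair a 0 := rfl
@[simp] theorem inrJ_apply (b : Vec d) : inrJ p d b = pair 0 b := rfl

theorem pair_eq (x : Vec p) (y : Vec d) : pair x y = inlJ p d x + inrJ p d y := by
  simp only [inlJ_apply, inrJ_apply, pair]
  rw [← WithLp.toLp_add]; simp

theorem pair_sub_pair (x x' : Vec p) (y y' : Vec d) :
    pair x y - pair x' y' = pair (x - x') (y - y') := rfl

theorem norm_pair_sq (x : Vec p) (y : Vec d) : ‖pair x y‖ ^ 2 = ‖x‖ ^ 2 + ‖y‖ ^ 2 :=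
  WithLp.prod_norm_sq_eq_of_L2 _

theorem norm_pair_le (x : Vec p) (y : Vec d) : ‖pair x y‖ ≤ ‖x‖ + ‖y‖ := by
  refine abs_le_of_sq_le_sq' ?_ (by positivity) |>.2
  rw [norm_pair_sq]
  nlinarith [mul_nonneg (norm_nonneg x) (norm_nonneg y)]

theorem norm_fst_le (w : Joint p d) : ‖w.fst‖ ≤ ‖w‖ :=
  abs_le_of_sq_le_sq' (by have := WithLp.prod_norm_sq_eq_of_L2 w; nlinarith [sq_nonneg ‖w.snd‖])
    (norm_nonneg _) |>.2

theorem norm_snd_le (w : Joint p d) : ‖w.snd‖ ≤ ‖w‖ :=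
  abs_le_of_sq_le_sq' (by have := WithLp.prod_norm_sq_eq_of_L2 w; nlinarith [sq_nonneg ‖w.fst‖])
    (norm_nonneg _) |>.2

/-- The derivative of `x ↦ (x, y(x))`. -/
theorem hasFDerivAt_pair {x : Vec p} {y : Vec p → Vec d} {J : Vec p →L[ℝ] Vec d}
    (hy : HasFDerivAt y J x) :
    HasFDerivAt (fun x => pair x (y x)) (inlJ p d + inrJ p d ∘L J) x := by
  have : (fun x => pair x (y x)) = fun x => inlJ p d x + inrJ p d (y x) := by
    funext x; exact pair_eq _ _
  rw [this]
  exact (inlJ p d).hasFDerivAt.add ((inrJ p d).hasFDerivAt.comp x hy)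

theorem hasFDerivAt_pair_left (x : Vec p) (y : Vec d) :
    HasFDerivAt (fun x => pair x y) (inlJ p d) x := by
  simpa using hasFDerivAt_pair (hasFDerivAt_const y x)

theorem hasFDerivAt_pair_right (x : Vec p) (y : Vec d) :
    HasFDerivAt (fun y => pair x y) (inrJ p d) y := by
  have : (fun y => pair x y) = fun y => inlJ p d x + inrJ p d y := by
    funext y; exact pair_eq _ _
  rw [this]
  exact (inrJ p d).hasFDerivAt.const_add _

theorem gradX_eq {h : Joint p d → ℝ} (hh : Differentiable ℝ h) (x : Vec p) (y : Vec d) :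
    gradX h x y = (gradient h (pair x y)).fst := by
  refine ext_inner_right ℝ fun a => ?_
  have h1 := (hh (pair x y)).hasFDerivAt.comp x (hasFDerivAt_pair_left x y)
  have h2 : inner ℝ (gradient h (pair x y)) (pair a 0) = inner ℝ (gradient h (pair x y)).fst a := by
    rw [WithLp.prod_inner_apply]; simp
  rw [gradX, inner_gradient_left, ← h2, inner_gradient_left]
  exact congrArg (fun A => A a) h1.fderiv

theorem gradY_eq {h : Joint p d → ℝ} (hh : Differentiable ℝ h) (x : Vec p) (y : Vec d) :
    gradY h x y = (gradient h (pair x y)).snd := by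
  refine ext_inner_right ℝ fun a => ?_
  have h1 := (hh (pair x y)).hasFDerivAt.comp y (hasFDerivAt_pair_right x y)
  have h2 : inner ℝ (gradient h (pair x y)) (pair 0 a) = inner ℝ (gradient h (pair x y)).snd a := by
    rw [WithLp.prod_inner_apply]; simp
  rw [gradY, inner_gradient_left, ← h2, inner_gradient_left]
  exact congrArg (fun A => A a) h1.fderiv

end Partial

/-! ### The inner problem: Hessian bounds, contraction of the gradient step, the minimizer. -/

section

variable {p d : ℕ} {f g : Joint p d → ℝ} {Lf Lg μg ρ τ M : ℝ}

namespace Assumptions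

theorem gradY_lip (hA : Assumptions f g Lf Lg μg ρ τ M) (x x' : Vec p) (y y' : Vec d) :
    ‖gradY g x y - gradY g x' y'‖ ≤ Lg * ‖pair (x - x') (y - y')‖ := by
  rw [gradY_eq hA.g_diff, gradY_eq hA.g_diff, ← pair_sub_pair]
  exact (norm_snd_le (gradient g (pair x y) - gradient g (pair x' y'))).trans
    (hA.g_grad_lip _ _)

theorem hasFDerivAt_gradY (hA : Assumptions f g Lf Lg μg ρ τ M) (x : Vec p) (y : Vec d) :
    HasFDerivAt (fun w : Joint p d => gradY g w.fst w.snd)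
      (fderiv ℝ (fun w : Joint p d => gradY g w.fst w.snd) (pair x y)) (pair x y) :=
  (hA.g_gradY_diff _).hasFDerivAt

theorem hasFDerivAt_gradY_right (hA : Assumptions f g Lf Lg μg ρ τ M) (x : Vec p) (y : Vec d) :
    HasFDerivAt (fun y => gradY g x y) (hessYY g x y) y := by
  have h := (hA.hasFDerivAt_gradY x y).comp y (hasFDerivAt_pair_right x y)
  have h' : HasFDerivAt (fun y => gradY g x y) _ y := h
  exact h'.differentiableAt.hasFDerivAt

theorem fderiv_gradY_apply (hA : Assumptions f g Lf Lg μg ρ τ M) (x : Vec p) (y : Vec d)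
    (a : Vec p) (b : Vec d) :
    fderiv ℝ (fun w : Joint p d => gradY g w.fst w.snd) (pair x y) (pair a b)
      = hessXY g x y a + hessYY g x y b := by
  have h1 := (hA.hasFDerivAt_gradY x y).comp x (hasFDerivAt_pair_left x y)
  have h2 := (hA.hasFDerivAt_gradY x y).comp y (hasFDerivAt_pair_right x y)
  have h3 : hessXY g x y = _ := h1.fderiv
  have h4 : hessYY g x y = _ := h2.fderiv
  rw [h3, h4, pair_eq a b, map_add]
  rfl

/-- Chain rule for `x ↦ ∇_y g(x, y(x))`. -/
theorem hasFDerivAt_gradY_comp (hA : Assumptions f g Lf Lg μg ρ τ M) {x : Vec p}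
    {y : Vec p → Vec d} {J : Vec p →L[ℝ] Vec d} (hy : HasFDerivAt y J x) :
    HasFDerivAt (fun x => gradY g x (y x)) (hessXY g x (y x) + hessYY g x (y x) ∘L J) x := by
  have h := (hA.hasFDerivAt_gradY x (y x)).comp x (hasFDerivAt_pair hy)
  refine HasFDerivAt.congr_fderiv h ?_
  ext1 a
  have := hA.fderiv_gradY_apply x (y x) a (J a)
  rw [pair_eq a (J a)] at this
  exact this

/-- The assumptions do not state that the Lipschitz constants are nonnegative; a nonzero vector
forces it, whence `1 ≤ p` below. -/
theorem nonneg_of_le_mul_norm {E : Type*} [NormedAddCommGroup E] [Nontrivial E] {c : ℝ}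
    {φ : E → E → ℝ} (h0 : ∀ a b, 0 ≤ φ a b) (h : ∀ a b, φ a b ≤ c * ‖a - b‖) : 0 ≤ c := by
  obtain ⟨v, hv⟩ := exists_ne (0 : E)
  have := (h0 v 0).trans (h v 0)
  rw [sub_zero] at this
  exact nonneg_of_mul_nonneg_left this (norm_pos_iff.2 hv)

theorem nontrivial_joint (hp : 1 ≤ p) : Nontrivial (Joint p d) := by
  have : Nonempty (Fin p) := ⟨⟨0, hp⟩⟩
  have : Nontrivial (Vec p) := inferInstance
  obtain ⟨v, hv⟩ := exists_ne (0 : Vec p)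
  exact ⟨⟨pair v 0, 0, fun h => hv (congrArg WithLp.fst h)⟩⟩

theorem Lg_nonneg (hA : Assumptions f g Lf Lg μg ρ τ M) (hp : 1 ≤ p) : 0 ≤ Lg :=
  haveI := nontrivial_joint (d := d) hp
  nonneg_of_le_mul_norm (fun _ _ => norm_nonneg _) hA.g_grad_lip

theorem Lf_nonneg (hA : Assumptions f g Lf Lg μg ρ τ M) (hp : 1 ≤ p) : 0 ≤ Lf :=
  haveI := nontrivial_joint (d := d) hp
  nonneg_of_le_mul_norm (fun _ _ => norm_nonneg _) hA.f_grad_lip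

theorem M_nonneg (hA : Assumptions f g Lf Lg μg ρ τ M) (hp : 1 ≤ p) : 0 ≤ M :=
  haveI := nontrivial_joint (d := d) hp
  nonneg_of_le_mul_norm (fun _ _ => abs_nonneg _) hA.f_lip

theorem rho_nonneg (hA : Assumptions f g Lf Lg μg ρ τ M) (hp : 1 ≤ p) : 0 ≤ ρ :=
  haveI := nontrivial_joint (d := d) hp
  nonneg_of_le_mul_norm (fun _ _ => Real.sqrt_nonneg _) hA.g_hessYY_lip

theorem tau_nonneg (hA : Assumptions f g Lf Lg μg ρ τ M) (hp : 1 ≤ p) : 0 ≤ τ :=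
  haveI := nontrivial_joint (d := d) hp
  nonneg_of_le_mul_norm (fun _ _ => Real.sqrt_nonneg _) hA.g_hessXY_lip

theorem hessYY_lip (hA : Assumptions f g Lf Lg μg ρ τ M) (hp : 1 ≤ p)
    (x x' : Vec p) (y y' : Vec d) :
    ‖hessYY g x y - hessYY g x' y'‖ ≤ ρ * (‖x - x'‖ + ‖y - y'‖) := by
  refine (norm_le_frobNorm _).trans ((hA.g_hessYY_lip (pair x y) (pair x' y')).trans ?_)
  exact mul_le_mul_of_nonneg_left (norm_pair_le _ _) (hA.rho_nonneg hp)

theorem hessXY_lip (hA : Assumptions f g Lf Lg μg ρ τ M) (hp : 1 ≤ p)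
    (x x' : Vec p) (y y' : Vec d) :
    ‖hessXY g x y - hessXY g x' y'‖ ≤ τ * (‖x - x'‖ + ‖y - y'‖) := by
  refine (norm_le_frobNorm _).trans ((hA.g_hessXY_lip (pair x y) (pair x' y')).trans ?_)
  exact mul_le_mul_of_nonneg_left (norm_pair_le _ _) (hA.tau_nonneg hp)

theorem norm_hess_apply_le (hA : Assumptions f g Lf Lg μg ρ τ M) (hp : 1 ≤ p)
    (x : Vec p) (y : Vec d) (a : Vec p) (b : Vec d) :
    ‖hessXY g x y a + hessYY g x y b‖ ≤ Lg * ‖pair a b‖ := by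
  rw [← hA.fderiv_gradY_apply]
  refine ContinuousLinearMap.le_of_opNorm_le _ ?_ _
  refine (hA.hasFDerivAt_gradY x y).le_of_lip' (hA.Lg_nonneg hp) (Eventually.of_forall fun w => ?_)
  exact hA.gradY_lip _ _ _ _

theorem norm_hessXY_le (hA : Assumptions f g Lf Lg μg ρ τ M) (hp : 1 ≤ p)
    (x : Vec p) (y : Vec d) : ‖hessXY g x y‖ ≤ Lg := by
  refine ContinuousLinearMap.opNorm_le_bound _ (hA.Lg_nonneg hp) fun a => ?_
  have := hA.norm_hess_apply_le hp x y a 0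
  rw [map_zero, add_zero] at this
  refine this.trans (mul_le_mul_of_nonneg_left ?_ (hA.Lg_nonneg hp))
  simp

theorem norm_hessYY_apply_le (hA : Assumptions f g Lf Lg μg ρ τ M) (hp : 1 ≤ p)
    (x : Vec p) (y : Vec d) (b : Vec d) : ‖hessYY g x y b‖ ≤ Lg * ‖b‖ := by
  have := hA.norm_hess_apply_le hp x y 0 b
  rw [map_zero, zero_add] at this
  refine this.trans (mul_le_mul_of_nonneg_left ?_ (hA.Lg_nonneg hp))
  simp

theorem hasGradientAt_g_right (hA : Assumptions f g Lf Lg μg ρ τ M) (x : Vec p) (y : Vec d) :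
    HasGradientAt (fun y => g (pair x y)) (gradY g x y) y := by
  have h := (hA.g_diff (pair x y)).hasFDerivAt.comp y (hasFDerivAt_pair_right x y)
  exact (DifferentiableAt.hasGradientAt h.differentiableAt : _)

theorem g_first_order (hA : Assumptions f g Lf Lg μg ρ τ M) (x : Vec p) (y z : Vec d) :
    g (pair x y) + inner ℝ (gradY g x y) (z - y) + μg / 2 * ‖z - y‖ ^ 2 ≤ g (pair x z) :=
  strongConvexOn_first_order (hA.strongConvex x) (hA.hasGradientAt_g_right x y).hasFDerivAt z

theorem gradY_strongMono (hA : Assumptions f g Lf Lg μg ρ τ M) (x : Vec p) (y z : Vec d) :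
    μg * ‖z - y‖ ^ 2 ≤ inner ℝ (gradY g x z - gradY g x y) (z - y) := by
  have h1 := hA.g_first_order x y z
  have h2 := hA.g_first_order x z y
  rw [← neg_sub z y, norm_neg, inner_neg_right] at h2
  rw [inner_sub_left]
  linarith

theorem hessYY_coercive (hA : Assumptions f g Lf Lg μg ρ τ M) (x : Vec p) (y b : Vec d) :
    μg * ‖b‖ ^ 2 ≤ inner ℝ (hessYY g x y b) b :=
  coercive_of_strongMono (hA.hasFDerivAt_gradY_right x y) (fun z => hA.gradY_strongMono x y z) b

theorem hessYY_symm (hA : Assumptions f g Lf Lg μg ρ τ M) (x : Vec p) (y a b : Vec d) :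
    inner ℝ (hessYY g x y a) b = inner ℝ a (hessYY g x y b) := by
  -- Symmetry needs only a gradient that exists everywhere and is differentiable at the point;
  -- continuity of the Hessian plays no role.
  have h := second_derivative_symmetric (𝕜 := ℝ) (f := fun y => g (pair x y))
    (f' := fun y => innerSL ℝ (gradY g x y)) (f'' := innerSL ℝ ∘L hessYY g x y) (x := y)
    (fun y => (hA.hasGradientAt_g_right x y).hasFDerivAt)
    ((innerSL ℝ).hasFDerivAt.comp y (hA.hasFDerivAt_gradY_right x y)) a b
  have h' : inner ℝ (hessYY g x y a) b = inner ℝ (hessYY g x y b) a := h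
  rw [h', real_inner_comm]

theorem mug_le_Lg (hA : Assumptions f g Lf Lg μg ρ τ M) (hp : 1 ≤ p) (hd : 1 ≤ d) : μg ≤ Lg := by
  have h1 := hA.hessYY_coercive 0 0 (EuclideanSpace.single ⟨0, hd⟩ 1)
  have h2 := real_inner_le_norm (hessYY g 0 0 (EuclideanSpace.single ⟨0, hd⟩ 1))
    (EuclideanSpace.single ⟨0, hd⟩ 1)
  have h3 := hA.norm_hessYY_apply_le hp 0 0 (EuclideanSpace.single ⟨0, hd⟩ 1)
  simp at h1 h2 h3
  linarith

/-- The Jacobian of an inner gradient step is a contraction. -/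
theorem norm_step_le (hA : Assumptions f g Lf Lg μg ρ τ M) (hp : 1 ≤ p) (hd : 1 ≤ d)
    {α : ℝ} (hα : 0 < α) (hαL : α * Lg ≤ 1) (x : Vec p) (y : Vec d) :
    ‖ContinuousLinearMap.id ℝ (Vec d) - α • hessYY g x y‖ ≤ 1 - α * μg := by
  have hμL := hA.mug_le_Lg hp hd
  -- `I - α H` is symmetric; `α * Lg ≤ 1` makes it nonnegative and coercivity of H bounds it above
  -- by `1 - α * μg`.
  refine norm_le_of_symmetric (by nlinarith) (fun a b => ?_) (fun a => ?_) (fun a => ?_)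
  · simp [inner_sub_left, inner_sub_right, inner_smul_left, inner_smul_right, hA.hessYY_symm]
  · have h1 := real_inner_le_norm (hessYY g x y a) a
    have h2 := mul_le_mul_of_nonneg_right (hA.norm_hessYY_apply_le hp x y a) (norm_nonneg a)
    simp only [sub_apply, ContinuousLinearMap.id_apply,
      smul_apply, inner_sub_left, inner_smul_left, conj_trivial,
      real_inner_self_eq_norm_sq]
    have h3 : α * inner ℝ (hessYY g x y a) a ≤ α * (Lg * ‖a‖ * ‖a‖) :=
      mul_le_mul_of_nonneg_left (h1.trans h2) hα.le
    nlinarith [mul_le_mul_of_nonneg_right hαL (sq_nonneg ‖a‖)]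
  · have h1 := mul_le_mul_of_nonneg_left (hA.hessYY_coercive x y a) hα.le
    simp only [sub_apply, ContinuousLinearMap.id_apply,
      smul_apply, inner_sub_left, inner_smul_left, conj_trivial,
      real_inner_self_eq_norm_sq]
    linarith

theorem step_contraction (hA : Assumptions f g Lf Lg μg ρ τ M) (hp : 1 ≤ p) (hd : 1 ≤ d)
    {α : ℝ} (hα : 0 < α) (hαL : α * Lg ≤ 1) (x : Vec p) (y z : Vec d) :
    ‖(y - α • gradY g x y) - (z - α • gradY g x z)‖ ≤ (1 - α * μg) * ‖y - z‖ := by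
  refine Convex.norm_image_sub_le_of_norm_hasFDerivWithin_le (s := Set.univ)
    (f := fun y => y - α • gradY g x y)
    (f' := fun y => ContinuousLinearMap.id ℝ (Vec d) - α • hessYY g x y)
    (fun y _ => ?_) (fun y _ => hA.norm_step_le hp hd hα hαL x y) convex_univ
    (Set.mem_univ z) (Set.mem_univ y)
  exact ((hasFDerivAt_id y).sub ((hA.hasFDerivAt_gradY_right x y).const_smul α)).hasFDerivWithinAt

/-- Banach's fixed point theorem for the gradient step of size `1 / Lg`, whose fixed points are the
critical points. -/
theorem exists_gradY_eq_zero (hA : Assumptions f g Lf Lg μg ρ τ M) (hp : 1 ≤ p) (hd : 1 ≤ d)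
    (hμ : 0 < μg) (x : Vec p) : ∃ y, gradY g x y = 0 := by
  have hL : 0 < Lg := hμ.trans_le (hA.mug_le_Lg hp hd)
  have hle : (1 / Lg) * μg ≤ 1 := by
    rw [one_div, inv_mul_le_iff₀ hL, mul_one]; exact hA.mug_le_Lg hp hd
  have hc : ContractingWith (Real.toNNReal (1 - 1 / Lg * μg))
      (fun y : Vec d => y - (1 / Lg) • gradY g x y) := by
    refine ⟨?_, LipschitzWith.of_dist_le_mul fun y z => ?_⟩
    · rw [← NNReal.coe_lt_coe, Real.coe_toNNReal _ (by linarith)]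
      have : 0 < 1 / Lg * μg := by positivity
      simpa using this
    · rw [Real.coe_toNNReal _ (by linarith), dist_eq_norm, dist_eq_norm]
      exact hA.step_contraction hp hd (by positivity) (by field_simp; exact le_rfl) x y z
  refine ⟨hc.fixedPoint, ?_⟩
  have := hc.fixedPoint_isFixedPt
  simp only [Function.IsFixedPt, sub_eq_self, smul_eq_zero] at this
  exact this.resolve_left (by positivity)

theorem ystar_le (hA : Assumptions f g Lf Lg μg ρ τ M) (hp : 1 ≤ p) (hd : 1 ≤ d)
    (hμ : 0 < μg) (x : Vec p) (z : Vec d) : g (pair x (ystar g x)) ≤ g (pair x z) := by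
  have hex : ∃ y : Vec d, ∀ z : Vec d, g (pair x y) ≤ g (pair x z) := by
    obtain ⟨y, hy⟩ := hA.exists_gradY_eq_zero hp hd hμ x
    refine ⟨y, fun z => ?_⟩
    have := hA.g_first_order x y z
    rw [hy, inner_zero_left] at this
    nlinarith [sq_nonneg ‖z - y‖]
  exact Classical.epsilon_spec hex z

theorem gradY_ystar (hA : Assumptions f g Lf Lg μg ρ τ M) (hp : 1 ≤ p) (hd : 1 ≤ d)
    (hμ : 0 < μg) (x : Vec p) : gradY g x (ystar g x) = 0 := by
  have hmin : IsLocalMin (fun y => g (pair x y)) (ystar g x) :=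
    Eventually.of_forall fun z => hA.ystar_le hp hd hμ x z
  rw [gradY, gradient, hmin.fderiv_eq_zero, map_zero]

theorem norm_innerGD_sub_ystar_le (hA : Assumptions f g Lf Lg μg ρ τ M) (hp : 1 ≤ p) (hd : 1 ≤ d)
    (hμ : 0 < μg) {α : ℝ} (hα : 0 < α) (hαL : α * Lg ≤ 1) {y₀ : Vec d} {D : ℝ} {x : Vec p}
    (hD : ‖y₀ - ystar g x‖ ≤ D) (t : ℕ) :
    ‖innerGD g α y₀ x t - ystar g x‖ ≤ (1 - α * μg) ^ t * D := by
  have hq : 0 ≤ 1 - α * μg := by nlinarith [hA.mug_le_Lg hp hd]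
  induction t with
  | zero => simpa [innerGD] using hD
  | succ t ih =>
    have h := hA.step_contraction hp hd hα hαL x (innerGD g α y₀ x t) (ystar g x)
    rw [hA.gradY_ystar hp hd hμ, smul_zero, sub_zero] at h
    rw [innerGD, pow_succ']
    refine h.trans ?_
    rw [mul_assoc]
    exact mul_le_mul_of_nonneg_left ih hq

end Assumptions

end

/-! ### Jacobians of the inner iterates and of the inner solution. -/

section

variable {p d : ℕ} {f g : Joint p d → ℝ} {Lf Lg μg ρ τ M : ℝ}

/-- The Jacobian of the inner gradient descent iterate `x ↦ yᵗ(x)`. -/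
def jacGD (g : Joint p d → ℝ) (α : ℝ) (y₀ : Vec d) (x : Vec p) : ℕ → (Vec p →L[ℝ] Vec d)
  | 0 => 0
  | t + 1 => (ContinuousLinearMap.id ℝ (Vec d) - α • hessYY g x (innerGD g α y₀ x t)) ∘L
      jacGD g α y₀ x t - α • hessXY g x (innerGD g α y₀ x t)

/-- A solution `J` of `∇_y² g · J + ∇ₓ∇_y g = 0` at `(x, y*(x))`: the Jacobian of `y*`. -/
def jacStar (g : Joint p d → ℝ) (x : Vec p) : Vec p →L[ℝ] Vec d :=
  Classical.epsilon fun J : Vec p →L[ℝ] Vec d =>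
    hessYY g x (ystar g x) ∘L J = - hessXY g x (ystar g x)

/-- A linear recursive inequality `e (t + 1) ≤ (1 - a m) e t + a c` keeps `e ≤ c / m`. -/
theorem le_div_of_recursion {e : ℕ → ℝ} {a m c : ℝ} (hm : 0 < m) (ha : 0 ≤ 1 - a * m)
    (h0 : e 0 ≤ c / m) (h : ∀ t, e (t + 1) ≤ (1 - a * m) * e t + a * c) (t : ℕ) :
    e t ≤ c / m := by
  induction t with
  | zero => exact h0
  | succ t ih =>
    calc e (t + 1) ≤ (1 - a * m) * e t + a * c := h t
      _ ≤ (1 - a * m) * (c / m) + a * c := by gcongr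
      _ = c / m := by field_simp; ring

namespace Assumptions

theorem hasFDerivAt_innerGD (hA : Assumptions f g Lf Lg μg ρ τ M) (α : ℝ) (y₀ : Vec d)
    (x : Vec p) (t : ℕ) :
    HasFDerivAt (fun x => innerGD g α y₀ x t) (jacGD g α y₀ x t) x := by
  induction t with
  | zero => exact hasFDerivAt_const y₀ x
  | succ t ih =>
    have h := ih.sub ((hA.hasFDerivAt_gradY_comp ih).const_smul α)
    refine HasFDerivAt.congr_fderiv (f := fun x => innerGD g α y₀ x (t + 1)) h ?_
    ext1 a
    simp [jacGD]
    abel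

section

variable (hA : Assumptions f g Lf Lg μg ρ τ M) (hp : 1 ≤ p) (hd : 1 ≤ d) (hμ : 0 < μg)
  {α : ℝ} (hα : 0 < α) (hαL : α * Lg ≤ 1)

include hA hp hd hα hαL in
theorem q_nonneg : 0 ≤ 1 - α * μg := by nlinarith [hA.mug_le_Lg hp hd]

-- `Lg / μg` is the fixed point of the recursion e ↦ (1 - αμg) e + α Lg, so the bound is uniform in
-- t and α.
include hA hp hd hμ hα hαL in
theorem norm_jacGD_le (y₀ : Vec d) (x : Vec p) (t : ℕ) : ‖jacGD g α y₀ x t‖ ≤ Lg / μg := by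
  have hq := hA.q_nonneg hp hd hα hαL
  refine le_div_of_recursion (e := fun t => ‖jacGD g α y₀ x t‖) hμ hq ?_ (fun t => ?_) t
  · simpa [jacGD] using div_nonneg (hA.Lg_nonneg hp) hμ.le
  · refine (norm_sub_le _ _).trans (add_le_add ?_ ?_)
    · refine (ContinuousLinearMap.opNorm_comp_le _ _).trans ?_
      gcongr
      exact hA.norm_step_le hp hd hα hαL _ _
    · rw [norm_smul, Real.norm_of_nonneg hα.le]
      gcongr
      exact hA.norm_hessXY_le hp _ _

include hA hp hd hμ hα hαL in
theorem innerGD_lip (y₀ : Vec d) (t : ℕ) (x x' : Vec p) :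
    ‖innerGD g α y₀ x t - innerGD g α y₀ x' t‖ ≤ Lg / μg * ‖x - x'‖ :=
  Convex.norm_image_sub_le_of_norm_hasFDerivWithin_le (s := Set.univ)
    (f := fun x => innerGD g α y₀ x t) (f' := fun x => jacGD g α y₀ x t)
    (fun x _ => (hA.hasFDerivAt_innerGD α y₀ x t).hasFDerivWithinAt)
    (fun x _ => hA.norm_jacGD_le hp hd hμ hα hαL y₀ x t) convex_univ
    (Set.mem_univ x') (Set.mem_univ x)

-- The difference of two Jacobians contracts and is fed by the variation of the second derivatives:
-- τ plus ρ times the Jacobian bound `Lg / μg`. Both are taken along x ↦ (x, yᵗ(x)), which is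
-- Lipschitz with constant `1 + Lg / μg`; dividing by `μg` gives `LJ`.
include hA hp hd hμ hα hαL in
theorem jacGD_lip (y₀ : Vec d) (t : ℕ) (x x' : Vec p) :
    ‖jacGD g α y₀ x t - jacGD g α y₀ x' t‖ ≤ LJ Lg μg ρ τ * ‖x - x'‖ := by
  have hq := hA.q_nonneg hp hd hα hαL
  have hL := hA.Lg_nonneg hp
  have hρ := hA.rho_nonneg hp
  have hτ := hA.tau_nonneg hp
  have hc : LJ Lg μg ρ τ * ‖x - x'‖ =
      ((τ + ρ * (Lg / μg)) * ((1 + Lg / μg) * ‖x - x'‖)) / μg := by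
    rw [LJ]; field_simp
  rw [hc]
  refine le_div_of_recursion (e := fun t => ‖jacGD g α y₀ x t - jacGD g α y₀ x' t‖) hμ hq ?_
    (fun t => ?_) t
  · simp only [jacGD, sub_self, norm_zero]; positivity
  set y := innerGD g α y₀ x t with hy
  set y' := innerGD g α y₀ x' t with hy'
  set J := jacGD g α y₀ x t with hJ
  set J' := jacGD g α y₀ x' t with hJ'
  have hyy : ‖x - x'‖ + ‖y - y'‖ ≤ (1 + Lg / μg) * ‖x - x'‖ := by
    have := hA.innerGD_lip hp hd hμ hα hαL y₀ t x x'
    linarith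
  have hJn : ‖J'‖ ≤ Lg / μg := hA.norm_jacGD_le hp hd hμ hα hαL y₀ x' t
  have hdec : jacGD g α y₀ x (t + 1) - jacGD g α y₀ x' (t + 1) =
      (ContinuousLinearMap.id ℝ (Vec d) - α • hessYY g x y) ∘L (J - J')
        - α • ((hessXY g x y - hessXY g x' y') + (hessYY g x y - hessYY g x' y') ∘L J') := by
    ext1 a
    simp only [jacGD, ← hy, ← hy', ← hJ, ← hJ', sub_apply, smul_apply, add_apply,
      ContinuousLinearMap.comp_apply, ContinuousLinearMap.id_apply, map_sub]
    module
  simp only [hdec]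
  refine (norm_sub_le _ _).trans (add_le_add ?_ ?_)
  · refine (ContinuousLinearMap.opNorm_comp_le _ _).trans ?_
    gcongr
    exact hA.norm_step_le hp hd hα hαL _ _
  · rw [norm_smul, Real.norm_of_nonneg hα.le]
    gcongr
    refine (norm_add_le _ _).trans ?_
    rw [add_mul]
    refine add_le_add ?_ ?_
    · exact (hA.hessXY_lip hp _ _ _ _).trans (mul_le_mul_of_nonneg_left hyy hτ)
    · refine (ContinuousLinearMap.opNorm_comp_le _ _).trans ?_
      have h1 := (hA.hessYY_lip hp x x' y y').trans (mul_le_mul_of_nonneg_left hyy hρ)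
      calc _ ≤ (ρ * ((1 + Lg / μg) * ‖x - x'‖)) * (Lg / μg) :=
            mul_le_mul h1 hJn (norm_nonneg _) (by positivity)
        _ = _ := by ring

include hA hp hd hμ hα hαL in
/-- First-order Taylor bound for the inner iterates. -/
theorem innerGD_taylor (y₀ : Vec d) (t : ℕ) (x v : Vec p) :
    ‖innerGD g α y₀ (x + v) t - innerGD g α y₀ x t - jacGD g α y₀ x t v‖
      ≤ LJ Lg μg ρ τ * ‖v‖ ^ 2 := by
  have hLJ : 0 ≤ LJ Lg μg ρ τ := by
    have hL := hA.Lg_nonneg hp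
    have hρ := hA.rho_nonneg hp
    have hτ := hA.tau_nonneg hp
    rw [LJ]; positivity
  -- The mean value inequality on this ball loses the factor 1/2 of Taylor's formula; the numerical
  -- bounds on the bias have room for it.
  have h := Convex.norm_image_sub_le_of_norm_hasFDerivWithin_le' (s := Metric.closedBall x ‖v‖)
    (f := fun x => innerGD g α y₀ x t) (f' := fun x => jacGD g α y₀ x t)
    (φ := jacGD g α y₀ x t) (C := LJ Lg μg ρ τ * ‖v‖) (x := x) (y := x + v)
    (fun x _ => (hA.hasFDerivAt_innerGD α y₀ x t).hasFDerivWithinAt)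
    (fun z hz => (hA.jacGD_lip hp hd hμ hα hαL y₀ t z x).trans
      (mul_le_mul_of_nonneg_left (by simpa [dist_eq_norm] using hz) hLJ))
    (convex_closedBall _ _) (Metric.mem_closedBall_self (norm_nonneg _)) (by simp)
  simp only [add_sub_cancel_left] at h
  refine h.trans_eq (by ring)

-- A coercive endomorphism is injective, hence bijective in finite dimension, so the equation behind
-- `jacStar` is solvable.
include hA hμ in
theorem jacStar_spec (x : Vec p) (a : Vec p) :
    hessYY g x (ystar g x) (jacStar g x a) = - hessXY g x (ystar g x) a := by
  have hinj : Function.Injective (hessYY g x (ystar g x)) := by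
    refine (injective_iff_map_eq_zero _).2 fun b hb => ?_
    have := hA.hessYY_coercive x (ystar g x) b
    rw [hb, inner_zero_left] at this
    have h2 : ‖b‖ ^ 2 ≤ 0 := nonpos_of_mul_nonpos_right this hμ
    exact norm_eq_zero.1 (pow_eq_zero_iff two_ne_zero |>.1 (le_antisymm h2 (sq_nonneg _)))
  let e := LinearEquiv.ofInjectiveEndo (hessYY g x (ystar g x)).toLinearMap hinj
  have hex : ∃ J : Vec p →L[ℝ] Vec d,
      hessYY g x (ystar g x) ∘L J = - hessXY g x (ystar g x) := by
    refine ⟨(e.symm.toLinearMap.toContinuousLinearMap) ∘L (- hessXY g x (ystar g x)), ?_⟩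
    ext1 a
    exact e.apply_symm_apply _
  have := Classical.epsilon_spec hex
  exact congrArg (fun A => A a) this

include hA hp hμ in
theorem norm_jacStar_le (x : Vec p) : ‖jacStar g x‖ ≤ Lg / μg := by
  refine ContinuousLinearMap.opNorm_le_bound _ (div_nonneg (hA.Lg_nonneg hp) hμ.le) fun a => ?_
  have h1 := hA.hessYY_coercive x (ystar g x) (jacStar g x a)
  rw [hA.jacStar_spec hμ] at h1
  have h2 := real_inner_le_norm (-hessXY g x (ystar g x) a) (jacStar g x a)
  rw [norm_neg] at h2
  have h3 := (hessXY g x (ystar g x)).le_of_opNorm_le (hA.norm_hessXY_le hp x (ystar g x)) a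
  rcases eq_or_lt_of_le (norm_nonneg (jacStar g x a)) with h | h
  · rw [← h]
    exact mul_nonneg (div_nonneg (hA.Lg_nonneg hp) hμ.le) (norm_nonneg _)
  · rw [div_mul_eq_mul_div, le_div_iff₀ hμ]
    have h4 := mul_le_mul_of_nonneg_right h3 h.le
    refine le_of_mul_le_mul_right ?_ h
    nlinarith

-- With H, B the second derivatives at y*, the Jacobian J* satisfies J* = (I - αH) J* - αB.
-- Subtracting this from the recursion, the error contracts by q and is fed by ‖yᵗ - y*‖ ≤ q^t D;
-- unrolling gives the term t q^(t-1).
include hA hp hd hμ hα hαL in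
theorem norm_jacGD_sub_jacStar_le {y₀ : Vec d} {D : ℝ} {x : Vec p}
    (hD : ‖y₀ - ystar g x‖ ≤ D) (t : ℕ) :
    ‖jacGD g α y₀ x t - jacStar g x‖ ≤ (1 - α * μg) ^ t * (Lg / μg)
      + α * ((τ + ρ * (Lg / μg)) * D) * (t * (1 - α * μg) ^ (t - 1)) := by
  have hq := hA.q_nonneg hp hd hα hαL
  have hL := hA.Lg_nonneg hp
  have hρ := hA.rho_nonneg hp
  have hτ := hA.tau_nonneg hp
  have hD0 : 0 ≤ D := (norm_nonneg _).trans hD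
  induction t with
  | zero => simpa [jacGD] using hA.norm_jacStar_le hp hμ x
  | succ t ih =>
    set y := innerGD g α y₀ x t with hy
    set J := jacGD g α y₀ x t with hJ
    have hyy : ‖x - x‖ + ‖y - ystar g x‖ ≤ (1 - α * μg) ^ t * D := by
      simpa using hA.norm_innerGD_sub_ystar_le hp hd hμ hα hαL hD t
    have hdec : jacGD g α y₀ x (t + 1) - jacStar g x =
        (ContinuousLinearMap.id ℝ (Vec d) - α • hessYY g x y) ∘L (J - jacStar g x)
          - α • ((hessXY g x y - hessXY g x (ystar g x))
            + (hessYY g x y - hessYY g x (ystar g x)) ∘L jacStar g x) := by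
      ext1 a
      simp only [jacGD, ← hy, ← hJ, sub_apply, smul_apply, add_apply,
        ContinuousLinearMap.comp_apply, ContinuousLinearMap.id_apply, map_sub,
        hA.jacStar_spec hμ]
      module
    -- At t = 0 the truncated exponent t - 1 is harmless because of the factor t.
    have hpow : (1 - α * μg) * (t * (1 - α * μg) ^ (t - 1)) = t * (1 - α * μg) ^ t := by
      cases t with
      | zero => simp
      | succ s => simp only [Nat.add_sub_cancel]; ring
    have h1 : ‖(ContinuousLinearMap.id ℝ (Vec d) - α • hessYY g x y) ∘L (J - jacStar g x)‖ ≤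
        (1 - α * μg) * ((1 - α * μg) ^ t * (Lg / μg)
          + α * ((τ + ρ * (Lg / μg)) * D) * (t * (1 - α * μg) ^ (t - 1))) := by
      refine (ContinuousLinearMap.opNorm_comp_le _ _).trans ?_
      exact mul_le_mul (hA.norm_step_le hp hd hα hαL _ _) ih (norm_nonneg _) hq
    have h2 : ‖α • ((hessXY g x y - hessXY g x (ystar g x))
            + (hessYY g x y - hessYY g x (ystar g x)) ∘L jacStar g x)‖ ≤
        α * ((τ + ρ * (Lg / μg)) * ((1 - α * μg) ^ t * D)) := by
      rw [norm_smul, Real.norm_of_nonneg hα.le]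
      gcongr
      refine (norm_add_le _ _).trans ?_
      rw [add_mul]
      refine add_le_add ?_ ?_
      · exact (hA.hessXY_lip hp _ _ _ _).trans (mul_le_mul_of_nonneg_left hyy hτ)
      · refine (ContinuousLinearMap.opNorm_comp_le _ _).trans ?_
        have h1 := (hA.hessYY_lip hp x x y (ystar g x)).trans (mul_le_mul_of_nonneg_left hyy hρ)
        calc _ ≤ (ρ * ((1 - α * μg) ^ t * D)) * (Lg / μg) :=
              mul_le_mul h1 (hA.norm_jacStar_le hp hμ x) (norm_nonneg _) (by positivity)
          _ = _ := by ring
    rw [hdec]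
    refine ((norm_sub_le _ _).trans (add_le_add h1 h2)).trans_eq ?_
    rw [mul_add, mul_left_comm (1 - α * μg) (α * _), hpow]
    simp only [Nat.add_sub_cancel]
    push_cast
    ring

include hA hp hd hμ in
/-- The inner solution is differentiable, with Jacobian `jacStar`. -/
theorem hasFDerivAt_ystar {y₀ : Vec d} {D : ℝ} (hD : ∀ x, ‖y₀ - ystar g x‖ ≤ D) (x : Vec p) :
    HasFDerivAt (ystar g) (jacStar g x) x ∧
      ∀ x', ‖jacStar g x - jacStar g x'‖ ≤ LJ Lg μg ρ τ * ‖x - x'‖ := by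
  have hL : 0 < Lg := hμ.trans_le (hA.mug_le_Lg hp hd)
  -- The step size is auxiliary: y* does not depend on it, and any admissible value serves.
  obtain ⟨α, hα, hαL⟩ : ∃ α : ℝ, 0 < α ∧ α * Lg ≤ 1 :=
    ⟨1 / Lg, by positivity, by field_simp; exact le_rfl⟩
  have hq := hA.q_nonneg hp hd hα hαL
  have hq1 : 1 - α * μg < 1 := by have := mul_pos hα hμ; linarith
  have ht1 : Tendsto (fun t : ℕ => (1 - α * μg) ^ t) atTop (𝓝 0) :=
    tendsto_pow_atTop_nhds_zero_of_lt_one hq hq1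
  have ht2 : Tendsto (fun t : ℕ => (t : ℝ) * (1 - α * μg) ^ (t - 1)) atTop (𝓝 0) := by
    rw [← tendsto_add_atTop_iff_nat 1]
    have h3 := tendsto_self_mul_const_pow_of_lt_one hq hq1
    simpa [add_mul] using h3.add ht1
  have hbound : Tendsto (fun t : ℕ => (1 - α * μg) ^ t * (Lg / μg)
      + α * ((τ + ρ * (Lg / μg)) * D) * (t * (1 - α * μg) ^ (t - 1))) atTop (𝓝 0) := by
    simpa using (ht1.mul_const (Lg / μg)).add (ht2.const_mul (α * ((τ + ρ * (Lg / μg)) * D)))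
  have hunif : TendstoUniformly (fun t x => jacGD g α y₀ x t) (jacStar g) atTop := by
    rw [Metric.tendstoUniformly_iff]
    intro ε hε
    filter_upwards [hbound.eventually_lt_const hε] with t ht x
    rw [dist_comm, dist_eq_norm]
    exact (hA.norm_jacGD_sub_jacStar_le hp hd hμ hα hαL (hD x) t).trans_lt ht
  refine ⟨hasFDerivAt_of_tendstoUniformly (l := atTop) hunif
    (fun t x => hA.hasFDerivAt_innerGD α y₀ x t) (fun x => ?_) x, fun x' => ?_⟩
  · rw [tendsto_iff_norm_sub_tendsto_zero]
    refine squeeze_zero (fun _ => norm_nonneg _)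
      (fun t => hA.norm_innerGD_sub_ystar_le hp hd hμ hα hαL (hD x) t) ?_
    simpa using ht1.mul_const D
  · exact le_of_tendsto ((hunif.tendsto_at x).sub (hunif.tendsto_at x')).norm
      (Eventually.of_forall fun t => hA.jacGD_lip hp hd hμ hα hαL y₀ t x x')

include hA hp hμ in
/-- If `Lg = μg` the inner problem decouples. -/
theorem hessXY_eq_zero (hLg : Lg = μg) (x : Vec p) (y : Vec d) : hessXY g x y = 0 := by
  have hinj : Function.Injective (hessYY g x y) := by
    refine (injective_iff_map_eq_zero _).2 fun b hb => ?_
    have := hA.hessYY_coercive x y b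
    rw [hb, inner_zero_left] at this
    have h2 : ‖b‖ ^ 2 ≤ 0 := nonpos_of_mul_nonpos_right this hμ
    exact norm_eq_zero.1 (pow_eq_zero_iff two_ne_zero |>.1 (le_antisymm h2 (sq_nonneg _)))
  have hsurj : Function.Surjective (hessYY g x y) :=
    LinearMap.injective_iff_surjective (f := (hessYY g x y).toLinearMap) |>.1 hinj
  ext1 a
  obtain ⟨c, hc⟩ := hsurj (hessXY g x y a)
  have hlow : μg * ‖c‖ ≤ ‖hessYY g x y c‖ := by
    rcases eq_or_lt_of_le (norm_nonneg c) with h | h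
    · rw [← h]; simp
    · refine le_of_mul_le_mul_right ?_ h
      have := (hA.hessYY_coercive x y c).trans (real_inner_le_norm _ _)
      nlinarith
  -- Apply the joint bound to (a, t c), where `hc` expresses the mixed term as H c. Since μg‖c‖ ≤ ‖H
  -- c‖ and Lg = μg, the t² terms cancel, and a bound linear in t survives for every t.
  have hall : ∀ t : ℝ, 2 * t * ‖hessXY g x y a‖ ^ 2 ≤ μg ^ 2 * ‖a‖ ^ 2 := by
    intro t
    have h1 := hA.norm_hess_apply_le hp x y a (t • c)
    rw [map_smul, hc] at h1
    have h2 : ‖hessXY g x y a + t • hessXY g x y a‖ ^ 2 ≤ (Lg * ‖pair a (t • c)‖) ^ 2 :=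
      pow_le_pow_left₀ (norm_nonneg _) h1 2
    rw [mul_pow, norm_pair_sq, norm_smul, Real.norm_eq_abs, mul_pow, sq_abs, hLg] at h2
    have h3 : hessXY g x y a + t • hessXY g x y a = (1 + t) • hessXY g x y a := by module
    rw [h3, norm_smul, mul_pow, Real.norm_eq_abs, sq_abs] at h2
    rw [hc] at hlow
    have h4 : (μg * ‖c‖) ^ 2 ≤ ‖hessXY g x y a‖ ^ 2 := pow_le_pow_left₀ (by positivity) hlow 2
    nlinarith [mul_le_mul_of_nonneg_left h4 (sq_nonneg t), sq_nonneg ‖hessXY g x y a‖]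
  by_contra hne
  have hpos : 0 < ‖hessXY g x y a‖ ^ 2 := by
    have : 0 < ‖hessXY g x y a‖ := norm_pos_iff.2 hne
    positivity
  have := hall ((μg ^ 2 * ‖a‖ ^ 2 + 1) / (2 * ‖hessXY g x y a‖ ^ 2))
  have h5 : 2 * ((μg ^ 2 * ‖a‖ ^ 2 + 1) / (2 * ‖hessXY g x y a‖ ^ 2)) * ‖hessXY g x y a‖ ^ 2
    = μg ^ 2 * ‖a‖ ^ 2 + 1 := by
    rw [mul_div_assoc', div_mul_eq_mul_div, div_eq_iff (by positivity)]; ring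
  linarith

include hA hp hμ in
theorem jacGD_eq_zero (hLg : Lg = μg) (α : ℝ) (y₀ : Vec d) (x : Vec p) (t : ℕ) :
    jacGD g α y₀ x t = 0 := by
  induction t with
  | zero => rfl
  | succ t ih =>
    ext1 a
    simp [jacGD, ih, hA.hessXY_eq_zero hp hμ hLg]

include hA hp hμ in
theorem jacStar_eq_zero (hLg : Lg = μg) (x : Vec p) : jacStar g x = 0 := by
  ext1 a
  have h := hA.jacStar_spec hμ x a
  rw [hA.hessXY_eq_zero hp hμ hLg] at h
  have h2 := hA.hessYY_coercive x (ystar g x) (jacStar g x a)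
  rw [h] at h2
  simp only [zero_apply, neg_zero, inner_zero_left] at h2
  have h3 : ‖jacStar g x a‖ ^ 2 ≤ 0 := nonpos_of_mul_nonpos_right h2 hμ
  exact norm_eq_zero.1 (pow_eq_zero_iff two_ne_zero |>.1 (le_antisymm h3 (sq_nonneg _)))

end

end Assumptions

end

/-! ### The hypergradient and the smoothness of the total objective. -/

section

variable {p d : ℕ} {f g : Joint p d → ℝ} {Lf Lg μg ρ τ M : ℝ}

/-- The hypergradient `∇ₓ f + (Jy*)ᵀ ∇_y f` at `(x, y*(x))`. -/
def gradPhi (f g : Joint p d → ℝ) (x : Vec p) : Vec p :=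
  gradX f x (ystar g x) + (jacStar g x).adjoint (gradY f x (ystar g x))

/-- A smoothness constant of the total objective. -/
def smoothPhi (Lf Lg μg ρ τ M : ℝ) : ℝ :=
  Lf * (1 + Lg / μg) ^ 2 + M * LJ Lg μg ρ τ

theorem LJ_nonneg {L : ℝ} (hL : 0 ≤ L) (hμ : 0 < μg) (hρ : 0 ≤ ρ) (hτ : 0 ≤ τ) :
    0 ≤ LJ L μg ρ τ := by
  rw [LJ]; positivity

theorem LJ_mono {L L' : ℝ} (hL : 0 ≤ L) (hLL : L ≤ L') (hμ : 0 < μg) (hρ : 0 ≤ ρ) (hτ : 0 ≤ τ) :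
    LJ L μg ρ τ ≤ LJ L' μg ρ τ := by
  have hL' := hL.trans hLL
  rw [LJ, LJ]; gcongr

theorem LPhi_pos {L : ℝ} (hL : 0 < L) (hμ : 0 < μg) (hρ : 0 ≤ ρ) (hτ : 0 ≤ τ) (hM : 0 ≤ M) :
    0 < LPhi L μg ρ τ M := by
  rw [LPhi]; positivity

/-- The only term not matched by `LPhi` is τM/μg, where `LPhi` has τM²/μg. It is at most τML/μg²
because μg ≤ L, at the price of the factor 2. -/
theorem smoothPhi_le (hμ : 0 < μg) (hμL : μg ≤ Lg) (hρ : 0 ≤ ρ) (hτ : 0 ≤ τ)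
    (hM : 0 ≤ M) : smoothPhi Lf Lg μg ρ τ M ≤ 2 * LPhi (max Lf Lg) μg ρ τ M := by
  set L := max Lf Lg with hL
  have hLg : Lg ≤ L := le_max_right _ _
  have hLg0 : 0 ≤ Lg := hμ.le.trans hμL
  have hL0 : 0 ≤ L := hLg0.trans hLg
  have h1 : smoothPhi Lf Lg μg ρ τ M ≤ smoothPhi L L μg ρ τ M := by
    rw [smoothPhi, smoothPhi]
    have := LJ_mono hLg0 hLg hμ hρ hτ
    have h2 : Lf ≤ L := le_max_left _ _
    gcongr
  have hk : 1 ≤ L / μg := by rw [le_div_iff₀ hμ]; linarith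
  have h2 : 2 * LPhi L μg ρ τ M - smoothPhi L L μg ρ τ M =
      L * (1 + L / μg) ^ 2 + 2 * (τ * M ^ 2 / μg) + τ * M / μg * (L / μg - 1)
        + ρ * L * M / μg ^ 2 * (1 + L / μg) := by
    rw [LPhi, smoothPhi, LJ]; field_simp; ring
  have h3 : 0 ≤ L * (1 + L / μg) ^ 2 + 2 * (τ * M ^ 2 / μg) + τ * M / μg * (L / μg - 1)
        + ρ * L * M / μg ^ 2 * (1 + L / μg) := by
    have : 0 ≤ L / μg - 1 := by linarith
    positivity
  linarith

namespace Assumptions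

theorem norm_gradient_f_le (hA : Assumptions f g Lf Lg μg ρ τ M) (hp : 1 ≤ p) (w : Joint p d) :
    ‖gradient f w‖ ≤ M := by
  rw [gradient, LinearIsometryEquiv.norm_map]
  exact (hA.f_diff w).hasFDerivAt.le_of_lip' (hA.M_nonneg hp)
    (Eventually.of_forall fun w' => hA.f_lip w' w)

theorem norm_gradX_f_le (hA : Assumptions f g Lf Lg μg ρ τ M) (hp : 1 ≤ p)
    (x : Vec p) (y : Vec d) : ‖gradX f x y‖ ≤ M := by
  rw [gradX_eq hA.f_diff]
  exact (norm_fst_le _).trans (hA.norm_gradient_f_le hp _)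

theorem norm_gradY_f_le (hA : Assumptions f g Lf Lg μg ρ τ M) (hp : 1 ≤ p)
    (x : Vec p) (y : Vec d) : ‖gradY f x y‖ ≤ M := by
  rw [gradY_eq hA.f_diff]
  exact (norm_snd_le _).trans (hA.norm_gradient_f_le hp _)

theorem gradX_f_lip (hA : Assumptions f g Lf Lg μg ρ τ M) (hp : 1 ≤ p)
    (x x' : Vec p) (y y' : Vec d) :
    ‖gradX f x y - gradX f x' y'‖ ≤ Lf * (‖x - x'‖ + ‖y - y'‖) := by
  rw [gradX_eq hA.f_diff, gradX_eq hA.f_diff]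
  refine (norm_fst_le (gradient f (pair x y) - gradient f (pair x' y'))).trans
    ((hA.f_grad_lip _ _).trans ?_)
  exact mul_le_mul_of_nonneg_left (norm_pair_le _ _) (hA.Lf_nonneg hp)

theorem gradY_f_lip (hA : Assumptions f g Lf Lg μg ρ τ M) (hp : 1 ≤ p)
    (x x' : Vec p) (y y' : Vec d) :
    ‖gradY f x y - gradY f x' y'‖ ≤ Lf * (‖x - x'‖ + ‖y - y'‖) := by
  rw [gradY_eq hA.f_diff, gradY_eq hA.f_diff]
  refine (norm_snd_le (gradient f (pair x y) - gradient f (pair x' y'))).trans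
    ((hA.f_grad_lip _ _).trans ?_)
  exact mul_le_mul_of_nonneg_left (norm_pair_le _ _) (hA.Lf_nonneg hp)

section

variable (hA : Assumptions f g Lf Lg μg ρ τ M) (hp : 1 ≤ p) (hd : 1 ≤ d) (hμ : 0 < μg)
  {y₀ : Vec d} {D : ℝ} (hD : ∀ x, ‖y₀ - ystar g x‖ ≤ D)

include hA hp hd hμ hD

theorem hasGradientAt_Phi (x : Vec p) : HasGradientAt (Phi f g) (gradPhi f g x) x := by
  rw [hasGradientAt_iff_hasFDerivAt]
  have hy := (hA.hasFDerivAt_ystar hp hd hμ hD x).1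
  have h := (hA.f_diff (pair x (ystar g x))).hasFDerivAt.comp x (hasFDerivAt_pair hy)
  refine HasFDerivAt.congr_fderiv (f := Phi f g) h ?_
  ext1 a
  have h1 : fderiv ℝ f (pair x (ystar g x)) (pair a (jacStar g x a)) =
      inner ℝ (gradX f x (ystar g x)) a + inner ℝ (gradY f x (ystar g x)) (jacStar g x a) := by
    rw [← inner_gradient_left, gradX_eq hA.f_diff, gradY_eq hA.f_diff, WithLp.prod_inner_apply]
    rfl
  rw [pair_eq a] at h1
  rw [InnerProductSpace.toDual_apply_apply, gradPhi, inner_add_left,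
    ContinuousLinearMap.adjoint_inner_left, ← h1]
  rfl

theorem differentiable_Phi : Differentiable ℝ (Phi f g) :=
  fun x => (hA.hasGradientAt_Phi hp hd hμ hD x).differentiableAt

theorem gradient_Phi (x : Vec p) : gradient (Phi f g) x = gradPhi f g x :=
  (hA.hasGradientAt_Phi hp hd hμ hD x).gradient

omit hd hD in
theorem norm_gradPhi_le (x : Vec p) : ‖gradPhi f g x‖ ≤ MPhi Lg μg M := by
  have hκ : 0 ≤ Lg / μg := div_nonneg (hA.Lg_nonneg hp) hμ.le
  refine (norm_add_le _ _).trans ?_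
  rw [MPhi, add_mul, one_mul]
  refine add_le_add (hA.norm_gradX_f_le hp _ _) ?_
  refine (ContinuousLinearMap.le_opNorm _ _).trans ?_
  rw [LinearIsometryEquiv.norm_map]
  exact mul_le_mul (hA.norm_jacStar_le hp hμ x) (hA.norm_gradY_f_le hp _ _) (norm_nonneg _) hκ

theorem ystar_lip (x x' : Vec p) : ‖ystar g x - ystar g x'‖ ≤ Lg / μg * ‖x - x'‖ :=
  Convex.norm_image_sub_le_of_norm_hasFDerivWithin_le (s := Set.univ)
    (fun x _ => (hA.hasFDerivAt_ystar hp hd hμ hD x).1.hasFDerivWithinAt)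
    (fun x _ => hA.norm_jacStar_le hp hμ x) convex_univ (Set.mem_univ x') (Set.mem_univ x)

theorem gradPhi_lip (x x' : Vec p) :
    ‖gradPhi f g x - gradPhi f g x'‖ ≤ smoothPhi Lf Lg μg ρ τ M * ‖x - x'‖ := by
  have hκ : 0 ≤ Lg / μg := div_nonneg (hA.Lg_nonneg hp) hμ.le
  have hLf := hA.Lf_nonneg hp
  have hM := hA.M_nonneg hp
  have hw : ‖x - x'‖ + ‖ystar g x - ystar g x'‖ ≤ (1 + Lg / μg) * ‖x - x'‖ := by
    have := hA.ystar_lip hp hd hμ hD x x'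
    linarith
  have hdec : gradPhi f g x - gradPhi f g x' =
      (gradX f x (ystar g x) - gradX f x' (ystar g x'))
      + (jacStar g x).adjoint (gradY f x (ystar g x) - gradY f x' (ystar g x'))
      + (jacStar g x - jacStar g x').adjoint (gradY f x' (ystar g x')) := by
    simp only [gradPhi, map_sub, sub_apply]; abel
  have h1 := (hA.gradX_f_lip hp x x' (ystar g x) (ystar g x')).trans
    (mul_le_mul_of_nonneg_left hw hLf)
  have h2 : ‖(jacStar g x).adjoint (gradY f x (ystar g x) - gradY f x' (ystar g x'))‖ ≤
      Lg / μg * (Lf * ((1 + Lg / μg) * ‖x - x'‖)) := by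
    refine (ContinuousLinearMap.le_opNorm _ _).trans ?_
    rw [LinearIsometryEquiv.norm_map]
    exact mul_le_mul (hA.norm_jacStar_le hp hμ x)
      ((hA.gradY_f_lip hp x x' _ _).trans (mul_le_mul_of_nonneg_left hw hLf)) (norm_nonneg _) hκ
  have h3 : ‖(jacStar g x - jacStar g x').adjoint (gradY f x' (ystar g x'))‖ ≤
      LJ Lg μg ρ τ * ‖x - x'‖ * M := by
    refine (ContinuousLinearMap.le_opNorm _ _).trans ?_
    rw [LinearIsometryEquiv.norm_map]
    exact mul_le_mul ((hA.hasFDerivAt_ystar hp hd hμ hD x).2 x') (hA.norm_gradY_f_le hp _ _)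
      (norm_nonneg _) (mul_nonneg (LJ_nonneg (hA.Lg_nonneg hp) hμ (hA.rho_nonneg hp)
        (hA.tau_nonneg hp)) (norm_nonneg _))
  rw [hdec]
  refine (norm_add₃_le.trans (add_le_add (add_le_add h1 h2) h3)).trans_eq ?_
  rw [smoothPhi]; ring

theorem continuous_gradPhi : Continuous (gradPhi f g) :=
  (LipschitzWith.of_dist_le_mul (K := Real.toNNReal (smoothPhi Lf Lg μg ρ τ M)) fun x x' => by
    rw [dist_eq_norm, dist_eq_norm]
    exact (hA.gradPhi_lip hp hd hμ hD x x').trans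
      (mul_le_mul_of_nonneg_right (Real.le_coe_toNNReal _) (norm_nonneg _))).continuous

theorem Phi_descent (x v : Vec p) : Phi f g (x + v) ≤ Phi f g x + inner ℝ (gradPhi f g x) v
    + smoothPhi Lf Lg μg ρ τ M / 2 * ‖v‖ ^ 2 :=
  descent_lemma (hA.hasGradientAt_Phi hp hd hμ hD) (hA.gradPhi_lip hp hd hμ hD) x v

theorem Phi_lip (x x' : Vec p) : |Phi f g x - Phi f g x'| ≤ MPhi Lg μg M * ‖x - x'‖ := by
  refine Convex.norm_image_sub_le_of_norm_hasFDerivWithin_le (s := Set.univ)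
    (fun x _ => (hA.hasGradientAt_Phi hp hd hμ hD x).hasFDerivAt.hasFDerivWithinAt)
    (fun x _ => ?_) convex_univ (Set.mem_univ x') (Set.mem_univ x)
  rw [LinearIsometryEquiv.norm_map]
  exact hA.norm_gradPhi_le hp hμ x

end

end Assumptions

end

/-! ### Gaussian moments. -/

section

section RealGaussian

theorem cosh_lower_bound (x : ℝ) : 1 + x ^ 2 / 2 + x ^ 4 / 24 + x ^ 6 / 720 ≤ Real.cosh x := by
  have h := sum_le_hasSum (Finset.range 4) (fun n _ => by
    have : 0 ≤ x ^ (2 * n) := (even_two_mul n).pow_nonneg x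
    positivity) (Real.hasSum_cosh x)
  refine le_trans (le_of_eq ?_) h
  simp [Finset.sum_range_succ, Nat.factorial]

theorem integrable_pow_gaussianReal (n : ℕ) :
    Integrable (fun x : ℝ => x ^ n) (gaussianReal 0 1) := by
  have h : MemLp (fun x : ℝ => x) n (gaussianReal 0 1) := memLp_id_gaussianReal n
  refine (h.integrable_norm_pow').mono (by fun_prop) (Eventually.of_forall fun x => ?_)
  simp

theorem integral_sq_gaussianReal : ∫ x, x ^ 2 ∂(gaussianReal 0 1) = 1 := by
  have h := variance_eq_sub (μ := gaussianReal 0 1) (X := fun x => x) (memLp_id_gaussianReal 2)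
  rw [variance_fun_id_gaussianReal, integral_id_gaussianReal] at h
  simpa using h.symm

/-- The expectation of cosh is e^(1/2) by the moment generating function, and the terms of order 0
and 2 account for 3/2. Both remaining moments are nonnegative, so each is bounded separately below:
crudely by 4 and 108, which suffices. -/
theorem integral_moments_gaussianReal :
    (∫ x, x ^ 4 ∂(gaussianReal 0 1)) / 24 + (∫ x, x ^ 6 ∂(gaussianReal 0 1)) / 720 ≤ 3 / 20 := by
  have hp : Integrable (fun x => Real.exp x) (gaussianReal 0 1) := by
    simpa using integrable_exp_mul_gaussianReal (μ := 0) (v := 1) 1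
  have hn : Integrable (fun x => Real.exp (-x)) (gaussianReal 0 1) := by
    simpa using integrable_exp_mul_gaussianReal (μ := 0) (v := 1) (-1)
  have hip : ∫ x, Real.exp x ∂(gaussianReal 0 1) = Real.exp (1 / 2) := by
    simpa [mgf] using congrFun (mgf_id_gaussianReal (μ := 0) (v := 1)) 1
  have hin : ∫ x, Real.exp (-x) ∂(gaussianReal 0 1) = Real.exp (1 / 2) := by
    simpa [mgf] using congrFun (mgf_id_gaussianReal (μ := 0) (v := 1)) (-1)
  have hcosh : ∫ x, Real.cosh x ∂(gaussianReal 0 1) = Real.exp (1 / 2) := by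
    simp only [Real.cosh_eq]
    rw [integral_div, integral_add hp hn, hip, hin]; ring
  have hci : Integrable (fun x => Real.cosh x) (gaussianReal 0 1) := by
    simp only [Real.cosh_eq]
    exact (hp.add hn).div_const 2
  have i2 := (integrable_pow_gaussianReal 2).div_const 2
  have i4 := (integrable_pow_gaussianReal 4).div_const 24
  have i6 := (integrable_pow_gaussianReal 6).div_const 720
  have h := integral_mono ((((integrable_const (1 : ℝ)).add i2).add i4).add i6) hci
    cosh_lower_bound
  have e1 : ∫ x, (1 + x ^ 2 / 2 + x ^ 4 / 24 + x ^ 6 / 720) ∂(gaussianReal 0 1) =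
      1 + 1 / 2 + (∫ x, x ^ 4 ∂(gaussianReal 0 1)) / 24
        + (∫ x, x ^ 6 ∂(gaussianReal 0 1)) / 720 := by
    have j2 : Integrable (fun x : ℝ => 1 + x ^ 2 / 2) (gaussianReal 0 1) :=
      (integrable_const (1 : ℝ)).add i2
    have j4 : Integrable (fun x : ℝ => 1 + x ^ 2 / 2 + x ^ 4 / 24) (gaussianReal 0 1) := j2.add i4
    rw [integral_add j4 i6, integral_add j2 i4, integral_add (integrable_const (1 : ℝ)) i2, integral_div, integral_div, integral_div,
      integral_sq_gaussianReal]
    simp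
  have h' : ∫ x, (1 + x ^ 2 / 2 + x ^ 4 / 24 + x ^ 6 / 720) ∂(gaussianReal 0 1) ≤
      ∫ x, Real.cosh x ∂(gaussianReal 0 1) := h
  rw [e1, hcosh] at h'
  -- (33/20)² = 2.7225 exceeds e, and 33/20 - 3/2 = 3/20.
  have hexp : Real.exp (1 / 2) ≤ 33 / 20 := by
    have h1 : Real.exp (1 / 2) ^ 2 = Real.exp 1 := by
      rw [← Real.exp_nat_mul]; norm_num
    have h2 := Real.exp_one_lt_d9
    nlinarith [Real.exp_pos (1 / 2)]
  linarith

theorem integral_pow_four_gaussianReal_le : ∫ x, x ^ 4 ∂(gaussianReal 0 1) ≤ 4 := by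
  have h := integral_moments_gaussianReal
  have h6 : 0 ≤ ∫ x, x ^ 6 ∂(gaussianReal 0 1) :=
    integral_nonneg fun x => (show Even 6 by decide).pow_nonneg x
  linarith

theorem integral_pow_six_gaussianReal_le : ∫ x, x ^ 6 ∂(gaussianReal 0 1) ≤ 108 := by
  have h := integral_moments_gaussianReal
  have h4 : 0 ≤ ∫ x, x ^ 4 ∂(gaussianReal 0 1) :=
    integral_nonneg fun x => (show Even 4 by decide).pow_nonneg x
  linarith

end RealGaussian

section StdGaussian

variable {p : ℕ}

theorem integrable_norm_pow_stdGaussian (n : ℕ) :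
    Integrable (fun u : Vec p => ‖u‖ ^ n) (stdGaussian (Vec p)) :=
  (IsGaussian.memLp_id (stdGaussian (Vec p)) n (by simp)).integrable_norm_pow'

/-- Continuous functions of polynomial growth are integrable. -/
theorem integrable_stdGaussian_of_norm_le {E : Type*} [NormedAddCommGroup E] {h : Vec p → E}
    (hm : AEStronglyMeasurable h (stdGaussian (Vec p))) {C : ℝ} {n : ℕ}
    (hb : ∀ u, ‖h u‖ ≤ C * ‖u‖ ^ n) : Integrable h (stdGaussian (Vec p)) :=
  ((integrable_norm_pow_stdGaussian n).const_mul C).mono' hm (Eventually.of_forall hb)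

theorem map_inner_stdGaussian {a : Vec p} (ha : ‖a‖ = 1) :
    (stdGaussian (Vec p)).map (fun u => inner ℝ a u) = gaussianReal 0 1 := by
  have h := IsGaussian.map_eq_gaussianReal (μ := stdGaussian (Vec p)) (innerSL ℝ a)
  rw [integral_strongDual_stdGaussian, variance_dual_stdGaussian, innerSL_apply_norm, ha] at h
  simpa using h

theorem integral_inner_pow_stdGaussian (a : Vec p) (n : ℕ) :
    ∫ u, (inner ℝ a u) ^ n ∂(stdGaussian (Vec p)) = ‖a‖ ^ n * ∫ x, x ^ n ∂(gaussianReal 0 1) := by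
  rcases eq_or_ne a 0 with rfl | ha
  · rcases eq_or_ne n 0 with rfl | hn
    · simp
    · simp [hn]
  · have hna : ‖a‖ ≠ 0 := norm_ne_zero_iff.2 ha
    have h1 : ‖‖a‖⁻¹ • a‖ = 1 := by
      rw [norm_smul, norm_inv, norm_norm, inv_mul_cancel₀ hna]
    rw [← map_inner_stdGaussian h1, integral_map (by fun_prop) (by fun_prop),
      ← integral_const_mul]
    congr 1
    ext u
    rw [← mul_pow, inner_smul_left]
    congr 1
    simp [hna]

theorem integral_inner_sq_stdGaussian (a : Vec p) :
    ∫ u, (inner ℝ a u) ^ 2 ∂(stdGaussian (Vec p)) = ‖a‖ ^ 2 := by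
  rw [integral_inner_pow_stdGaussian, integral_sq_gaussianReal, mul_one]

theorem integral_inner_pow_four_stdGaussian_le (a : Vec p) :
    ∫ u, (inner ℝ a u) ^ 4 ∂(stdGaussian (Vec p)) ≤ 4 * ‖a‖ ^ 4 := by
  rw [integral_inner_pow_stdGaussian, mul_comm]
  exact mul_le_mul_of_nonneg_right integral_pow_four_gaussianReal_le (by positivity)

theorem integrable_inner_pow_stdGaussian (a : Vec p) (n : ℕ) :
    Integrable (fun u => (inner ℝ a u : ℝ) ^ n) (stdGaussian (Vec p)) := by
  refine integrable_stdGaussian_of_norm_le (C := ‖a‖ ^ n) (n := n) (by fun_prop) fun u => ?_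
  rw [norm_pow, ← mul_pow]
  exact pow_le_pow_left₀ (norm_nonneg _) (norm_inner_le_norm a u) n

theorem coord_eq_inner (u : Vec p) (i : Fin p) :
    u i = inner ℝ (EuclideanSpace.single i (1 : ℝ)) u := by
  simp [EuclideanSpace.inner_single_left]

theorem integrable_coord_pow_stdGaussian (i : Fin p) (n : ℕ) :
    Integrable (fun u : Vec p => u i ^ n) (stdGaussian (Vec p)) := by
  simp only [coord_eq_inner]
  exact integrable_inner_pow_stdGaussian _ n

theorem integral_coord_pow_stdGaussian (i : Fin p) (n : ℕ) :
    ∫ u : Vec p, u i ^ n ∂(stdGaussian (Vec p)) = ∫ x, x ^ n ∂(gaussianReal 0 1) := by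
  simp only [coord_eq_inner]
  rw [integral_inner_pow_stdGaussian]
  simp

theorem integral_norm_pow_four_stdGaussian_le :
    ∫ u : Vec p, ‖u‖ ^ 4 ∂(stdGaussian (Vec p)) ≤ 4 * (p : ℝ) ^ 2 := by
  have hpt : ∀ u : Vec p, ‖u‖ ^ 4 ≤ p * ∑ i, u i ^ 4 := by
    intro u
    have h := sq_sum_le_card_mul_sum_sq (s := Finset.univ) (f := fun i => u i ^ 2)
    rw [← EuclideanSpace.real_norm_sq_eq] at h
    simpa [← pow_mul] using h
  have hint : Integrable (fun u : Vec p => ∑ i, u i ^ 4) (stdGaussian (Vec p)) :=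
    integrable_finsetSum _ fun i _ => integrable_coord_pow_stdGaussian i 4
  calc ∫ u : Vec p, ‖u‖ ^ 4 ∂(stdGaussian (Vec p))
      ≤ ∫ u : Vec p, p * ∑ i, u i ^ 4 ∂(stdGaussian (Vec p)) :=
        integral_mono (integrable_norm_pow_stdGaussian 4) (hint.const_mul _) hpt
    _ = p * (p * ∫ x, x ^ 4 ∂(gaussianReal 0 1)) := by
        rw [integral_const_mul, integral_finsetSum _ fun i _ => integrable_coord_pow_stdGaussian i 4]
        simp [integral_coord_pow_stdGaussian]
    _ ≤ p * (p * 4) := by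
        have := integral_pow_four_gaussianReal_le
        gcongr
    _ = _ := by ring

theorem integral_norm_pow_six_stdGaussian_le (hp : 1 ≤ p) :
    ∫ u : Vec p, ‖u‖ ^ 6 ∂(stdGaussian (Vec p)) ≤ 108 * (p : ℝ) ^ 3 := by
  have hp' : (0 : ℝ) < p := by exact_mod_cast hp
  have hpt : ∀ u : Vec p, ‖u‖ ^ 6 ≤ p ^ 2 * ∑ i, u i ^ 6 := by
    intro u
    have h := pow_sum_div_card_le_sum_pow (s := Finset.univ) (f := fun i => u i ^ 2)
      (fun i _ => sq_nonneg _) 2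
    rw [← EuclideanSpace.real_norm_sq_eq, Finset.card_univ, Fintype.card_fin,
      div_le_iff₀ (by positivity)] at h
    rw [mul_comm]
    simpa [← pow_mul] using h
  have hint : Integrable (fun u : Vec p => ∑ i, u i ^ 6) (stdGaussian (Vec p)) :=
    integrable_finsetSum _ fun i _ => integrable_coord_pow_stdGaussian i 6
  calc ∫ u : Vec p, ‖u‖ ^ 6 ∂(stdGaussian (Vec p))
      ≤ ∫ u : Vec p, p ^ 2 * ∑ i, u i ^ 6 ∂(stdGaussian (Vec p)) :=
        integral_mono (integrable_norm_pow_stdGaussian 6) (hint.const_mul _) hpt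
    _ = p ^ 2 * (p * ∫ x, x ^ 6 ∂(gaussianReal 0 1)) := by
        rw [integral_const_mul, integral_finsetSum _ fun i _ => integrable_coord_pow_stdGaussian i 6]
        simp [integral_coord_pow_stdGaussian]
    _ ≤ p ^ 2 * (p * 108) := by
        have := integral_pow_six_gaussianReal_le
        gcongr
    _ = _ := by ring

theorem integrable_inner_sq_mul_norm_sq (a : Vec p) :
    Integrable (fun u => (inner ℝ a u) ^ 2 * ‖u‖ ^ 2) (stdGaussian (Vec p)) := by
  refine integrable_stdGaussian_of_norm_le (C := ‖a‖ ^ 2) (n := 4) (by fun_prop) fun u => ?_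
  rw [norm_mul, norm_pow, norm_pow, norm_norm]
  have := pow_le_pow_left₀ (norm_nonneg _) (norm_inner_le_norm (𝕜 := ℝ) a u) 2
  calc _ ≤ (‖a‖ * ‖u‖) ^ 2 * ‖u‖ ^ 2 := by gcongr
    _ = _ := by ring

theorem integral_inner_sq_mul_norm_sq_le (a : Vec p) :
    ∫ u, (inner ℝ a u) ^ 2 * ‖u‖ ^ 2 ∂(stdGaussian (Vec p)) ≤ 4 * p * ‖a‖ ^ 2 := by
  rcases eq_or_ne a 0 with rfl | ha
  · simp
  have hna : 0 < ‖a‖ := norm_pos_iff.2 ha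
  -- Young's inequality coordinate by coordinate, weighted so that the two fourth moments contribute
  -- at most 2‖a‖² each.
  have hpt : ∀ u : Vec p, (inner ℝ a u) ^ 2 * ‖u‖ ^ 2 ≤
      ∑ i : Fin p, (1 / (2 * ‖a‖ ^ 2) * (inner ℝ a u) ^ 4 + ‖a‖ ^ 2 / 2 * u i ^ 4) := by
    intro u
    rw [EuclideanSpace.real_norm_sq_eq, Finset.mul_sum]
    refine Finset.sum_le_sum fun i _ => ?_
    have h : 1 / (2 * ‖a‖ ^ 2) * (inner ℝ a u : ℝ) ^ 4 + ‖a‖ ^ 2 / 2 * u i ^ 4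
      - (inner ℝ a u) ^ 2 * u i ^ 2 =
      1 / (2 * ‖a‖ ^ 2) * ((inner ℝ a u) ^ 2 - ‖a‖ ^ 2 * u i ^ 2) ^ 2 := by
      field_simp; ring
    have h2 : 0 ≤ 1 / (2 * ‖a‖ ^ 2) * ((inner ℝ a u : ℝ) ^ 2 - ‖a‖ ^ 2 * u i ^ 2) ^ 2 := by
      positivity
    linarith
  have hi : ∀ i ∈ Finset.univ, Integrable (fun u : Vec p =>
      1 / (2 * ‖a‖ ^ 2) * (inner ℝ a u) ^ 4 + ‖a‖ ^ 2 / 2 * u i ^ 4) (stdGaussian (Vec p)) :=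
    fun i _ => ((integrable_inner_pow_stdGaussian a 4).const_mul _).add
      ((integrable_coord_pow_stdGaussian i 4).const_mul _)
  refine (integral_mono (integrable_inner_sq_mul_norm_sq a) (integrable_finsetSum _ hi) hpt).trans ?_
  rw [integral_finsetSum _ hi]
  have hterm : ∀ i ∈ Finset.univ, ∫ u : Vec p,
      (1 / (2 * ‖a‖ ^ 2) * (inner ℝ a u) ^ 4 + ‖a‖ ^ 2 / 2 * u i ^ 4) ∂(stdGaussian (Vec p))
      ≤ 4 * ‖a‖ ^ 2 := by
    intro i _
    rw [integral_add ((integrable_inner_pow_stdGaussian a 4).const_mul _)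
      ((integrable_coord_pow_stdGaussian i 4).const_mul _), integral_const_mul, integral_const_mul,
      integral_coord_pow_stdGaussian]
    calc _ ≤ 1 / (2 * ‖a‖ ^ 2) * (4 * ‖a‖ ^ 4) + ‖a‖ ^ 2 / 2 * 4 := by
          gcongr
          · exact integral_inner_pow_four_stdGaussian_le a
          · exact integral_pow_four_gaussianReal_le
      _ = _ := by field_simp; ring
  refine (Finset.sum_le_sum hterm).trans_eq ?_
  simp; ring

theorem integral_inner_mul_inner_stdGaussian (a b : Vec p) :
    ∫ u, inner ℝ a u * inner ℝ b u ∂(stdGaussian (Vec p)) = inner ℝ a b := by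
  have h := covarianceBilin_apply (μ := stdGaussian (Vec p)) IsGaussian.memLp_two_id a b
  rw [covarianceBilin_stdGaussian] at h
  simp only [id_eq, integral_id_stdGaussian, sub_zero] at h
  exact h.symm

end StdGaussian

/-! ### Bias and variance of a mean of independent copies. -/

section Averaging

variable {α : Type*} [MeasurableSpace α] {ν : Measure α} [IsProbabilityMeasure ν] {p Q : ℕ}

theorem integral_comp_eval_pi {E : Type*} [NormedAddCommGroup E] [NormedSpace ℝ E] {h : α → E}
    (hh : AEStronglyMeasurable h ν) (j : Fin Q) :
    ∫ u : Fin Q → α, h (u j) ∂(Measure.pi fun _ => ν) = ∫ x, h x ∂ν := by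
  have hmp := measurePreserving_eval (fun _ : Fin Q => ν) j
  have h2 := integral_map (f := h) hmp.measurable.aemeasurable (by rw [hmp.map_eq]; exact hh)
  rw [hmp.map_eq] at h2
  exact h2.symm

theorem integrable_comp_eval_pi {E : Type*} [NormedAddCommGroup E] {h : α → E}
    (hh : Integrable h ν) (j : Fin Q) :
    Integrable (fun u : Fin Q → α => h (u j)) (Measure.pi fun _ => ν) :=
  (measurePreserving_eval (fun _ : Fin Q => ν) j).integrable_comp_of_integrable hh

theorem memLp_comp_eval_pi {E : Type*} [NormedAddCommGroup E] {h : α → E} {r : ENNReal}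
    (hh : MemLp h r ν) (j : Fin Q) :
    MemLp (fun u : Fin Q → α => h (u j)) r (Measure.pi fun _ => ν) :=
  hh.comp_measurePreserving (measurePreserving_eval (fun _ : Fin Q => ν) j)

/-- Bias-variance bound for the mean of independent copies, real case. -/
theorem integral_sq_average_sub_le {X : α → ℝ} (hX : MemLp X 2 ν) (hQ : 1 ≤ Q) (c : ℝ) :
    ∫ u : Fin Q → α, ((Q : ℝ)⁻¹ * ∑ j, X (u j) - c) ^ 2 ∂(Measure.pi fun _ => ν)
      ≤ (Q : ℝ)⁻¹ * ∫ x, X x ^ 2 ∂ν + (∫ x, X x ∂ν - c) ^ 2 := by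
  have hQ0 : (Q : ℝ) ≠ 0 := by positivity
  have hS : MemLp (∑ j : Fin Q, fun u : Fin Q → α => X (u j)) 2 (Measure.pi fun _ => ν) :=
    memLp_finsetSum' _ fun j _ => memLp_comp_eval_pi hX j
  have hY : MemLp (fun u : Fin Q → α => (Q : ℝ)⁻¹ * ∑ j, X (u j) - c) 2
      (Measure.pi fun _ => ν) := by
    have := (hS.const_mul (Q : ℝ)⁻¹).sub (memLp_const c)
    convert this using 2 with u
    simp
  have hvar : Var[fun u : Fin Q → α => (Q : ℝ)⁻¹ * ∑ j, X (u j) - c; Measure.pi fun _ => ν]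
      = (Q : ℝ)⁻¹ * Var[X; ν] := by
    rw [variance_sub_const (by
      have := (hS.const_mul (Q : ℝ)⁻¹).1
      convert this using 2 with u
      simp)]
    rw [variance_const_mul]
    have : (fun u : Fin Q → α => ∑ j, X (u j)) = ∑ j : Fin Q, fun u : Fin Q → α => X (u j) := by
      ext u; simp
    rw [this, variance_sum_pi fun _ => hX]
    simp
    field_simp
  have hmean : ∫ u : Fin Q → α, ((Q : ℝ)⁻¹ * ∑ j, X (u j) - c) ∂(Measure.pi fun _ => ν)
      = ∫ x, X x ∂ν - c := by
    have hXi : Integrable X ν := hX.integrable one_le_two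
    rw [integral_sub ((integrable_finsetSum _ fun j _ => integrable_comp_eval_pi hXi j).const_mul _)
      (integrable_const c), integral_const_mul,
      integral_finsetSum _ fun j _ => integrable_comp_eval_pi hXi j]
    simp_rw [integral_comp_eval_pi hXi.1]
    simp [hQ0]
  have h := variance_eq_sub hY
  rw [hvar, hmean] at h
  -- Only the variance is divided by Q; replacing it by the second moment avoids handling the mean
  -- separately.
  have h2 := variance_le_expectation_sq (μ := ν) hX.1
  simp only [Pi.pow_apply] at h h2
  have h3 : (Q : ℝ)⁻¹ * Var[X; ν] ≤ (Q : ℝ)⁻¹ * ∫ x, X x ^ 2 ∂ν := by gcongr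
  linarith

/-- Bias-variance bound for the mean of independent copies. -/
theorem integral_norm_sq_average_sub_le {h : α → Vec p} (hh : MemLp h 2 ν) (hQ : 1 ≤ Q)
    (c : Vec p) :
    ∫ u : Fin Q → α, ‖(Q : ℝ)⁻¹ • ∑ j, h (u j) - c‖ ^ 2 ∂(Measure.pi fun _ => ν)
      ≤ (Q : ℝ)⁻¹ * ∫ x, ‖h x‖ ^ 2 ∂ν + ‖∫ x, h x ∂ν - c‖ ^ 2 := by
  have hc : ∀ i, MemLp (fun x => h x i) 2 ν := fun i =>
    (EuclideanSpace.proj (𝕜 := ℝ) i).comp_memLp' hh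
  have hS : ∀ i, MemLp (fun u : Fin Q → α => (Q : ℝ)⁻¹ * ∑ j, h (u j) i - c i) 2
      (Measure.pi fun _ => ν) := fun i =>
    ((memLp_finsetSum _ fun j _ => memLp_comp_eval_pi (hc i) j).const_mul _).sub (memLp_const _)
  have hmean : ∀ i, (∫ x, h x ∂ν) i = ∫ x, h x i ∂ν := fun i =>
    ((EuclideanSpace.proj (𝕜 := ℝ) i).integral_comp_comm (hh.integrable one_le_two)).symm
  have hsq : ∀ i ∈ Finset.univ, Integrable (fun x => h x i ^ 2) ν := fun i _ => (hc i).integrable_sq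
  simp only [EuclideanSpace.real_norm_sq_eq]
  rw [integral_finsetSum _ hsq, Finset.mul_sum, ← Finset.sum_add_distrib]
  have e : ∀ u : Fin Q → α, ∑ i, ((Q : ℝ)⁻¹ • ∑ j, h (u j) - c) i ^ 2 =
      ∑ i, ((Q : ℝ)⁻¹ * ∑ j, h (u j) i - c i) ^ 2 := by
    intro u; simp
  simp only [e]
  rw [integral_finsetSum _ fun i _ => (hS i).integrable_sq]
  refine Finset.sum_le_sum fun i _ => ?_
  have := integral_sq_average_sub_le (hc i) hQ (c i)
  rw [PiLp.sub_apply, hmean]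
  exact this

end Averaging

end

/-! ### The Gaussian smoothing estimator along one direction. -/

section

variable {p d Q : ℕ} {f g : Joint p d → ℝ} {Lf Lg μg ρ τ M : ℝ}

/-- The contribution `⟨δ(x; u), ∇_y f(x, yᴺ(x))⟩ u` of one direction to the estimator. -/
def dirEst (f g : Joint p d → ℝ) (α μ : ℝ) (y₀ : Vec d) (N : ℕ) (x u : Vec p) : Vec p :=
  (inner ℝ (delta g α μ y₀ N x u) (gradY f x (innerGD g α y₀ x N)) : ℝ) • u

theorem hyperGradEst_eq (f g : Joint p d → ℝ) (α μ : ℝ) (y₀ : Vec d) (N : ℕ)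
    (x : Vec p) (u : Fin Q → Vec p) : hyperGradEst f g α μ y₀ N x u =
      gradX f x (innerGD g α y₀ x N) + (Q : ℝ)⁻¹ • ∑ j, dirEst f g α μ y₀ N x (u j) := rfl

namespace Assumptions

section

variable (hA : Assumptions f g Lf Lg μg ρ τ M)

include hA in
theorem continuous_innerGD (α : ℝ) (y₀ : Vec d) (N : ℕ) :
    Continuous fun x => innerGD g α y₀ x N :=
  continuous_iff_continuousAt.2 fun x => (hA.hasFDerivAt_innerGD α y₀ x N).continuousAt

include hA in
theorem continuous_gradient_f (hp : 1 ≤ p) : Continuous (gradient f) :=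
  (LipschitzWith.of_dist_le_mul (K := ⟨Lf, hA.Lf_nonneg hp⟩) fun w w' => by
    rw [dist_eq_norm, dist_eq_norm]; exact hA.f_grad_lip w w').continuous

theorem continuous_pair_comp {X : Type*} [TopologicalSpace X] {a : X → Vec p} {b : X → Vec d}
    (ha : Continuous a) (hb : Continuous b) : Continuous fun t => pair (a t) (b t) := by
  simp only [pair_eq]
  exact ((inlJ p d).continuous.comp ha).add ((inrJ p d).continuous.comp hb)

include hA in
theorem continuous_gradX_comp (hp : 1 ≤ p) {X : Type*} [TopologicalSpace X] {a : X → Vec p}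
    {b : X → Vec d} (ha : Continuous a) (hb : Continuous b) :
    Continuous fun t => gradX f (a t) (b t) := by
  simp only [gradX_eq hA.f_diff]
  exact (WithLp.prod_continuous_ofLp 2 _ _).fst.comp
    ((hA.continuous_gradient_f hp).comp (continuous_pair_comp ha hb))

include hA in
theorem continuous_gradY_comp (hp : 1 ≤ p) {X : Type*} [TopologicalSpace X] {a : X → Vec p}
    {b : X → Vec d} (ha : Continuous a) (hb : Continuous b) :
    Continuous fun t => gradY f (a t) (b t) := by
  simp only [gradY_eq hA.f_diff]
  exact (WithLp.prod_continuous_ofLp 2 _ _).snd.comp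
    ((hA.continuous_gradient_f hp).comp (continuous_pair_comp ha hb))

include hA in
theorem continuous_dirEst_comp (hp : 1 ≤ p) (α μ : ℝ) (y₀ : Vec d) (N : ℕ) {X : Type*}
    [TopologicalSpace X] {a b : X → Vec p} (ha : Continuous a) (hb : Continuous b) :
    Continuous fun t => dirEst f g α μ y₀ N (a t) (b t) := by
  have hi := hA.continuous_innerGD α y₀ N
  have h1 : Continuous fun t => delta g α μ y₀ N (a t) (b t) :=
    ((hi.comp (ha.add (hb.const_smul μ))).sub (hi.comp ha)).const_smul μ⁻¹
  exact (Continuous.inner (𝕜 := ℝ) h1 (hA.continuous_gradY_comp hp ha (hi.comp ha))).smul hb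

include hA in
theorem continuous_hyperGradEst (hp : 1 ≤ p) (α μ : ℝ) (y₀ : Vec d) (N : ℕ) :
    Continuous fun z : Vec p × (Fin Q → Vec p) => hyperGradEst f g α μ y₀ N z.1 z.2 := by
  simp only [hyperGradEst_eq]
  refine (hA.continuous_gradX_comp hp continuous_fst
    ((hA.continuous_innerGD α y₀ N).comp continuous_fst)).add ?_
  refine Continuous.const_smul (g := fun z : Vec p × (Fin Q → Vec p) =>
    ∑ j, dirEst f g α μ y₀ N z.1 (z.2 j)) ?_ (Q : ℝ)⁻¹
  exact continuous_finsetSum _ fun j _ => hA.continuous_dirEst_comp hp α μ y₀ N continuous_fst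
    ((continuous_apply j).comp continuous_snd)

variable (hp : 1 ≤ p) (hd : 1 ≤ d) (hμg : 0 < μg)
  {α μ : ℝ} (hα : 0 < α) (hαL : α * Lg ≤ 1) (hμ : 0 < μ) (y₀ : Vec d) (N : ℕ) (x : Vec p)

include hA hp hd hμg hα hαL hμ

theorem norm_delta_le (u : Vec p) : ‖delta g α μ y₀ N x u‖ ≤ Lg / μg * ‖u‖ := by
  have h := hA.innerGD_lip hp hd hμg hα hαL y₀ N (x + μ • u) x
  rw [add_sub_cancel_left, norm_smul, Real.norm_of_nonneg hμ.le] at h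
  rw [delta, norm_smul, norm_inv, Real.norm_of_nonneg hμ.le, inv_mul_le_iff₀ hμ]
  linarith

theorem norm_delta_sub_le (u : Vec p) :
    ‖delta g α μ y₀ N x u - jacGD g α y₀ x N u‖ ≤ μ * LJ Lg μg ρ τ * ‖u‖ ^ 2 := by
  have h := hA.innerGD_taylor hp hd hμg hα hαL y₀ N x (μ • u)
  have e : delta g α μ y₀ N x u - jacGD g α y₀ x N u =
      μ⁻¹ • (innerGD g α y₀ (x + μ • u) N - innerGD g α y₀ x N - jacGD g α y₀ x N (μ • u)) := by
    rw [delta, map_smul, smul_sub μ⁻¹ (_ - _), smul_smul, inv_mul_cancel₀ hμ.ne', one_smul]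
  rw [norm_smul, Real.norm_of_nonneg hμ.le] at h
  rw [e, norm_smul, norm_inv, Real.norm_of_nonneg hμ.le, inv_mul_le_iff₀ hμ]
  refine h.trans_eq (by ring)

/-- Serves integrability only: squaring this growth bound would cost p² in the second moment, where
a leading term linear in p is needed. -/
theorem norm_dirEst_le (u : Vec p) :
    ‖dirEst f g α μ y₀ N x u‖ ≤ Lg / μg * M * ‖u‖ ^ 2 := by
  rw [dirEst, norm_smul]
  have h1 := hA.norm_delta_le hp hd hμg hα hαL hμ y₀ N x u
  have h2 := hA.norm_gradY_f_le hp x (innerGD g α y₀ x N)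
  have hκ : 0 ≤ Lg / μg := div_nonneg (hA.Lg_nonneg hp) hμg.le
  calc _ ≤ (Lg / μg * ‖u‖ * M) * ‖u‖ := by
        gcongr
        exact (norm_inner_le_norm _ _).trans (mul_le_mul h1 h2 (norm_nonneg _) (by positivity))
    _ = _ := by ring

theorem norm_hyperGradEst_le (u : Fin Q → Vec p) :
    ‖hyperGradEst f g α μ y₀ N x u‖ ≤ M + Lg / μg * M * ∑ j, ‖u j‖ ^ 2 := by
  rw [hyperGradEst_eq]
  have hκ : 0 ≤ Lg / μg := div_nonneg (hA.Lg_nonneg hp) hμg.le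
  have hM := hA.M_nonneg hp
  refine (norm_add_le _ _).trans (add_le_add (hA.norm_gradX_f_le hp _ _) ?_)
  rw [norm_smul, norm_inv, Real.norm_natCast, Finset.mul_sum]
  have h1 : ‖∑ j, dirEst f g α μ y₀ N x (u j)‖ ≤ ∑ j, Lg / μg * M * ‖u j‖ ^ 2 :=
    norm_sum_le_of_le _ fun j _ => hA.norm_dirEst_le hp hd hμg hα hαL hμ y₀ N x (u j)
  calc _ ≤ 1 * ∑ j, Lg / μg * M * ‖u j‖ ^ 2 := by
        gcongr
        exact Nat.cast_inv_le_one Q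
    _ = _ := one_mul _

theorem memLp_dirEst : MemLp (dirEst f g α μ y₀ N x) 2 (stdGaussian (Vec p)) := by
  have hc : Continuous (dirEst f g α μ y₀ N x) :=
    hA.continuous_dirEst_comp hp α μ y₀ N continuous_const continuous_id
  rw [memLp_two_iff_integrable_sq_norm hc.aestronglyMeasurable]
  refine integrable_stdGaussian_of_norm_le (C := (Lg / μg * M) ^ 2) (n := 4)
    (by fun_prop) fun u => ?_
  rw [norm_pow, norm_norm]
  refine (pow_le_pow_left₀ (norm_nonneg _)
    (hA.norm_dirEst_le hp hd hμg hα hαL hμ y₀ N x u) 2).trans_eq (by ring)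

theorem inner_delta_sub_le (u : Vec p) :
    |inner ℝ (delta g α μ y₀ N x u) (gradY f x (innerGD g α y₀ x N))
      - inner ℝ ((jacGD g α y₀ x N).adjoint (gradY f x (innerGD g α y₀ x N))) u|
      ≤ μ * LJ Lg μg ρ τ * M * ‖u‖ ^ 2 := by
  rw [ContinuousLinearMap.adjoint_inner_left, real_inner_comm (jacGD g α y₀ x N u),
    ← inner_sub_left]
  refine (abs_real_inner_le_norm _ _).trans ?_
  have hLJ := LJ_nonneg (hA.Lg_nonneg hp) hμg (hA.rho_nonneg hp) (hA.tau_nonneg hp)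
  calc _ ≤ μ * LJ Lg μg ρ τ * ‖u‖ ^ 2 * M :=
        mul_le_mul (hA.norm_delta_sub_le hp hd hμg hα hαL hμ y₀ N x u)
          (hA.norm_gradY_f_le hp _ _) (norm_nonneg _) (by positivity)
    _ = _ := by ring

/-- Bias of the Gaussian smoothing estimator. -/
theorem norm_integral_dirEst_sub_le :
    ‖∫ u, dirEst f g α μ y₀ N x u ∂(stdGaussian (Vec p))
      - (jacGD g α y₀ x N).adjoint (gradY f x (innerGD g α y₀ x N))‖
      ≤ 2 * p * (μ * LJ Lg μg ρ τ * M) := by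
  set v := gradY f x (innerGD g α y₀ x N) with hv
  set b := (jacGD g α y₀ x N).adjoint v with hb
  set c := μ * LJ Lg μg ρ τ * M with hc
  set h := dirEst f g α μ y₀ N x with hh
  set w := ∫ u, h u ∂(stdGaussian (Vec p)) - b with hw
  have hLJ := LJ_nonneg (hA.Lg_nonneg hp) hμg (hA.rho_nonneg hp) (hA.tau_nonneg hp)
  have hM := hA.M_nonneg hp
  have hc0 : 0 ≤ c := by positivity
  have hp0 : (0 : ℝ) < p := by exact_mod_cast hp
  -- The bias w is tested against itself with Young weights depending on ‖w‖, so w = 0 is set apart.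
  rcases eq_or_lt_of_le (norm_nonneg w) with h0 | h0
  · rw [← h0]; positivity
  have hint : Integrable h (stdGaussian (Vec p)) :=
    (hA.memLp_dirEst hp hd hμg hα hαL hμ y₀ N x).integrable one_le_two
  have hi1 : Integrable (fun u => inner ℝ w (h u)) (stdGaussian (Vec p)) := hint.const_inner w
  have hi2 : Integrable (fun u => inner ℝ w u * inner ℝ b u) (stdGaussian (Vec p)) := by
    refine integrable_stdGaussian_of_norm_le (C := ‖w‖ * ‖b‖) (n := 2) (by fun_prop) fun u => ?_
    rw [norm_mul]
    calc _ ≤ (‖w‖ * ‖u‖) * (‖b‖ * ‖u‖) :=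
          mul_le_mul (norm_inner_le_norm _ _) (norm_inner_le_norm _ _) (norm_nonneg _)
            (by positivity)
      _ = _ := by ring
  have e1 : ‖w‖ ^ 2 = ∫ u, (inner ℝ w (h u) - inner ℝ w u * inner ℝ b u)
      ∂(stdGaussian (Vec p)) := by
    rw [integral_sub hi1 hi2, integral_inner hint, integral_inner_mul_inner_stdGaussian,
      ← inner_sub_right, ← real_inner_self_eq_norm_sq]
  -- Since E‖u‖⁴ ≤ 4p² and E⟨w,u⟩² = ‖w‖², these weights give each of the two terms a mean of at
  -- most p‖w‖.
  have hpt : ∀ u, inner ℝ w (h u) - inner ℝ w u * inner ℝ b u ≤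
      c * (‖w‖ / (4 * p) * ‖u‖ ^ 4 + p / ‖w‖ * (inner ℝ w u) ^ 2) := by
    intro u
    have hr := hA.inner_delta_sub_le hp hd hμg hα hαL hμ y₀ N x u
    rw [← hv, ← hb, ← hc] at hr
    have e2 : inner ℝ w (h u) = inner ℝ (delta g α μ y₀ N x u) v * inner ℝ w u := by
      rw [hh, dirEst, inner_smul_right]
    have e3 : ‖w‖ / (4 * p) * ‖u‖ ^ 4 + p / ‖w‖ * |(inner ℝ w u : ℝ)| ^ 2
        - ‖u‖ ^ 2 * |(inner ℝ w u : ℝ)| =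
        (‖w‖ * ‖u‖ ^ 2 - 2 * p * |(inner ℝ w u : ℝ)|) ^ 2 / (4 * p * ‖w‖) := by
      field_simp; ring
    have h3 : 0 ≤ (‖w‖ * ‖u‖ ^ 2 - 2 * p * |(inner ℝ w u : ℝ)|) ^ 2 / (4 * p * ‖w‖) := by
      positivity
    rw [e2, mul_comm (inner ℝ w u : ℝ) (inner ℝ b u), ← sub_mul]
    calc _ ≤ |(inner ℝ (delta g α μ y₀ N x u) v - inner ℝ b u) * inner ℝ w u| := le_abs_self _
      _ ≤ c * ‖u‖ ^ 2 * |(inner ℝ w u : ℝ)| := by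
          rw [abs_mul]; gcongr
      _ = c * (‖u‖ ^ 2 * |(inner ℝ w u : ℝ)|) := by ring
      _ ≤ _ := by
          rw [← sq_abs (inner ℝ w u : ℝ)]
          gcongr; linarith
  have i4 := (integrable_norm_pow_stdGaussian (p := p) 4).const_mul (‖w‖ / (4 * p))
  have i2 := (integrable_inner_pow_stdGaussian w 2).const_mul (p / ‖w‖)
  have hle := integral_mono (hi1.sub hi2) ((i4.add i2).const_mul c) hpt
  have hle' : ‖w‖ ^ 2 ≤ ∫ u, c * (‖w‖ / (4 * p) * ‖u‖ ^ 4 + p / ‖w‖ * (inner ℝ w u) ^ 2)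
      ∂(stdGaussian (Vec p)) := e1.trans_le hle
  rw [integral_const_mul, integral_add i4 i2, integral_const_mul, integral_const_mul,
    integral_inner_sq_stdGaussian] at hle'
  have h5 : c * (‖w‖ / (4 * p) * ∫ u : Vec p, ‖u‖ ^ 4 ∂(stdGaussian (Vec p))
      + p / ‖w‖ * ‖w‖ ^ 2) ≤ c * (‖w‖ / (4 * p) * (4 * (p : ℝ) ^ 2) + p / ‖w‖ * ‖w‖ ^ 2) := by
    have := integral_norm_pow_four_stdGaussian_le (p := p)
    gcongr
  have h6 : c * (‖w‖ / (4 * p) * (4 * (p : ℝ) ^ 2) + p / ‖w‖ * ‖w‖ ^ 2) = 2 * p * c * ‖w‖ := by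
    field_simp; ring
  refine le_of_mul_le_mul_right ?_ h0
  nlinarith

/-- Second moment of the Gaussian smoothing estimator. -/
theorem integral_norm_sq_dirEst_le :
    ∫ u, ‖dirEst f g α μ y₀ N x u‖ ^ 2 ∂(stdGaussian (Vec p))
      ≤ 8 * p * (Lg / μg * M) ^ 2 + 216 * (μ * LJ Lg μg ρ τ * M) ^ 2 * (p : ℝ) ^ 3 := by
  set v := gradY f x (innerGD g α y₀ x N) with hv
  set b := (jacGD g α y₀ x N).adjoint v with hb
  set c := μ * LJ Lg μg ρ τ * M with hc
  have hκ : 0 ≤ Lg / μg := div_nonneg (hA.Lg_nonneg hp) hμg.le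
  have hbn : ‖b‖ ≤ Lg / μg * M := by
    refine (ContinuousLinearMap.le_opNorm _ _).trans ?_
    rw [LinearIsometryEquiv.norm_map]
    exact mul_le_mul (hA.norm_jacGD_le hp hd hμg hα hαL y₀ x N) (hA.norm_gradY_f_le hp _ _)
      (norm_nonneg _) hκ
  -- Splitting off the linear part ⟨b, u⟩ keeps the main term linear in p; the curvature part
  -- carries μ².
  have hpt : ∀ u, ‖dirEst f g α μ y₀ N x u‖ ^ 2 ≤
      2 * ((inner ℝ b u) ^ 2 * ‖u‖ ^ 2) + 2 * c ^ 2 * ‖u‖ ^ 6 := by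
    intro u
    have hr := hA.inner_delta_sub_le hp hd hμg hα hαL hμ y₀ N x u
    rw [← hv, ← hb, ← hc] at hr
    rw [dirEst, norm_smul, mul_pow, Real.norm_eq_abs, sq_abs, ← hv]
    have h1 := pow_le_pow_left₀ (abs_nonneg _) hr 2
    rw [sq_abs] at h1
    have h2 : (inner ℝ (delta g α μ y₀ N x u) v : ℝ) ^ 2 ≤
        2 * (inner ℝ b u) ^ 2 + 2 * (c * ‖u‖ ^ 2) ^ 2 := by
      nlinarith [sq_nonneg ((inner ℝ (delta g α μ y₀ N x u) v : ℝ) - 2 * inner ℝ b u)]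
    calc _ ≤ (2 * (inner ℝ b u) ^ 2 + 2 * (c * ‖u‖ ^ 2) ^ 2) * ‖u‖ ^ 2 := by gcongr
      _ = _ := by ring
  have i1 := (integrable_inner_sq_mul_norm_sq b).const_mul 2
  have i2 := (integrable_norm_pow_stdGaussian (p := p) 6).const_mul (2 * c ^ 2)
  have hm := (hA.memLp_dirEst hp hd hμg hα hαL hμ y₀ N x).integrable_norm_pow two_ne_zero
  refine (integral_mono hm (i1.add i2) hpt).trans ?_
  simp only [Pi.add_apply]
  rw [integral_add i1 i2, integral_const_mul, integral_const_mul]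
  calc _ ≤ 2 * (4 * p * ‖b‖ ^ 2) + 2 * c ^ 2 * (108 * (p : ℝ) ^ 3) := by
        gcongr
        · exact integral_inner_sq_mul_norm_sq_le b
        · exact integral_norm_pow_six_stdGaussian_le hp
    _ ≤ 2 * (4 * p * (Lg / μg * M) ^ 2) + 2 * c ^ 2 * (108 * (p : ℝ) ^ 3) := by gcongr
    _ = _ := by ring

end

end Assumptions

end

/-! ### Bias and mean squared error of the hypergradient estimator. -/

section

variable {p d Q : ℕ} {f g : Joint p d → ℝ} {Lf Lg μg ρ τ M : ℝ}

/-- Bound on the bias of the hypergradient estimator, given an error `ε` of the inner iterate, an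
error `e` of its Jacobian, and the size `c` of the smoothing error. -/
def biasBound (Lf κ M : ℝ) (p : ℕ) (c ε e : ℝ) : ℝ :=
  Lf * ε + 2 * p * c + e * M + κ * (Lf * ε)

/-- Bound on the mean squared error of the hypergradient estimator. -/
def mseBound (Lf κ M : ℝ) (p Q : ℕ) (c ε e : ℝ) : ℝ :=
  2 * (Lf * ε) ^ 2 + 4 * (κ * (Lf * ε)) ^ 2
    + 4 * ((Q : ℝ)⁻¹ * (8 * p * (κ * M) ^ 2 + 216 * c ^ 2 * (p : ℝ) ^ 3)
      + (2 * p * c + e * M) ^ 2)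

/-- The law of the directions used in one outer step. -/
def dirLaw (p Q : ℕ) : Measure (Fin Q → Vec p) := Measure.pi fun _ => stdGaussian (Vec p)

instance : IsProbabilityMeasure (dirLaw p Q) := by unfold dirLaw; infer_instance

namespace Assumptions

section

variable (hA : Assumptions f g Lf Lg μg ρ τ M) (hp : 1 ≤ p) (hd : 1 ≤ d) (hμg : 0 < μg)
  {α μ : ℝ} (hα : 0 < α) (hαL : α * Lg ≤ 1) (hμ : 0 < μ) (y₀ : Vec d) (N : ℕ) (x : Vec p)

include hA hp hd hμg hα hαL hμ

theorem memLp_hyperGradEst :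
    MemLp (fun u : Fin Q → Vec p => hyperGradEst f g α μ y₀ N x u) 2 (dirLaw p Q) := by
  simp only [hyperGradEst_eq]
  have hs : MemLp (fun u : Fin Q → Vec p => ∑ j, dirEst f g α μ y₀ N x (u j)) 2 (dirLaw p Q) :=
    memLp_finsetSum _ fun j _ =>
      memLp_comp_eval_pi (hA.memLp_dirEst hp hd hμg hα hαL hμ y₀ N x) j
  exact (memLp_const (gradX f x (innerGD g α y₀ x N))).add (hs.const_smul (Q : ℝ)⁻¹)

theorem integral_hyperGradEst (hQ : 1 ≤ Q) :
    ∫ u : Fin Q → Vec p, hyperGradEst f g α μ y₀ N x u ∂(dirLaw p Q) =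
      gradX f x (innerGD g α y₀ x N) + ∫ u, dirEst f g α μ y₀ N x u ∂(stdGaussian (Vec p)) := by
  have hQ0 : (Q : ℝ) ≠ 0 := by positivity
  have hi := (hA.memLp_dirEst hp hd hμg hα hαL hμ y₀ N x).integrable one_le_two
  have hs : Integrable (fun u : Fin Q → Vec p => ∑ j, dirEst f g α μ y₀ N x (u j)) (dirLaw p Q) :=
    integrable_finsetSum _ fun j _ => integrable_comp_eval_pi hi j
  have hs' : Integrable (fun u : Fin Q → Vec p => (Q : ℝ)⁻¹ • ∑ j, dirEst f g α μ y₀ N x (u j))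
      (dirLaw p Q) := hs.smul (Q : ℝ)⁻¹
  simp only [hyperGradEst_eq]
  rw [integral_add (integrable_const _) hs', integral_smul]
  congr 1
  · simp
  · rw [dirLaw, integral_finsetSum _ fun j _ => integrable_comp_eval_pi hi j]
    simp_rw [integral_comp_eval_pi hi.1]
    rw [Finset.sum_const, Finset.card_univ, Fintype.card_fin, ← Nat.cast_smul_eq_nsmul ℝ,
      smul_smul, inv_mul_cancel₀ hQ0, one_smul]

variable {ε e : ℝ} (hε : ‖innerGD g α y₀ x N - ystar g x‖ ≤ ε)
  (he : ‖jacGD g α y₀ x N - jacStar g x‖ ≤ e)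

include he in
theorem norm_integral_dirEst_sub_jacStar_le :
    ‖∫ u, dirEst f g α μ y₀ N x u ∂(stdGaussian (Vec p))
      - (jacStar g x).adjoint (gradY f x (innerGD g α y₀ x N))‖
      ≤ 2 * p * (μ * LJ Lg μg ρ τ * M) + e * M := by
  have h1 := hA.norm_integral_dirEst_sub_le hp hd hμg hα hαL hμ y₀ N x
  set v := gradY f x (innerGD g α y₀ x N)
  have h2 : ‖(jacGD g α y₀ x N - jacStar g x).adjoint v‖ ≤ e * M := by
    refine (ContinuousLinearMap.le_opNorm _ _).trans ?_
    rw [LinearIsometryEquiv.norm_map]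
    exact mul_le_mul he (hA.norm_gradY_f_le hp _ _) (norm_nonneg _) ((norm_nonneg _).trans he)
  have hdec : ∫ u, dirEst f g α μ y₀ N x u ∂(stdGaussian (Vec p)) - (jacStar g x).adjoint v =
      (∫ u, dirEst f g α μ y₀ N x u ∂(stdGaussian (Vec p)) - (jacGD g α y₀ x N).adjoint v)
        + (jacGD g α y₀ x N - jacStar g x).adjoint v := by
    rw [map_sub, sub_apply]; abel
  rw [hdec]
  exact (norm_add_le _ _).trans (add_le_add h1 h2)

omit hd hα hαL hμ hμg in
include hε in
theorem norm_gradX_sub_le :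
    ‖gradX f x (innerGD g α y₀ x N) - gradX f x (ystar g x)‖ ≤ Lf * ε := by
  have h := hA.gradX_f_lip hp x x (innerGD g α y₀ x N) (ystar g x)
  rw [sub_self, norm_zero, zero_add] at h
  exact h.trans (mul_le_mul_of_nonneg_left hε (hA.Lf_nonneg hp))

omit hd hα hαL hμ in
include hε in
theorem norm_adjoint_gradY_sub_le :
    ‖(jacStar g x).adjoint (gradY f x (innerGD g α y₀ x N) - gradY f x (ystar g x))‖
      ≤ Lg / μg * (Lf * ε) := by
  have h := hA.gradY_f_lip hp x x (innerGD g α y₀ x N) (ystar g x)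
  rw [sub_self, norm_zero, zero_add] at h
  refine (ContinuousLinearMap.le_opNorm _ _).trans ?_
  rw [LinearIsometryEquiv.norm_map]
  exact mul_le_mul (hA.norm_jacStar_le hp hμg x)
    (h.trans (mul_le_mul_of_nonneg_left hε (hA.Lf_nonneg hp))) (norm_nonneg _)
    (div_nonneg (hA.Lg_nonneg hp) hμg.le)

include hε he in
theorem norm_bias_le (hQ : 1 ≤ Q) :
    ‖∫ u : Fin Q → Vec p, hyperGradEst f g α μ y₀ N x u ∂(dirLaw p Q) - gradPhi f g x‖
      ≤ biasBound Lf (Lg / μg) M p (μ * LJ Lg μg ρ τ * M) ε e := by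
  rw [hA.integral_hyperGradEst hp hd hμg hα hαL hμ y₀ N x hQ]
  have h1 := hA.norm_gradX_sub_le hp y₀ N x hε
  have h2 := hA.norm_integral_dirEst_sub_jacStar_le hp hd hμg hα hαL hμ y₀ N x he
  have h3 := hA.norm_adjoint_gradY_sub_le hp hμg y₀ N x hε
  have hdec : gradX f x (innerGD g α y₀ x N)
      + ∫ u, dirEst f g α μ y₀ N x u ∂(stdGaussian (Vec p)) - gradPhi f g x =
      (gradX f x (innerGD g α y₀ x N) - gradX f x (ystar g x))
      + (∫ u, dirEst f g α μ y₀ N x u ∂(stdGaussian (Vec p))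
        - (jacStar g x).adjoint (gradY f x (innerGD g α y₀ x N)))
      + (jacStar g x).adjoint (gradY f x (innerGD g α y₀ x N) - gradY f x (ystar g x)) := by
    rw [gradPhi, map_sub]; abel
  rw [hdec, biasBound]
  refine (norm_add₃_le.trans (add_le_add (add_le_add h1 h2) h3)).trans_eq (by ring)

include hε he in
theorem integral_norm_sq_error_le (hQ : 1 ≤ Q) :
    ∫ u : Fin Q → Vec p, ‖hyperGradEst f g α μ y₀ N x u - gradPhi f g x‖ ^ 2 ∂(dirLaw p Q)
      ≤ mseBound Lf (Lg / μg) M p Q (μ * LJ Lg μg ρ τ * M) ε e := by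
  have h1 := hA.norm_gradX_sub_le hp y₀ N x hε
  have h2 := hA.norm_integral_dirEst_sub_jacStar_le hp hd hμg hα hαL hμ y₀ N x he
  have h3 := hA.norm_adjoint_gradY_sub_le hp hμg y₀ N x hε
  have hL2 := hA.memLp_dirEst hp hd hμg hα hαL hμ y₀ N x
  set v := gradY f x (innerGD g α y₀ x N) with hv
  set A := gradX f x (innerGD g α y₀ x N) - gradX f x (ystar g x) with hAdef
  set C := (jacStar g x).adjoint (v - gradY f x (ystar g x)) with hC
  -- Only the middle term of A + (B + C) is random. This grouping produces the weights 2 and 4 in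
  -- the leading terms of `Dvar`.
  have hpt : ∀ u : Fin Q → Vec p, ‖hyperGradEst f g α μ y₀ N x u - gradPhi f g x‖ ^ 2 ≤
      (2 * ‖A‖ ^ 2 + 4 * ‖C‖ ^ 2) + 4 * ‖(Q : ℝ)⁻¹ • ∑ j, dirEst f g α μ y₀ N x (u j)
        - (jacStar g x).adjoint v‖ ^ 2 := by
    intro u
    set B := (Q : ℝ)⁻¹ • ∑ j, dirEst f g α μ y₀ N x (u j) - (jacStar g x).adjoint v with hB
    have hdec : hyperGradEst f g α μ y₀ N x u - gradPhi f g x = A + (B + C) := by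
      rw [hyperGradEst_eq, gradPhi, hAdef, hB, hC, map_sub]; abel
    rw [hdec]
    have e1 := pow_le_pow_left₀ (norm_nonneg _) (norm_add_le A (B + C)) 2
    have e2 := pow_le_pow_left₀ (norm_nonneg _) (norm_add_le B C) 2
    nlinarith [sq_nonneg (‖A‖ - ‖B + C‖), sq_nonneg (‖B‖ - ‖C‖)]
  have hi1 : Integrable (fun u : Fin Q → Vec p =>
      ‖hyperGradEst f g α μ y₀ N x u - gradPhi f g x‖ ^ 2) (dirLaw p Q) :=
    ((hA.memLp_hyperGradEst hp hd hμg hα hαL hμ y₀ N x).sub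
      (memLp_const _)).integrable_norm_pow two_ne_zero
  have hs : MemLp (fun u : Fin Q → Vec p => ∑ j, dirEst f g α μ y₀ N x (u j)) 2 (dirLaw p Q) :=
    memLp_finsetSum _ fun j _ => memLp_comp_eval_pi hL2 j
  have hi2 : Integrable (fun u : Fin Q → Vec p => 4 * ‖(Q : ℝ)⁻¹ • ∑ j, dirEst f g α μ y₀ N x (u j)
        - (jacStar g x).adjoint v‖ ^ 2) (dirLaw p Q) :=
    (((hs.const_smul (Q : ℝ)⁻¹).sub (memLp_const _)).integrable_norm_pow two_ne_zero).const_mul 4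
  refine (integral_mono hi1 ((integrable_const _).add hi2) hpt).trans ?_
  simp only [Pi.add_apply]
  rw [integral_add (integrable_const _) hi2, integral_const_mul]
  have hav := integral_norm_sq_average_sub_le (Q := Q) hL2 hQ ((jacStar g x).adjoint v)
  have hsm := hA.integral_norm_sq_dirEst_le hp hd hμg hα hαL hμ y₀ N x
  rw [← dirLaw] at hav
  have hav2 := hav.trans (add_le_add (mul_le_mul_of_nonneg_left hsm (by positivity))
    (pow_le_pow_left₀ (norm_nonneg _) h2 2))
  have h1' := pow_le_pow_left₀ (norm_nonneg _) h1 2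
  have h3' := pow_le_pow_left₀ (norm_nonneg _) h3 2
  simp only [integral_const, probReal_univ, one_smul]
  rw [mseBound]
  linarith

end

end Assumptions

/-! ### Expected decrease in one outer step. -/

section Step

variable {U : Type*} [MeasurableSpace U] {ν : Measure U} [IsProbabilityMeasure ν]

/-- Expected decrease of a smooth function along a stochastic gradient step. -/
theorem expected_descent {F : Vec p → ℝ} {G x : Vec p} {gh : U → Vec p} {β Lt : ℝ}
    (hgh : MemLp gh 2 ν)
    (hF : ∀ v, F (x + v) ≤ F x + inner ℝ G v + Lt / 2 * ‖v‖ ^ 2)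
    (hFi : Integrable (fun u => F (x - β • gh u)) ν) :
    ∫ u, F (x - β • gh u) ∂ν ≤ F x - β * (‖G‖ ^ 2 + inner ℝ G (∫ u, gh u ∂ν - G))
      + Lt * β ^ 2 / 2 * (‖G‖ ^ 2 + 2 * inner ℝ G (∫ u, gh u ∂ν - G)
        + ∫ u, ‖gh u - G‖ ^ 2 ∂ν) := by
  have hi : Integrable gh ν := hgh.integrable one_le_two
  have hie : Integrable (fun u => gh u - G) ν := hi.sub (integrable_const G)
  have hin : Integrable (fun u => inner ℝ G (gh u - G)) ν := hie.const_inner G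
  have hsq : Integrable (fun u => ‖gh u - G‖ ^ 2) ν :=
    (hgh.sub (memLp_const G)).integrable_norm_pow two_ne_zero
  have hpt : ∀ u, F (x - β • gh u) ≤
      (F x - β * ‖G‖ ^ 2 + Lt * β ^ 2 / 2 * ‖G‖ ^ 2)
        + (Lt * β ^ 2 - β) * inner ℝ G (gh u - G) + Lt * β ^ 2 / 2 * ‖gh u - G‖ ^ 2 := by
    intro u
    have h := hF (-(β • gh u))
    rw [← sub_eq_add_neg, norm_neg, norm_smul, mul_pow, Real.norm_eq_abs, sq_abs, inner_neg_right,
      inner_smul_right] at h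
    have e1 : gh u = G + (gh u - G) := by abel
    have e2 : ‖gh u‖ ^ 2 = ‖G‖ ^ 2 + 2 * inner ℝ G (gh u - G) + ‖gh u - G‖ ^ 2 := by
      conv_lhs => rw [e1]
      exact norm_add_sq_real _ _
    have e3 : (inner ℝ G (gh u) : ℝ) = ‖G‖ ^ 2 + inner ℝ G (gh u - G) := by
      rw [inner_sub_right, real_inner_self_eq_norm_sq]; ring
    rw [e2, e3] at h
    linarith
  have j1 : Integrable (fun u => (F x - β * ‖G‖ ^ 2 + Lt * β ^ 2 / 2 * ‖G‖ ^ 2)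
        + (Lt * β ^ 2 - β) * inner ℝ G (gh u - G)) ν :=
    (integrable_const _).add (hin.const_mul _)
  have hmono := integral_mono hFi (j1.add (hsq.const_mul (Lt * β ^ 2 / 2))) hpt
  simp only [Pi.add_apply] at hmono
  rw [integral_add j1 (hsq.const_mul _), integral_add (integrable_const _) (hin.const_mul _),
    integral_const_mul, integral_const_mul, integral_inner hie,
    integral_sub hi (integrable_const G)] at hmono
  simp only [integral_const, probReal_univ, one_smul] at hmono
  linarith

/-- The two cross terms combine into (Lt β - 1)⟨G, b⟩ with b the bias, and 0 ≤ Lt β ≤ 2 gives a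
factor of modulus at most 1; hence the bias enters exactly once, against ‖G‖ ≤ m. -/
theorem expected_descent_bias {F : Vec p → ℝ} {G x : Vec p} {gh : U → Vec p}
    {β Lt s B V m : ℝ} (hgh : MemLp gh 2 ν)
    (hF : ∀ v, F (x + v) ≤ F x + inner ℝ G v + Lt / 2 * ‖v‖ ^ 2)
    (hFi : Integrable (fun u => F (x - β • gh u)) ν)
    (hβ : 0 < β) (hLt0 : 0 ≤ Lt) (hLt : Lt * β ≤ 2 * s) (hs : s ≤ 1)
    (hB : ‖∫ u, gh u ∂ν - G‖ ≤ B) (hV : ∫ u, ‖gh u - G‖ ^ 2 ∂ν ≤ V) (hG : ‖G‖ ≤ m) :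
    ∫ u, F (x - β • gh u) ∂ν ≤ F x - β * (1 - s) * ‖G‖ ^ 2 + β * (m * B) + β * (s * V) := by
  have h := expected_descent hgh hF hFi
  set b := ∫ u, gh u ∂ν - G
  have hV0 : 0 ≤ ∫ u, ‖gh u - G‖ ^ 2 ∂ν := integral_nonneg fun u => sq_nonneg _
  have hLb : 0 ≤ Lt * β := mul_nonneg hLt0 hβ.le
  have hs0 : 0 ≤ s := by linarith
  have h1 : (Lt * β - 1) * inner ℝ G b ≤ m * B := by
    calc (Lt * β - 1) * inner ℝ G b ≤ |(Lt * β - 1) * inner ℝ G b| := le_abs_self _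
      _ ≤ 1 * (m * B) := by
          rw [abs_mul]
          refine mul_le_mul (abs_le.2 ⟨by linarith, by linarith⟩) ?_ (abs_nonneg _) zero_le_one
          exact (abs_real_inner_le_norm _ _).trans
            (mul_le_mul hG hB (norm_nonneg _) ((norm_nonneg _).trans hG))
      _ = _ := one_mul _
  have h2 : Lt * β / 2 * ‖G‖ ^ 2 ≤ s * ‖G‖ ^ 2 := by gcongr; linarith
  have h3 : Lt * β / 2 * ∫ u, ‖gh u - G‖ ^ 2 ∂ν ≤ s * V := by
    refine mul_le_mul (by linarith) hV hV0 hs0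
  have h4 : -‖G‖ ^ 2 + (Lt * β / 2 * ‖G‖ ^ 2) + (Lt * β - 1) * inner ℝ G b
      + Lt * β / 2 * ∫ u, ‖gh u - G‖ ^ 2 ∂ν ≤ -(1 - s) * ‖G‖ ^ 2 + m * B + s * V := by linarith
  have h5 := mul_le_mul_of_nonneg_left h4 hβ.le
  linarith

/-- Half of ‖G‖² is spent to make the bias quadratic, and the second-order ‖G‖² is bounded by m²
instead of being absorbed, so a decrease of 1/2 remains even for s = 1. -/
theorem expected_descent_young {F : Vec p → ℝ} {G x : Vec p} {gh : U → Vec p}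
    {β Lt s B V m : ℝ} (hgh : MemLp gh 2 ν)
    (hF : ∀ v, F (x + v) ≤ F x + inner ℝ G v + Lt / 2 * ‖v‖ ^ 2)
    (hFi : Integrable (fun u => F (x - β • gh u)) ν)
    (hβ : 0 < β) (hLt0 : 0 ≤ Lt) (hLt : Lt * β ≤ 2 * s) (hs : s ≤ 1)
    (hB : ‖∫ u, gh u ∂ν - G‖ ≤ B) (hV : ∫ u, ‖gh u - G‖ ^ 2 ∂ν ≤ V) (hG : ‖G‖ ≤ m) :
    ∫ u, F (x - β • gh u) ∂ν ≤ F x - β * (1 / 2) * ‖G‖ ^ 2 + β * (3 / 2 * B ^ 2)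
      + β * (s * (2 * m ^ 2 + V)) := by
  have h := expected_descent hgh hF hFi
  set b := ∫ u, gh u ∂ν - G
  have hV0 : 0 ≤ ∫ u, ‖gh u - G‖ ^ 2 ∂ν := integral_nonneg fun u => sq_nonneg _
  have hLb : 0 ≤ Lt * β := mul_nonneg hLt0 hβ.le
  have hs0 : 0 ≤ s := by linarith
  have hbB := pow_le_pow_left₀ (norm_nonneg _) hB 2
  have hGm := pow_le_pow_left₀ (norm_nonneg _) hG 2
  have hin := abs_le.1 (abs_real_inner_le_norm G b)
  have hyoung := two_mul_le_add_sq ‖G‖ ‖b‖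
  have h1 : -inner ℝ G b ≤ 1 / 2 * ‖G‖ ^ 2 + 1 / 2 * B ^ 2 := by linarith [hin.1]
  have h2 : ‖G‖ ^ 2 + 2 * inner ℝ G b + ∫ u, ‖gh u - G‖ ^ 2 ∂ν ≤ 2 * m ^ 2 + V + B ^ 2 := by
    linarith [hin.2]
  have h3 : Lt * β / 2 * (‖G‖ ^ 2 + 2 * inner ℝ G b + ∫ u, ‖gh u - G‖ ^ 2 ∂ν) ≤
      s * (2 * m ^ 2 + V) + B ^ 2 := by
    have hn : 0 ≤ 2 * m ^ 2 + V := by nlinarith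
    calc _ ≤ Lt * β / 2 * (2 * m ^ 2 + V + B ^ 2) := by gcongr
      _ ≤ s * (2 * m ^ 2 + V + B ^ 2) := by
          gcongr
          linarith
      _ ≤ _ := by nlinarith [sq_nonneg B]
  have h4 : -(‖G‖ ^ 2 + inner ℝ G b) + Lt * β / 2 *
      (‖G‖ ^ 2 + 2 * inner ℝ G b + ∫ u, ‖gh u - G‖ ^ 2 ∂ν) ≤
      -(1 / 2) * ‖G‖ ^ 2 + 3 / 2 * B ^ 2 + s * (2 * m ^ 2 + V) := by linarith
  have h5 := mul_le_mul_of_nonneg_left h4 hβ.le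
  linarith

end Step

end

/-! ### The random iterates: independence, integrability, telescoping. -/

section

variable {p d Q : ℕ} {f g : Joint p d → ℝ} {Lf Lg μg ρ τ M : ℝ}

/-- The source of independence: x_k uses only the directions of rounds before k. -/
theorem iterate_congr {α β μ : ℝ} {x₀ : Vec p} {y₀ : Vec d} {N : ℕ}
    {u u' : ℕ → Fin Q → Vec p} {k : ℕ} (h : ∀ i < k, ∀ j, u i j = u' i j) :
    iterate f g α β μ x₀ y₀ N u k = iterate f g α β μ x₀ y₀ N u' k := by
  induction k with
  | zero => rfl
  | succ k ih =>
    have h1 := ih fun i hi => h i (hi.trans (Nat.lt_succ_self k))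
    have h2 : u k = u' k := funext (h k (Nat.lt_succ_self k))
    rw [iterate, iterate, h1, h2]

namespace Assumptions

variable (hA : Assumptions f g Lf Lg μg ρ τ M)

include hA in
theorem measurable_iterate (hp : 1 ≤ p) (α β μ : ℝ) (x₀ : Vec p) (y₀ : Vec d) (N : ℕ)
    {Ω : Type*} [MeasurableSpace Ω] {u : ℕ → Fin Q → Ω → Vec p} (hu : ∀ k j, Measurable (u k j))
    (k : ℕ) : Measurable fun ω => iterate f g α β μ x₀ y₀ N (fun i j => u i j ω) k := by
  induction k with
  | zero => exact measurable_const
  | succ k ih =>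
    have h1 : Measurable fun ω => (iterate f g α β μ x₀ y₀ N (fun i j => u i j ω) k,
        fun j => u k j ω) := ih.prodMk (measurable_pi_lambda _ fun j => hu k j)
    have h2 := (hA.continuous_hyperGradEst (Q := Q) hp α μ y₀ N).measurable.comp h1
    exact ih.sub (h2.const_smul β)

section

variable (hp : 1 ≤ p) {Ω : Type*} [MeasurableSpace Ω] {P : Measure Ω} [IsProbabilityMeasure P]
  {u : ℕ → Fin Q → Ω → Vec p} (hu : ∀ k j, Measurable (u k j))
  (hlaw : ∀ k j, P.map (u k j) = stdGaussian (Vec p))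
  (hind : iIndepFun (fun kj : ℕ × Fin Q => u kj.1 kj.2) P)

omit [IsProbabilityMeasure P] in
include hA hp hu hind in
theorem indepFun_iterate (α β μ : ℝ) (x₀ : Vec p) (y₀ : Vec d) (N k : ℕ) :
    IndepFun (fun ω => iterate f g α β μ x₀ y₀ N (fun i j => u i j ω) k)
      (fun ω j => u k j ω) P := by
  classical
  let S : Finset (ℕ × Fin Q) := Finset.range k ×ˢ Finset.univ
  let T : Finset (ℕ × Fin Q) := {k} ×ˢ Finset.univ
  have hST : Disjoint S T := by
    rw [Finset.disjoint_left]
    rintro ⟨i, j⟩ h1 h2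
    simp only [S, T, Finset.mem_product, Finset.mem_range, Finset.mem_singleton] at h1 h2
    omega
  have h := hind.indepFun_finset S T hST fun i => hu i.1 i.2
  -- Filling the absent directions with 0 exhibits x_k as a measurable function of the finite block
  -- `S`.
  let ext : ℕ → Fin Q → (S → Vec p) → Vec p := fun i j w =>
    if hij : (i, j) ∈ S then w ⟨(i, j), hij⟩ else 0
  have hext : ∀ i j, Measurable (ext i j) := by
    intro i j
    by_cases hij : (i, j) ∈ S
    · simp only [ext, dif_pos hij]; exact measurable_pi_apply _
    · simp only [ext, dif_neg hij]; exact measurable_const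
  have hφ := hA.measurable_iterate hp α β μ x₀ y₀ N hext k
  have hψ : Measurable fun (w : T → Vec p) (j : Fin Q) => w ⟨(k, j), by simp [T]⟩ :=
    measurable_pi_lambda _ fun j => measurable_pi_apply _
  have h2 := h.comp hφ hψ
  have e : (fun ω => iterate f g α β μ x₀ y₀ N (fun i j => u i j ω) k) =
      (fun w => iterate f g α β μ x₀ y₀ N (fun i j => ext i j w) k) ∘
        fun ω (i : S) => u i.1.1 i.1.2 ω := by
    ext1 ω
    refine iterate_congr fun i hi j => ?_
    have hij : (i, j) ∈ S := by simp [S, hi]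
    simp only [ext, dif_pos hij]
  rw [e]
  exact h2

include hu hlaw hind in
omit hA in
theorem map_directions (k : ℕ) : P.map (fun ω j => u k j ω) = dirLaw p Q := by
  have hinj : Function.Injective fun j : Fin Q => (k, j) := fun a b h => (Prod.mk.inj h).2
  have h := hind.precomp hinj
  rw [iIndepFun_iff_map_fun_eq_pi_map fun j => (hu k j).aemeasurable] at h
  simp only [hlaw] at h
  exact h

variable (hd : 1 ≤ d) (hμg : 0 < μg) {α β μ : ℝ} (hα : 0 < α) (hαL : α * Lg ≤ 1) (hμ : 0 < μ)
  (x₀ : Vec p) (y₀ : Vec d) (N : ℕ)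

include hA hp hu hlaw hd hμg hα hαL hμ in
theorem integrable_iterate (k : ℕ) :
    Integrable (fun ω => iterate f g α β μ x₀ y₀ N (fun i j => u i j ω) k) P := by
  induction k with
  | zero => exact integrable_const _
  | succ k ih =>
    have hm := hA.measurable_iterate hp α β μ x₀ y₀ N hu k
    have h1 : Measurable fun ω => (iterate f g α β μ x₀ y₀ N (fun i j => u i j ω) k,
        fun j => u k j ω) := hm.prodMk (measurable_pi_lambda _ fun j => hu k j)
    have h2 := (hA.continuous_hyperGradEst (Q := Q) hp α μ y₀ N).measurable.comp h1
    have hn : ∀ j, Integrable (fun ω => ‖u k j ω‖ ^ 2) P := by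
      intro j
      have h3 := integrable_norm_pow_stdGaussian (p := p) 2
      rw [← hlaw k j] at h3
      exact h3.comp_measurable (hu k j)
    have h3 : Integrable (fun ω => hyperGradEst f g α μ y₀ N
        (iterate f g α β μ x₀ y₀ N (fun i j => u i j ω) k) (fun j => u k j ω)) P := by
      refine Integrable.mono' (g := fun ω => M + Lg / μg * M * ∑ j, ‖u k j ω‖ ^ 2)
        ((integrable_const M).add ((integrable_finsetSum _ fun j _ => hn j).const_mul _))
        h2.aestronglyMeasurable (Eventually.of_forall fun ω => ?_)
      exact hA.norm_hyperGradEst_le hp hd hμg hα hαL hμ y₀ N _ _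
    exact ih.sub (h3.smul β)

variable {D : ℝ} (hD : ∀ x, ‖y₀ - ystar g x‖ ≤ D)

include hA hp hd hμg hD in
theorem integrable_Phi_comp {U : Type*} [MeasurableSpace U] {ν : Measure U} [IsFiniteMeasure ν]
    {X : U → Vec p} (hX : Integrable X ν) : Integrable (fun ω => Phi f g (X ω)) ν := by
  have hc := (hA.differentiable_Phi hp hd hμg hD).continuous
  refine Integrable.mono' (g := fun ω => |Phi f g 0| + MPhi Lg μg M * ‖X ω‖)
    ((integrable_const _).add (hX.norm.const_mul _))
    (hc.comp_aestronglyMeasurable hX.1) (Eventually.of_forall fun ω => ?_)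
  have h := hA.Phi_lip hp hd hμg hD (X ω) 0
  rw [sub_zero] at h
  have h2 := abs_sub_abs_le_abs_sub (Phi f g (X ω)) (Phi f g 0)
  rw [Real.norm_eq_abs]
  linarith

include hA hp hd hμg hD in
theorem integrable_norm_gradPhi_sq {U : Type*} [MeasurableSpace U] {ν : Measure U}
    [IsFiniteMeasure ν] {X : U → Vec p} (hX : Measurable X) :
    Integrable (fun ω => ‖gradPhi f g (X ω)‖ ^ 2) ν := by
  have hc := (hA.continuous_gradPhi hp hd hμg hD).measurable.comp hX
  refine Integrable.mono' (g := fun _ => MPhi Lg μg M ^ 2) (integrable_const _)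
    (hc.norm.pow_const 2).aestronglyMeasurable (Eventually.of_forall fun ω => ?_)
  rw [norm_pow, norm_norm]
  exact pow_le_pow_left₀ (norm_nonneg _) (hA.norm_gradPhi_le hp hμg _) 2

-- By independence the law of (x_k, u_k) is a product, so Fubini integrates the bound at fixed x
-- over the law of x_k.
include hA hp hu hlaw hind hd hμg hα hαL hμ hD in
theorem integral_Phi_iterate_succ_le {c R : ℝ}
    (hstep : ∀ x, ∫ v : Fin Q → Vec p, Phi f g (x - β • hyperGradEst f g α μ y₀ N x v)
      ∂(dirLaw p Q) ≤ Phi f g x - c * ‖gradPhi f g x‖ ^ 2 + R) (k : ℕ) :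
    ∫ ω, Phi f g (iterate f g α β μ x₀ y₀ N (fun i j => u i j ω) (k + 1)) ∂P ≤
      ∫ ω, Phi f g (iterate f g α β μ x₀ y₀ N (fun i j => u i j ω) k) ∂P
        - c * ∫ ω, ‖gradPhi f g (iterate f g α β μ x₀ y₀ N (fun i j => u i j ω) k)‖ ^ 2 ∂P + R := by
  set X : Ω → Vec p := fun ω => iterate f g α β μ x₀ y₀ N (fun i j => u i j ω) k with hX
  set V : Ω → Fin Q → Vec p := fun ω j => u k j ω with hV
  have hXm : Measurable X := hA.measurable_iterate hp α β μ x₀ y₀ N hu k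
  have hVm : Measurable V := measurable_pi_lambda _ fun j => hu k j
  have hXi : Integrable X P := hA.integrable_iterate hp hu hlaw hd hμg hα hαL hμ x₀ y₀ N k
  have hi1 : Integrable (fun ω => Phi f g (X ω)) P := hA.integrable_Phi_comp hp hd hμg y₀ hD hXi
  have hmap : P.map (fun ω => (X ω, V ω)) = (P.map X).prod (dirLaw p Q) := by
    have h := (indepFun_iff_map_prod_eq_prod_map_map hXm.aemeasurable hVm.aemeasurable).1
      (hA.indepFun_iterate hp hu hind α β μ x₀ y₀ N k)
    rw [h, map_directions hu hlaw hind k]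
  have hprob : IsProbabilityMeasure (P.map X) := Measure.isProbabilityMeasure_map hXm.aemeasurable
  have hPc := (hA.differentiable_Phi hp hd hμg hD).continuous
  let H : Vec p × (Fin Q → Vec p) → ℝ := fun z =>
    Phi f g (z.1 - β • hyperGradEst f g α μ y₀ N z.1 z.2)
  have hHm : Measurable H := hPc.measurable.comp
    (measurable_fst.sub ((hA.continuous_hyperGradEst hp α μ y₀ N).measurable.const_smul β))
  have hHi : Integrable H ((P.map X).prod (dirLaw p Q)) := by
    rw [← hmap, integrable_map_measure hHm.aestronglyMeasurable (hXm.prodMk hVm).aemeasurable]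
    exact hA.integrable_Phi_comp hp hd hμg y₀ hD
      (hA.integrable_iterate hp hu hlaw hd hμg hα hαL hμ x₀ y₀ N (k + 1))
  have e1 : ∫ ω, Phi f g (iterate f g α β μ x₀ y₀ N (fun i j => u i j ω) (k + 1)) ∂P =
      ∫ x, ∫ v, H (x, v) ∂(dirLaw p Q) ∂(P.map X) := by
    rw [← integral_prod _ hHi, ← hmap, integral_map (hXm.prodMk hVm).aemeasurable
      hHm.aestronglyMeasurable]
    rfl
  have j1 : Integrable (fun x => Phi f g x) (P.map X) := by
    rw [integrable_map_measure hPc.aestronglyMeasurable hXm.aemeasurable]; exact hi1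
  have j2 : Integrable (fun x => ‖gradPhi f g x‖ ^ 2) (P.map X) :=
    hA.integrable_norm_gradPhi_sq hp hd hμg y₀ hD measurable_id
  have j3 : Integrable (fun x => Phi f g x - c * ‖gradPhi f g x‖ ^ 2) (P.map X) :=
    j1.sub (j2.const_mul c)
  rw [e1]
  refine (integral_mono hHi.integral_prod_left (j3.add (integrable_const R)) hstep).trans_eq ?_
  simp only [Pi.add_apply]
  rw [integral_add j3 (integrable_const R), integral_sub j1 (j2.const_mul c), integral_const_mul,
    integral_map hXm.aemeasurable hPc.aestronglyMeasurable,
    integral_map hXm.aemeasurable j2.1]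
  simp [hX]

include hA hp hu hlaw hind hd hμg hα hαL hμ hD in
/-- Summing the expected decrease over the outer iterations. -/
theorem sum_integral_norm_gradPhi_sq_le {c R : ℝ}
    (hstep : ∀ x, ∫ v : Fin Q → Vec p, Phi f g (x - β • hyperGradEst f g α μ y₀ N x v)
      ∂(dirLaw p Q) ≤ Phi f g x - c * ‖gradPhi f g x‖ ^ 2 + R)
    (hbdd : BddBelow (Set.range (Phi f g))) (K : ℕ) :
    c * ∑ k ∈ Finset.range K,
      ∫ ω, ‖gradPhi f g (iterate f g α β μ x₀ y₀ N (fun i j => u i j ω) k)‖ ^ 2 ∂P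
      ≤ Phi f g x₀ - (⨅ x, Phi f g x) + K * R := by
  have htel : ∀ K : ℕ, c * ∑ k ∈ Finset.range K,
      ∫ ω, ‖gradPhi f g (iterate f g α β μ x₀ y₀ N (fun i j => u i j ω) k)‖ ^ 2 ∂P
      ≤ Phi f g x₀ - ∫ ω, Phi f g (iterate f g α β μ x₀ y₀ N (fun i j => u i j ω) K) ∂P
        + K * R := by
    intro K
    induction K with
    | zero => simp [iterate]
    | succ k ih =>
      have h := hA.integral_Phi_iterate_succ_le hp hu hlaw hind hd hμg hα hαL hμ x₀ y₀ N hD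
        hstep k
      rw [Finset.sum_range_succ, mul_add]
      push_cast
      linarith
  have hlow : (⨅ x, Phi f g x) ≤
      ∫ ω, Phi f g (iterate f g α β μ x₀ y₀ N (fun i j => u i j ω) K) ∂P := by
    have h := integral_mono (integrable_const (⨅ x, Phi f g x))
      (hA.integrable_Phi_comp hp hd hμg y₀ hD
        (hA.integrable_iterate hp hu hlaw hd hμg hα hαL hμ (β := β) x₀ y₀ N K))
      (fun ω => ciInf_le hbdd _)
    simpa using h
  linarith [htel K]

end

end Assumptions

end

/-! ### Numerical comparison of the error bounds with the stated constants. -/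

section

section Numerics

/-- Put r = √q. Comparison with a geometric sum gives (1 - r) N r^(N-1) ≤ 1, while 1 - q = (1 + r)(1
- r) with 1 + r ≤ 2; a factor r^(N-1) is left over. The factor N is paid for with half of the
exponent. -/
theorem mul_pow_pred_le {q : ℝ} (hq0 : 0 ≤ q) (hq1 : q ≤ 1) (N : ℕ) :
    (1 - q) * (N * q ^ (N - 1)) ≤ 2 * Real.sqrt q ^ (N - 1) := by
  set r := Real.sqrt q with hr
  have hr0 : 0 ≤ r := Real.sqrt_nonneg q
  have hr1 : r ≤ 1 := Real.sqrt_le_one.2 hq1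
  have hrq : q = r ^ 2 := (Real.sq_sqrt hq0).symm
  have hsum : (N : ℝ) * r ^ (N - 1) ≤ ∑ i ∈ Finset.range N, r ^ i := by
    have h : ∑ _i ∈ Finset.range N, r ^ (N - 1) ≤ ∑ i ∈ Finset.range N, r ^ i :=
      Finset.sum_le_sum fun i hi => pow_le_pow_of_le_one hr0 hr1
        (by have := Finset.mem_range.1 hi; omega)
    simpa using h
  have hgeom : (1 - r) * ∑ i ∈ Finset.range N, r ^ i ≤ 1 := by
    rw [mul_neg_geom_sum]
    have := pow_nonneg hr0 N
    linarith
  have h1 : (1 - r) * ((N : ℝ) * r ^ (N - 1)) ≤ 1 :=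
    (mul_le_mul_of_nonneg_left hsum (by linarith)).trans hgeom
  have hpow : 0 ≤ r ^ (N - 1) := pow_nonneg hr0 _
  have e : (1 - q) * (N * q ^ (N - 1)) =
      ((1 + r) * ((1 - r) * (N * r ^ (N - 1)))) * r ^ (N - 1) := by
    rw [hrq, ← pow_mul, mul_comm 2, pow_mul]; ring
  rw [e]
  refine mul_le_mul_of_nonneg_right ?_ hpow
  have h0 : 0 ≤ (1 - r) * ((N : ℝ) * r ^ (N - 1)) := by
    have : 0 ≤ 1 - r := by linarith
    positivity
  nlinarith

theorem sqrt_pow_eq_rpow {q : ℝ} (hq0 : 0 ≤ q) {N : ℕ} (hN : 1 ≤ N) :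
    Real.sqrt q ^ (N - 1) = q ^ (((N : ℝ) - 1) / 2) := by
  rw [Real.sqrt_eq_rpow, ← Real.rpow_natCast, ← Real.rpow_mul hq0]
  congr 1
  rw [Nat.cast_sub hN]
  push_cast
  ring

theorem pow_le_rpow_half {q : ℝ} (hq0 : 0 ≤ q) (hq1 : q ≤ 1) (N : ℕ) :
    q ^ N ≤ q ^ ((N : ℝ) / 2) := by
  rw [← Real.rpow_natCast]
  have : (0 : ℝ) ≤ N := Nat.cast_nonneg N
  exact Real.rpow_le_rpow_of_exponent_ge' hq0 hq1 (by positivity) (by linarith)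

theorem sq_add_three_le (a b c : ℝ) :
    4 * (a + (b + c)) ^ 2 ≤ 12 * a ^ 2 + 12 * b ^ 2 + 12 * c ^ 2 := by
  nlinarith [sq_nonneg (a - b), sq_nonneg (a - c), sq_nonneg (b - c)]

theorem sq_add_four_le (a b c d : ℝ) :
    (a + b + c + d) ^ 2 ≤ 4 * (a ^ 2 + b ^ 2 + c ^ 2 + d ^ 2) := by
  nlinarith [sq_nonneg (a - b), sq_nonneg (a - c), sq_nonneg (a - d), sq_nonneg (b - c),
    sq_nonneg (b - d), sq_nonneg (c - d)]

theorem cubic_bound {p : ℝ} (hp : 0 ≤ p) : (4 * p) ^ 2 ≤ (p + 3) ^ 3 := by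
  nlinarith [mul_nonneg hp (sq_nonneg (p - 7 / 2)), sq_nonneg p]

/-- Matches the smoothing bias 2pμ = (μ/2)·4p with the term of `Dbias` in (p + 3)^(3/2). -/
theorem four_mul_le_rpow {p : ℝ} (hp : 0 ≤ p) : 4 * p ≤ (p + 3) ^ ((3 : ℝ) / 2) := by
  refine abs_le_of_sq_le_sq' ?_ (by positivity) |>.2
  have h : ((p + 3) ^ ((3 : ℝ) / 2)) ^ 2 = (p + 3) ^ 3 := by
    rw [← Real.rpow_natCast, ← Real.rpow_natCast, ← Real.rpow_mul (by positivity)]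
    norm_num
  rw [h]
  exact cubic_bound hp

/-- The part of the Jacobian error that stems from the variation of the second derivatives. -/
def jacErr (L μg ρ τ D q : ℝ) (N : ℕ) : ℝ :=
  2 * D * (τ * μg + L * ρ) / μg ^ 2 * Real.sqrt q ^ (N - 1)

variable {Lf Lg L μg ρ τ M D α μ : ℝ} {p d N Q : ℕ}

theorem biasBound_le_Dbias (hμg : 0 < μg) (hLf : Lf ≤ L) (hLg0 : 0 ≤ Lg)
    (hLg : Lg ≤ L) (hρ : 0 ≤ ρ) (hτ : 0 ≤ τ) (hM : 0 ≤ M) (hD : 0 ≤ D) (hμ : 0 < μ)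
    (hq0 : 0 ≤ 1 - α * μg) (hq1 : 1 - α * μg ≤ 1) (hd : 1 ≤ d) (hN : 1 ≤ N) :
    biasBound Lf (Lg / μg) M p (μ * LJ Lg μg ρ τ * M) ((1 - α * μg) ^ N * D)
      (Lg / μg * (1 - α * μg) ^ N + jacErr L μg ρ τ D (1 - α * μg) N)
      ≤ Dbias L μg ρ τ M D α μ p d N := by
  have hL0 : 0 ≤ L := hLg0.trans hLg
  rw [biasBound, Dbias, jacErr, sqrt_pow_eq_rpow hq0 hN]
  set q := 1 - α * μg
  have hqN : 0 ≤ q ^ N := pow_nonneg hq0 N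
  have hhalf := pow_le_rpow_half hq0 hq1 N
  have hLJ := LJ_nonneg (μg := μg) hLg0 hμg hρ hτ
  have hLJ' := LJ_mono (μg := μg) hLg0 hLg hμg hρ hτ
  have h1 : Lf * (q ^ N * D) ≤ L * D * q ^ ((N : ℝ) / 2) := by
    calc _ ≤ L * (q ^ ((N : ℝ) / 2) * D) := by gcongr
      _ = _ := by ring
  have hd1 : 1 ≤ (d : ℝ) ^ ((1 : ℝ) / 2) :=
    Real.one_le_rpow (by exact_mod_cast hd) (by norm_num)
  have hLJL := hLJ.trans hLJ'
  have h2 : 2 * p * (μ * LJ Lg μg ρ τ * M) ≤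
      μ / 2 * LJ L μg ρ τ * M * (d : ℝ) ^ ((1 : ℝ) / 2) * ((p : ℝ) + 3) ^ ((3 : ℝ) / 2) := by
    have h4 := four_mul_le_rpow (Nat.cast_nonneg (α := ℝ) p)
    calc 2 * p * (μ * LJ Lg μg ρ τ * M) = μ / 2 * LJ Lg μg ρ τ * M * 1 * (4 * p) := by ring
      _ ≤ _ := by gcongr
  have h3 : Lg / μg * q ^ N * M ≤ L * M * q ^ N / μg := by
    calc _ ≤ L / μg * q ^ N * M := by gcongr
      _ = _ := by ring
  have h5 : Lg / μg * (Lf * (q ^ N * D)) ≤ L ^ 2 * D / μg * q ^ ((N : ℝ) / 2) := by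
    calc _ ≤ Lg / μg * (L * D * q ^ ((N : ℝ) / 2)) := by gcongr
      _ ≤ L / μg * (L * D * q ^ ((N : ℝ) / 2)) := by
          have : 0 ≤ q ^ ((N : ℝ) / 2) := Real.rpow_nonneg hq0 _
          gcongr
      _ = _ := by ring
  have e4 : 2 * D * (τ * μg + L * ρ) / μg ^ 2 * q ^ (((N : ℝ) - 1) / 2) * M =
      2 * M * D * (τ * μg + L * ρ) / μg ^ 2 * q ^ (((N : ℝ) - 1) / 2) := by ring
  rw [add_mul, e4]
  linarith

theorem mseBound_le_Dvar (hμg : 0 < μg) (hLf0 : 0 ≤ Lf) (hLf : Lf ≤ L) (hLg0 : 0 ≤ Lg)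
    (hLg : Lg ≤ L) (hρ : 0 ≤ ρ) (hτ : 0 ≤ τ) (hM : 0 ≤ M) (hμ : 0 < μ)
    (hq0 : 0 ≤ 1 - α * μg) (hq1 : 1 - α * μg ≤ 1) (hp : 1 ≤ p) (hd : 1 ≤ d) :
    mseBound Lf (Lg / μg) M p Q (μ * LJ Lg μg ρ τ * M) ((1 - α * μg) ^ N * D)
      (Lg / μg * (1 - α * μg) ^ N + jacErr L μg ρ τ D (1 - α * μg) N)
      ≤ Dvar (Polynomial.C 864 * Polynomial.X ^ 4) L μg ρ τ M D α μ p d N Q := by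
  have hL0 : 0 ≤ L := hLg0.trans hLg
  rw [mseBound, Dvar, jacErr]
  set q := 1 - α * μg
  have hp' : (1 : ℝ) ≤ p := by exact_mod_cast hp
  have hd' : (1 : ℝ) ≤ d := by exact_mod_cast hd
  have hqN : 0 ≤ q ^ N := pow_nonneg hq0 N
  have hq2 : (q ^ N) ^ 2 ≤ q ^ N := by
    rw [sq]; exact mul_le_of_le_one_left hqN (pow_le_one₀ hq0 hq1)
  have hLJ := LJ_nonneg (μg := μg) hLg0 hμg hρ hτ
  have hLJ' := LJ_mono (μg := μg) hLg0 hLg hμg hρ hτ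
  have hsq : (Real.sqrt q ^ (N - 1)) ^ 2 = q ^ (N - 1) := by
    rw [← pow_mul, mul_comm, pow_mul, Real.sq_sqrt hq0]
  have hκ : Lg / μg ≤ L / μg := by gcongr
  have hκ0 : 0 ≤ Lg / μg := by positivity
  have h1 : 2 * (Lf * (q ^ N * D)) ^ 2 ≤ 2 * L ^ 2 * D ^ 2 * q ^ N := by
    calc 2 * (Lf * (q ^ N * D)) ^ 2 = 2 * Lf ^ 2 * D ^ 2 * (q ^ N) ^ 2 := by ring
      _ ≤ _ := by gcongr
  have h2 : 4 * (Lg / μg * (Lf * (q ^ N * D))) ^ 2 ≤ 4 * (L ^ 4 / μg ^ 2) * D ^ 2 * q ^ N := by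
    calc 4 * (Lg / μg * (Lf * (q ^ N * D))) ^ 2
        = 4 * ((Lg / μg) ^ 2 * Lf ^ 2) * D ^ 2 * (q ^ N) ^ 2 := by ring
      _ ≤ 4 * ((L / μg) ^ 2 * L ^ 2) * D ^ 2 * q ^ N := by gcongr
      _ = _ := by ring
  have h3 : 4 * ((Q : ℝ)⁻¹ * (8 * p * (Lg / μg * M) ^ 2)) ≤
      24 * (4 * (p : ℝ) + 15) * (L ^ 2 * M ^ 2 / (Q * μg ^ 2)) := by
    calc 4 * ((Q : ℝ)⁻¹ * (8 * p * (Lg / μg * M) ^ 2))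
        = (32 * p) * ((Q : ℝ)⁻¹ * (Lg / μg * M) ^ 2) := by ring
      _ ≤ 24 * (4 * (p : ℝ) + 15) * ((Q : ℝ)⁻¹ * (L / μg * M) ^ 2) := by
          refine mul_le_mul (by linarith) ?_ (by positivity) (by positivity)
          gcongr
      _ = _ := by ring
  -- 864 = 4 · 216; p³ is raised to p⁴ only to make the polynomial of degree four.
  have h4 : 4 * ((Q : ℝ)⁻¹ * (216 * (μ * LJ Lg μg ρ τ * M) ^ 2 * (p : ℝ) ^ 3)) ≤
      μ ^ 2 / Q * LJ L μg ρ τ ^ 2 * M ^ 2 * d * (864 * (p : ℝ) ^ 4) := by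
    calc 4 * ((Q : ℝ)⁻¹ * (216 * (μ * LJ Lg μg ρ τ * M) ^ 2 * (p : ℝ) ^ 3))
        = μ ^ 2 / Q * LJ Lg μg ρ τ ^ 2 * M ^ 2 * 1 * (864 * (p : ℝ) ^ 3) := by ring
      _ ≤ _ := by
          have : (p : ℝ) ^ 3 ≤ (p : ℝ) ^ 4 := pow_le_pow_right₀ hp' (by norm_num)
          gcongr
  set a := 2 * p * (μ * LJ Lg μg ρ τ * M) with ha
  set b := Lg / μg * q ^ N * M with hb
  set c := 2 * D * (τ * μg + L * ρ) / μg ^ 2 * Real.sqrt q ^ (N - 1) * M with hc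
  have h5 := sq_add_three_le a b c
  have h6 : 12 * a ^ 2 ≤ 6 * μ ^ 2 * LJ L μg ρ τ ^ 2 * M ^ 2 * d * ((p : ℝ) + 3) ^ 3 := by
    have := cubic_bound (Nat.cast_nonneg (α := ℝ) p)
    calc 12 * a ^ 2 = 6 * μ ^ 2 * LJ Lg μg ρ τ ^ 2 * M ^ 2 * 1 * (8 * (p : ℝ) ^ 2) := by
          rw [ha]; ring
      _ ≤ _ := by
          have h8 : 8 * (p : ℝ) ^ 2 ≤ ((p : ℝ) + 3) ^ 3 := by nlinarith [sq_nonneg (p : ℝ)]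
          gcongr
  have h7 : 12 * b ^ 2 ≤ 24 * L ^ 2 * M ^ 2 * q ^ (2 * N) / μg ^ 2 := by
    calc 12 * b ^ 2 = 12 * ((Lg / μg) ^ 2 * M ^ 2 * q ^ (2 * N)) := by rw [hb]; ring
      _ ≤ 24 * ((L / μg) ^ 2 * M ^ 2 * q ^ (2 * N)) := by
          gcongr
          norm_num
      _ = _ := by ring
  have h8 : 12 * c ^ 2 = 48 * M ^ 2 * (τ * μg + L * ρ) ^ 2 / μg ^ 4 * q ^ (N - 1) * D ^ 2 := by
    rw [← hsq, hc]; ring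
  have e : (Lg / μg * q ^ N + 2 * D * (τ * μg + L * ρ) / μg ^ 2 * Real.sqrt q ^ (N - 1)) * M
      = b + c := by rw [hb, hc]; ring
  simp only [Polynomial.eval_mul, Polynomial.eval_C, Polynomial.eval_pow, Polynomial.eval_X]
  rw [e, mul_add (Q : ℝ)⁻¹, mul_add 4, mul_add 4]
  linarith

/-- Under the step size restriction on the smoothing parameter, `μ² d p³ K ≤ cμ²`. -/
theorem smoothing_sq_le {cμ : ℝ} {K : ℕ} (hp : 1 ≤ p) (hd : 1 ≤ d) (hK : 1 ≤ K) (hμ : 0 < μ)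
    (hle : μ ≤ cμ / Real.sqrt ((K : ℝ) * d * (p : ℝ) ^ 3)) :
    μ ^ 2 * (d * (p : ℝ) ^ 3) * K ≤ cμ ^ 2 := by
  have hpos : (0 : ℝ) < (K : ℝ) * d * (p : ℝ) ^ 3 := by positivity
  rw [le_div_iff₀ (Real.sqrt_pos.2 hpos)] at hle
  have h := pow_le_pow_left₀ (by positivity) hle 2
  rw [mul_pow, Real.sq_sqrt hpos.le] at h
  linarith

/-- The constant in front of `p` in the bound on the mean squared error. -/
def varConst (L μg ρ τ M D cμ : ℝ) : ℝ :=
  2 * L ^ 2 * D ^ 2 + 4 * (L ^ 4 / μg ^ 2) * D ^ 2 + 480 * (L ^ 2 * M ^ 2 / μg ^ 2)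
    + 1248 * (LJ L μg ρ τ ^ 2 * M ^ 2 * cμ ^ 2) + 48 * M ^ 2 * (τ * μg + L * ρ) ^ 2 / μg ^ 4 * D ^ 2

/-- As 1 ≤ p, powers of q are at most p, 4p + 15 ≤ 19p and p + 3 ≤ 4p. In `varConst`, 480 = 24 · 19
+ 24 and 1248 = 864 + 6 · 4³. -/
theorem Dvar_le (hμg : 0 < μg) (hq0 : 0 ≤ 1 - α * μg) (hq1 : 1 - α * μg ≤ 1) {cμ : ℝ}
    {K : ℕ} (hp : 1 ≤ p) (hQ : 1 ≤ Q) (hK : 1 ≤ K)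
    (hμd : μ ^ 2 * (d * (p : ℝ) ^ 3) * K ≤ cμ ^ 2) :
    Dvar (Polynomial.C 864 * Polynomial.X ^ 4) L μg ρ τ M D α μ p d N Q
      ≤ varConst L μg ρ τ M D cμ * p := by
  rw [Dvar, varConst]
  set q := 1 - α * μg
  have hp' : (1 : ℝ) ≤ p := by exact_mod_cast hp
  have hQ' : (1 : ℝ) ≤ Q := by exact_mod_cast hQ
  have hK' : (1 : ℝ) ≤ K := by exact_mod_cast hK
  have hμd1 : μ ^ 2 * (d * (p : ℝ) ^ 3) ≤ cμ ^ 2 :=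
    (le_mul_of_one_le_right (by positivity) hK').trans hμd
  have hpw : ∀ n : ℕ, 0 ≤ q ^ n ∧ q ^ n ≤ p := fun n =>
    ⟨pow_nonneg hq0 n, (pow_le_one₀ hq0 hq1).trans hp'⟩
  have h1 : 2 * L ^ 2 * D ^ 2 * q ^ N ≤ 2 * L ^ 2 * D ^ 2 * p := by
    have := (hpw N).2; gcongr
  have h2 : 4 * (L ^ 4 / μg ^ 2) * D ^ 2 * q ^ N ≤ 4 * (L ^ 4 / μg ^ 2) * D ^ 2 * p := by
    have := (hpw N).2; gcongr
  have h3 : 24 * (4 * (p : ℝ) + 15) * (L ^ 2 * M ^ 2 / (Q * μg ^ 2)) ≤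
      456 * (L ^ 2 * M ^ 2 / μg ^ 2) * p := by
    calc _ ≤ (456 * p) * (L ^ 2 * M ^ 2 / (1 * μg ^ 2)) := by
          refine mul_le_mul (by linarith) ?_ (by positivity) (by positivity)
          gcongr
      _ = _ := by ring
  have h4 : μ ^ 2 / Q * LJ L μg ρ τ ^ 2 * M ^ 2 * d * (864 * (p : ℝ) ^ 4) ≤
      864 * (LJ L μg ρ τ ^ 2 * M ^ 2 * cμ ^ 2) * p := by
    calc _ ≤ μ ^ 2 / 1 * LJ L μg ρ τ ^ 2 * M ^ 2 * d * (864 * (p : ℝ) ^ 4) := by gcongr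
      _ = 864 * (LJ L μg ρ τ ^ 2 * M ^ 2 * (μ ^ 2 * (d * (p : ℝ) ^ 3))) * p := by ring
      _ ≤ _ := by gcongr
  have h5 : 24 * L ^ 2 * M ^ 2 * q ^ (2 * N) / μg ^ 2 ≤ 24 * (L ^ 2 * M ^ 2 / μg ^ 2) * p := by
    have := (hpw (2 * N)).2
    calc _ = 24 * (L ^ 2 * M ^ 2 / μg ^ 2) * q ^ (2 * N) := by ring
      _ ≤ _ := by gcongr
  have h6 : 6 * μ ^ 2 * LJ L μg ρ τ ^ 2 * M ^ 2 * d * ((p : ℝ) + 3) ^ 3 ≤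
      384 * (LJ L μg ρ τ ^ 2 * M ^ 2 * cμ ^ 2) * p := by
    calc _ ≤ 6 * μ ^ 2 * LJ L μg ρ τ ^ 2 * M ^ 2 * d * (4 * (p : ℝ)) ^ 3 := by
          gcongr; linarith
      _ = 384 * (LJ L μg ρ τ ^ 2 * M ^ 2 * (μ ^ 2 * (d * (p : ℝ) ^ 3))) := by ring
      _ ≤ 384 * (LJ L μg ρ τ ^ 2 * M ^ 2 * cμ ^ 2) := by gcongr
      _ ≤ _ := le_mul_of_one_le_right (by positivity) hp'
  have h7 : 48 * M ^ 2 * (τ * μg + L * ρ) ^ 2 / μg ^ 4 * q ^ (N - 1) * D ^ 2 ≤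
      48 * M ^ 2 * (τ * μg + L * ρ) ^ 2 / μg ^ 4 * D ^ 2 * p := by
    have := (hpw (N - 1)).2
    calc _ = 48 * M ^ 2 * (τ * μg + L * ρ) ^ 2 / μg ^ 4 * D ^ 2 * q ^ (N - 1) := by ring
      _ ≤ _ := by gcongr
  simp only [Polynomial.eval_mul, Polynomial.eval_C, Polynomial.eval_pow, Polynomial.eval_X]
  linarith

/-- The error `e` is kept abstract so as to cover both `jacErr` and the value 0 of the decoupled
case. -/
theorem biasBound_sq_le (hμg : 0 < μg) (hLf0 : 0 ≤ Lf) (hLf : Lf ≤ L) (hLg0 : 0 ≤ Lg)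
    (hLg : Lg ≤ L) (hρ : 0 ≤ ρ) (hτ : 0 ≤ τ) {q cμ W e : ℝ} {K : ℕ}
    (hq0 : 0 ≤ q) (hq1 : q ≤ 1) (hp : 1 ≤ p) (hd : 1 ≤ d) (hK : 1 ≤ K)
    (hμd : μ ^ 2 * (d * (p : ℝ) ^ 3) * K ≤ cμ ^ 2) (he : (e * M) ^ 2 ≤ W * q ^ N) :
    biasBound Lf (Lg / μg) M p (μ * LJ Lg μg ρ τ * M) (q ^ N * D) (Lg / μg * q ^ N + e) ^ 2
      ≤ 4 * ((L * D * (1 + L / μg)) ^ 2 + (L / μg * M) ^ 2 + W) * q ^ N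
        + 16 * (LJ L μg ρ τ ^ 2 * M ^ 2 * cμ ^ 2) * (p / Real.sqrt K) := by
  have hp' : (1 : ℝ) ≤ p := by exact_mod_cast hp
  have hd' : (1 : ℝ) ≤ d := by exact_mod_cast hd
  have hK' : (1 : ℝ) ≤ K := by exact_mod_cast hK
  have hL0 : 0 ≤ L := hLg0.trans hLg
  have hqN : 0 ≤ q ^ N := pow_nonneg hq0 N
  have hq2 : (q ^ N) ^ 2 ≤ q ^ N := by
    rw [sq]; exact mul_le_of_le_one_left hqN (pow_le_one₀ hq0 hq1)
  have hLJ := LJ_nonneg (μg := μg) hLg0 hμg hρ hτ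
  have hLJ' := LJ_mono (μg := μg) hLg0 hLg hμg hρ hτ
  set c := μ * LJ Lg μg ρ τ * M with hc
  set A := Lf * D * (1 + Lg / μg) * q ^ N with hAd
  set B := Lg / μg * M * q ^ N with hBd
  have e0 : biasBound Lf (Lg / μg) M p c (q ^ N * D) (Lg / μg * q ^ N + e) =
      A + 2 * p * c + B + e * M := by rw [biasBound, hAd, hBd]; ring
  have hA : A ^ 2 ≤ (L * D * (1 + L / μg)) ^ 2 * q ^ N := by
    calc A ^ 2 = (Lf ^ 2 * D ^ 2 * (1 + Lg / μg) ^ 2) * (q ^ N) ^ 2 := by rw [hAd]; ring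
      _ ≤ (L ^ 2 * D ^ 2 * (1 + L / μg) ^ 2) * q ^ N := by gcongr
      _ = _ := by ring
  have hB : B ^ 2 ≤ (L / μg * M) ^ 2 * q ^ N := by
    calc B ^ 2 = ((Lg / μg) ^ 2 * M ^ 2) * (q ^ N) ^ 2 := by rw [hBd]; ring
      _ ≤ ((L / μg) ^ 2 * M ^ 2) * q ^ N := by gcongr
      _ = _ := by ring
  have hsK : Real.sqrt K ≤ K := by
    rw [Real.sqrt_le_left (by positivity)]
    nlinarith
  have hsK0 : 0 < Real.sqrt K := Real.sqrt_pos.2 (by linarith)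
  have hmu : μ ^ 2 * (p : ℝ) ^ 2 ≤ cμ ^ 2 * (p / Real.sqrt K) := by
    have h1 : μ ^ 2 * (p : ℝ) ^ 2 * Real.sqrt K ≤ cμ ^ 2 := by
      calc _ ≤ μ ^ 2 * (1 * (p : ℝ) ^ 3) * K := by
            have : (p : ℝ) ^ 2 ≤ (p : ℝ) ^ 3 := pow_le_pow_right₀ hp' (by norm_num)
            rw [one_mul]
            gcongr
        _ ≤ μ ^ 2 * (d * (p : ℝ) ^ 3) * K := by gcongr
        _ ≤ _ := hμd
    rw [← mul_div_assoc, le_div_iff₀ hsK0]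
    exact h1.trans (le_mul_of_one_le_right (sq_nonneg _) hp')
  have hC : (2 * p * c) ^ 2 ≤ 4 * (LJ L μg ρ τ ^ 2 * M ^ 2 * cμ ^ 2) * (p / Real.sqrt K) := by
    calc (2 * p * c) ^ 2 = 4 * (LJ Lg μg ρ τ ^ 2 * M ^ 2) * (μ ^ 2 * (p : ℝ) ^ 2) := by
          rw [hc]; ring
      _ ≤ 4 * (LJ L μg ρ τ ^ 2 * M ^ 2) * (cμ ^ 2 * (p / Real.sqrt K)) := by gcongr
      _ = _ := by ring
  have h4 := sq_add_four_le A (2 * p * c) B (e * M)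
  rw [e0]
  linarith

end Numerics

end

/-! ### The constant of the rate and the Jacobian error of order q^N. -/

section

variable {p d Q : ℕ} {f g : Joint p d → ℝ} {Lf Lg L μg ρ τ M D : ℝ}

/-- A bound on the square of the Jacobian error relative to `(1 - α μg) ^ N`. When `L = μg` the
inner problem decouples from `x` and the Jacobian error vanishes. -/
def jacErrConst (L μg ρ τ M D : ℝ) : ℝ :=
  if L = μg then 0 else (2 * D * (τ * μg + L * ρ) / μg ^ 2 * M) ^ 2 / (1 - μg / L)

/-- The constant in front of `(1 - α μg) ^ N` in the bound on the squared bias. -/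
def biasConst (L μg ρ τ M D : ℝ) : ℝ :=
  4 * ((L * D * (1 + L / μg)) ^ 2 + (L / μg * M) ^ 2 + jacErrConst L μg ρ τ M D)

/-- The constant of the convergence rate. -/
def rateConst (L Lg μg ρ τ M D Δ cμ : ℝ) : ℝ :=
  2 * LPhi L μg ρ τ M * Δ + 3 * biasConst L μg ρ τ M D
    + 48 * (LJ L μg ρ τ ^ 2 * M ^ 2 * cμ ^ 2) + 4 * MPhi Lg μg M ^ 2
    + 2 * varConst L μg ρ τ M D cμ

theorem jacErrConst_nonneg (hμg : 0 < μg) (hL : μg ≤ L) : 0 ≤ jacErrConst L μg ρ τ M D := by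
  unfold jacErrConst
  split_ifs with h
  · exact le_rfl
  · have : μg / L ≤ 1 := (div_le_one (hμg.trans_le hL)).2 hL
    exact div_nonneg (sq_nonneg _) (by linarith)

/-- Dividing the summed descent inequality by `β K`, where `β = 1 / (l √K)`. -/
theorem average_le {l S Δ₀ R c β : ℝ} {K : ℕ} (hl : 0 < l) (hK : 1 ≤ K)
    (hβ : β = 1 / (l * Real.sqrt K)) (h : β * c * S ≤ Δ₀ + K * (β * R)) :
    c / K * S ≤ l * Δ₀ / Real.sqrt K + R := by
  have hK0 : (0 : ℝ) < K := by exact_mod_cast hK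
  have hs : 0 < Real.sqrt K := Real.sqrt_pos.2 hK0
  have hβK : β * K = Real.sqrt K / l := by
    rw [hβ]
    conv_lhs => rw [← Real.mul_self_sqrt hK0.le]
    rw [Real.sqrt_mul_self hs.le]
    field_simp
  have hpos : 0 < β * K := by rw [hβK]; positivity
  refine le_of_mul_le_mul_right ?_ hpos
  have e1 : c / K * S * (β * K) = β * c * S := by field_simp
  have e2 : (l * Δ₀ / Real.sqrt K + R) * (β * K) = Δ₀ + K * (β * R) := by
    rw [add_mul]
    congr 1
    · rw [hβK]; field_simp
    · ring
  rw [e1, e2]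
  exact h

namespace Assumptions

variable (hA : Assumptions f g Lf Lg μg ρ τ M) (hp : 1 ≤ p) (hd : 1 ≤ d) (hμg : 0 < μg)
  {α β μ : ℝ} (hα : 0 < α) (hαL : α * Lg ≤ 1) (hμ : 0 < μ) {y₀ : Vec d} {N : ℕ}

include hA hp hd hμg hα hαL in
theorem norm_jac_error_le (hLg : Lg ≤ L) {x : Vec p} (hD : ‖y₀ - ystar g x‖ ≤ D) :
    ‖jacGD g α y₀ x N - jacStar g x‖ ≤ Lg / μg * (1 - α * μg) ^ N
      + jacErr L μg ρ τ D (1 - α * μg) N := by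
  have hq0 := hA.q_nonneg hp hd hα hαL
  have hq1 : 1 - α * μg ≤ 1 := by have := mul_pos hα hμg; linarith
  have hD0 : 0 ≤ D := (norm_nonneg _).trans hD
  have hρ := hA.rho_nonneg hp
  have hτ := hA.tau_nonneg hp
  have hL0 := hA.Lg_nonneg hp
  refine (hA.norm_jacGD_sub_jacStar_le hp hd hμg hα hαL hD N).trans ?_
  rw [mul_comm ((1 - α * μg) ^ N)]
  refine add_le_add le_rfl ?_
  have h := mul_pow_pred_le hq0 hq1 N
  set q := 1 - α * μg with hq
  have hαq : α = (1 - q) / μg := by rw [hq]; field_simp; ring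
  calc α * ((τ + ρ * (Lg / μg)) * D) * (N * q ^ (N - 1))
      = ((τ + ρ * (Lg / μg)) * D / μg) * ((1 - q) * (N * q ^ (N - 1))) := by
        conv_lhs => rw [hαq]
        ring
    _ ≤ ((τ + ρ * (L / μg)) * D / μg) * (2 * Real.sqrt q ^ (N - 1)) := by
        have h1 : 0 ≤ 1 - q := by linarith
        have h2 : 0 ≤ L := hL0.trans hLg
        gcongr
    _ = jacErr L μg ρ τ D q N := by rw [jacErr]; field_simp

include hA hp hd hμg hα hαL in
/-- A Jacobian error bound whose square is of order `(1 - α μg) ^ N`. -/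
theorem exists_jac_error_le (hL : Lg ≤ L) (hαL' : α * L ≤ 1) (hN : 1 ≤ N)
    (hD : ∀ x, ‖y₀ - ystar g x‖ ≤ D) :
    ∃ e, (e * M) ^ 2 ≤ jacErrConst L μg ρ τ M D * (1 - α * μg) ^ N ∧
      ∀ x, ‖jacGD g α y₀ x N - jacStar g x‖ ≤ Lg / μg * (1 - α * μg) ^ N + e := by
  have hq0 := hA.q_nonneg hp hd hα hαL
  have hμL := hA.mug_le_Lg hp hd
  -- If L = μg then q may vanish, and for N = 1 the power q^(N-1) = 1 is not bounded by a multiple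
  -- of q^N; there the decoupling makes the error exactly 0.
  by_cases h : L = μg
  · have hLg : Lg = μg := le_antisymm (hL.trans h.le) hμL
    refine ⟨0, by simp [jacErrConst, h], fun x => ?_⟩
    rw [hA.jacGD_eq_zero hp hμg hLg, hA.jacStar_eq_zero hp hμg hLg, sub_zero, norm_zero, add_zero]
    exact mul_nonneg (div_nonneg (hA.Lg_nonneg hp) hμg.le) (pow_nonneg hq0 N)
  · refine ⟨jacErr L μg ρ τ D (1 - α * μg) N, ?_,
      fun x => hA.norm_jac_error_le hp hd hμg hα hαL hL (hD x)⟩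
    have hL0 : 0 < L := hμg.trans_le (hμL.trans hL)
    have hlt : μg / L < 1 := (div_lt_one hL0).2 (lt_of_le_of_ne (hμL.trans hL) (Ne.symm h))
    -- `α * L ≤ 1` keeps q away from 0 uniformly in α, which lets q^(N-1) be traded for q^N.
    have hqL : 1 - μg / L ≤ 1 - α * μg := by
      have : α * μg ≤ μg / L := by
        rw [le_div_iff₀ hL0]; nlinarith
      linarith
    rw [jacErrConst, if_neg h, jacErr]
    set q := 1 - α * μg
    set t := 2 * D * (τ * μg + L * ρ) / μg ^ 2
    have hsq : (Real.sqrt q ^ (N - 1)) ^ 2 = q ^ (N - 1) := by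
      rw [← pow_mul, mul_comm, pow_mul, Real.sq_sqrt hq0]
    have hpow : q ^ N = q ^ (N - 1) * q := by rw [← pow_succ, Nat.sub_add_cancel hN]
    have hpos : 0 < 1 - μg / L := by linarith
    rw [div_mul_eq_mul_div ((t * M) ^ 2), le_div_iff₀ hpos, hpow]
    calc (t * Real.sqrt q ^ (N - 1) * M) ^ 2 * (1 - μg / L)
        = (t * M) ^ 2 * (q ^ (N - 1) * (1 - μg / L)) := by rw [← hsq]; ring
      _ ≤ (t * M) ^ 2 * (q ^ (N - 1) * q) := by gcongr

include hA hp hd hμg hα hαL hμ in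
theorem integrable_Phi_step (hD : ∀ x, ‖y₀ - ystar g x‖ ≤ D) (x : Vec p) :
    Integrable (fun v : Fin Q → Vec p => Phi f g (x - β • hyperGradEst f g α μ y₀ N x v))
      (dirLaw p Q) :=
  hA.integrable_Phi_comp hp hd hμg y₀ hD ((integrable_const x).sub
    (((hA.memLp_hyperGradEst hp hd hμg hα hαL hμ y₀ N x).integrable one_le_two).smul β))

end Assumptions

end

end PZOBO

end

/-! ### Assembly of both bounds. -/

theorem theorem1 :
    ∃ P₄ : Polynomial ℝ, P₄.natDegree = 4 ∧
    ∀ Lf Lg μg ρ τ M D Δ cμ : ℝ, 0 < μg →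
    ∃ C : ℝ,
    ∀ (p d : ℕ), 1 ≤ p → 1 ≤ d →
    ∀ (f g : PZOBO.Joint p d → ℝ), PZOBO.Assumptions f g Lf Lg μg ρ τ M →
    ∀ (x₀ : PZOBO.Vec p) (y₀ : PZOBO.Vec d),
    (∀ x : PZOBO.Vec p, ‖y₀ - PZOBO.ystar g x‖ ≤ D) →
    BddBelow (Set.range (PZOBO.Phi f g)) →
    PZOBO.Phi f g x₀ - (⨅ x, PZOBO.Phi f g x) ≤ Δ →
    ∀ (K N Q : ℕ), 1 ≤ K → 1 ≤ N → 1 ≤ Q →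
    ∀ (α β μ : ℝ), 0 < α → α ≤ 1 / max Lf Lg →
    β = 1 / (PZOBO.LPhi (max Lf Lg) μg ρ τ M * Real.sqrt K) →
    0 < μ → μ ≤ cμ / Real.sqrt ((K : ℝ) * d * (p : ℝ) ^ 3) →
    ∀ (Ω : Type*) [MeasurableSpace Ω] (P : Measure Ω) [IsProbabilityMeasure P]
      (u : ℕ → Fin Q → Ω → PZOBO.Vec p),
    (∀ k j, Measurable (u k j)) →
    (∀ k j, P.map (u k j) = stdGaussian (PZOBO.Vec p)) →
    iIndepFun (fun kj : ℕ × Fin Q => u kj.1 kj.2) P →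
    Differentiable ℝ (PZOBO.Phi f g) ∧
    (∀ k < K, Integrable (fun ω => ‖gradient (PZOBO.Phi f g)
      (PZOBO.iterate f g α β μ x₀ y₀ N (fun i j => u i j ω) k)‖ ^ 2) P) ∧
    PZOBO.weightedAvg P f g α β μ x₀ y₀ N K u ≤
        PZOBO.LPhi (max Lf Lg) μg ρ τ M *
          (PZOBO.Phi f g x₀ - ⨅ x, PZOBO.Phi f g x) / Real.sqrt K
        + PZOBO.MPhi Lg μg M * PZOBO.Dbias (max Lf Lg) μg ρ τ M D α μ p d N
        + PZOBO.Dvar P₄ (max Lf Lg) μg ρ τ M D α μ p d N Q / Real.sqrt K ∧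
    PZOBO.weightedAvg P f g α β μ x₀ y₀ N K u ≤
        C * ((p : ℝ) / Real.sqrt K + (1 - α * μg) ^ N) := by
  refine ⟨Polynomial.C 864 * Polynomial.X ^ 4, Polynomial.natDegree_C_mul_X_pow 4 864 (by norm_num),
    fun Lf Lg μg ρ τ M D Δ cμ hμg =>
      ⟨PZOBO.rateConst (max Lf Lg) Lg μg ρ τ M D Δ cμ, ?_⟩⟩
  intro p d hp hd f g hA x₀ y₀ hD hbdd hΔ K N Q hK hN hQ α β μ hα hαL hβ hμ hμc Ω _ P _ u hu hlaw hind
  set L := max Lf Lg with hLdef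
  have hLf : Lf ≤ L := le_max_left _ _
  have hLg : Lg ≤ L := le_max_right _ _
  have hLf0 := hA.Lf_nonneg hp
  have hLg0 := hA.Lg_nonneg hp
  have hρ := hA.rho_nonneg hp
  have hτ := hA.tau_nonneg hp
  have hM := hA.M_nonneg hp
  have hμLg := hA.mug_le_Lg hp hd
  have hL0 : 0 < L := hμg.trans_le (hμLg.trans hLg)
  have hD0 : 0 ≤ D := (norm_nonneg _).trans (hD x₀)
  have hαL1 : α * L ≤ 1 := (le_div_iff₀ hL0).1 hαL
  have hαLg : α * Lg ≤ 1 := (mul_le_mul_of_nonneg_left hLg hα.le).trans hαL1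
  have hq0 := hA.q_nonneg hp hd hα hαLg
  have hq1 : 1 - α * μg ≤ 1 := by have := mul_pos hα hμg; linarith
  have hp' : (1 : ℝ) ≤ p := by exact_mod_cast hp
  have hK' : (1 : ℝ) ≤ K := by exact_mod_cast hK
  have hsK : 1 ≤ Real.sqrt K := Real.one_le_sqrt.2 hK'
  have hl := PZOBO.LPhi_pos hL0 hμg hρ hτ hM
  set l := PZOBO.LPhi L μg ρ τ M with hldef
  set s := 1 / Real.sqrt K with hs
  have hs0 : 0 < s := by positivity
  have hs1 : s ≤ 1 := by rw [hs, div_le_one (by linarith)]; exact hsK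
  have hβ0 : 0 < β := by rw [hβ]; positivity
  have hlβ : l * β = s := by rw [hβ, hs]; field_simp
  have hLt0 : 0 ≤ PZOBO.smoothPhi Lf Lg μg ρ τ M := by
    have := PZOBO.LJ_nonneg hLg0 hμg hρ hτ
    unfold PZOBO.smoothPhi
    positivity
  -- The factor 2 of `smoothPhi_le` is exactly what the descent lemmas tolerate, because they use Lt
  -- β / 2 ≤ s.
  have hLt : PZOBO.smoothPhi Lf Lg μg ρ τ M * β ≤ 2 * s := by
    have h := mul_le_mul_of_nonneg_right
      (PZOBO.smoothPhi_le (Lf := Lf) hμg hμLg hρ hτ hM) hβ0.le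
    rw [← hlβ, ← mul_assoc]
    exact h
  set m := PZOBO.MPhi Lg μg M with hm
  have hμd := PZOBO.smoothing_sq_le hp hd hK hμ hμc
  have hε := fun x => hA.norm_innerGD_sub_ystar_le hp hd hμg hα hαLg (hD x) N
  have hmse := fun x => (hA.integral_norm_sq_error_le hp hd hμg hα hαLg hμ y₀ N x (hε x)
    (hA.norm_jac_error_le hp hd hμg hα hαLg hLg (hD x)) hQ).trans
    (PZOBO.mseBound_le_Dvar hμg hLf0 hLf hLg0 hLg hρ hτ hM hμ hq0 hq1 hp hd)
  have hbias := fun x => (hA.norm_bias_le hp hd hμg hα hαLg hμ y₀ N x (hε x)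
    (hA.norm_jac_error_le hp hd hμg hα hαLg hLg (hD x)) hQ).trans
    (PZOBO.biasBound_le_Dbias hμg hLf hLg0 hLg hρ hτ hM hD0 hμ hq0 hq1 hd hN)
  have havg : PZOBO.weightedAvg P f g α β μ x₀ y₀ N K u = (1 - s) / K * ∑ k ∈ Finset.range K,
      ∫ ω, ‖PZOBO.gradPhi f g
        (PZOBO.iterate f g α β μ x₀ y₀ N (fun i j => u i j ω) k)‖ ^ 2 ∂P := by
    simp only [PZOBO.weightedAvg, hA.gradient_Phi hp hd hμg hD, hs]
  refine ⟨hA.differentiable_Phi hp hd hμg hD, fun k _ => ?_, ?_, ?_⟩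
  · simp only [hA.gradient_Phi hp hd hμg hD]
    exact hA.integrable_norm_gradPhi_sq hp hd hμg y₀ hD
      (hA.measurable_iterate hp α β μ x₀ y₀ N hu k)
  · have hsum := hA.sum_integral_norm_gradPhi_sq_le hp hu hlaw hind hd hμg hα hαLg hμ x₀ y₀ N hD
      (fun x => (PZOBO.expected_descent_bias (hA.memLp_hyperGradEst hp hd hμg hα hαLg hμ y₀ N x)
        (hA.Phi_descent hp hd hμg hD x) (hA.integrable_Phi_step hp hd hμg hα hαLg hμ hD x)
        hβ0 hLt0 hLt hs1 (hbias x) (hmse x) (hA.norm_gradPhi_le hp hμg x)).trans_eq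
          (by rw [add_assoc, ← mul_add])) hbdd K
    have h := PZOBO.average_le hl hK hβ hsum
    rw [havg]
    refine h.trans_eq ?_
    rw [← add_assoc, hs]
    congr 1
    ring
  -- The refined Jacobian error is needed for the bias alone: the variance is multiplied by s, so
  -- its bound by a multiple of p suffices.
  · obtain ⟨e, he, hjac⟩ := hA.exists_jac_error_le hp hd hμg hα hαLg hLg hαL1 hN hD
    have hbias2 := fun x => hA.norm_bias_le hp hd hμg hα hαLg hμ y₀ N x (hε x) (hjac x) hQ
    have hB := PZOBO.biasBound_sq_le (D := D) hμg hLf0 hLf hLg0 hLg hρ hτ hq0 hq1 hp hd hK hμd he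
    have hV := PZOBO.Dvar_le (L := L) (ρ := ρ) (τ := τ) (M := M) (D := D) (N := N) hμg hq0 hq1
      hp hQ hK hμd
    have hsum := hA.sum_integral_norm_gradPhi_sq_le hp hu hlaw hind hd hμg hα hαLg hμ x₀ y₀ N hD
      (fun x => (PZOBO.expected_descent_young (hA.memLp_hyperGradEst hp hd hμg hα hαLg hμ y₀ N x)
        (hA.Phi_descent hp hd hμg hD x) (hA.integrable_Phi_step hp hd hμg hα hαLg hμ hD x)
        hβ0 hLt0 hLt hs1 (hbias2 x) (hmse x) (hA.norm_gradPhi_le hp hμg x)).trans_eq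
          (by rw [add_assoc, ← mul_add])) hbdd K
    have h := PZOBO.average_le hl hK hβ hsum
    rw [havg]
    set S := ∑ k ∈ Finset.range K, ∫ ω, ‖PZOBO.gradPhi f g
        (PZOBO.iterate f g α β μ x₀ y₀ N (fun i j => u i j ω) k)‖ ^ 2 ∂P with hS
    have hS0 : 0 ≤ S := Finset.sum_nonneg fun k _ => integral_nonneg fun ω => sq_nonneg _
    have hSK : 0 ≤ S / K := by positivity
    -- The weight 1 - s is bounded by 1, and the factor 2 undoes the 1/2 left by Young's inequality.
    -- The same factor gives 3 = 2 · 3/2 and 48 = 2 · 3/2 · 16 in `rateConst`.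
    have h1 : (1 - s) / K * S ≤ 2 * (1 / 2 / K * S) := by
      have e1 : (1 - s) / K * S = (1 - s) * (S / K) := by ring
      have e2 : 2 * (1 / 2 / K * S) = S / K := by ring
      rw [e1, e2]
      exact mul_le_of_le_one_left hSK (by linarith)
    have hinf : (⨅ x, PZOBO.Phi f g x) ≤ PZOBO.Phi f g x₀ := ciInf_le hbdd x₀
    have hΔ0 : 0 ≤ Δ := by linarith
    set B := PZOBO.biasBound Lf (Lg / μg) M p (μ * PZOBO.LJ Lg μg ρ τ * M)
      ((1 - α * μg) ^ N * D) (Lg / μg * (1 - α * μg) ^ N + e)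
    set V := PZOBO.Dvar (Polynomial.C 864 * Polynomial.X ^ 4) L μg ρ τ M D α μ p d N Q
    have hps : (p : ℝ) / Real.sqrt K = p * s := by rw [hs]; ring
    rw [hps] at hB ⊢
    have hsp : s ≤ p * s := le_mul_of_one_le_left hs0.le hp'
    have hqN : 0 ≤ (1 - α * μg) ^ N := pow_nonneg hq0 N
    have t1 : l * (PZOBO.Phi f g x₀ - ⨅ x, PZOBO.Phi f g x) / Real.sqrt K ≤ l * Δ * (p * s) := by
      calc _ = l * (PZOBO.Phi f g x₀ - ⨅ x, PZOBO.Phi f g x) * s := by rw [hs]; ring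
        _ ≤ l * Δ * (p * s) := by gcongr
    have t2 : s * (2 * m ^ 2 + V) ≤ (2 * m ^ 2 + PZOBO.varConst L μg ρ τ M D cμ) * (p * s) := by
      have t3 : s * V ≤ s * (PZOBO.varConst L μg ρ τ M D cμ * p) := by gcongr
      have t4 : 2 * m ^ 2 * s ≤ 2 * m ^ 2 * (p * s) := by gcongr
      linarith
    have hj := PZOBO.jacErrConst_nonneg (ρ := ρ) (τ := τ) (M := M) (D := D) hμg (hμLg.trans hLg)
    have hbc : 0 ≤ PZOBO.biasConst L μg ρ τ M D := by unfold PZOBO.biasConst; positivity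
    have hvc : 0 ≤ PZOBO.varConst L μg ρ τ M D cμ := by unfold PZOBO.varConst; positivity
    have hB' : B ^ 2 ≤ PZOBO.biasConst L μg ρ τ M D * (1 - α * μg) ^ N
        + 16 * (PZOBO.LJ L μg ρ τ ^ 2 * M ^ 2 * cμ ^ 2) * (p * s) := hB
    set J := PZOBO.LJ L μg ρ τ ^ 2 * M ^ 2 * cμ ^ 2 with hJ
    have hJ0 : 0 ≤ J := by positivity
    have hps0 : 0 ≤ p * s := by positivity
    have hfin : 2 * (l * Δ * (p * s) + (3 / 2 * (PZOBO.biasConst L μg ρ τ M D * (1 - α * μg) ^ N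
        + 16 * J * (p * s)) + (2 * m ^ 2 + PZOBO.varConst L μg ρ τ M D cμ) * (p * s)))
        ≤ PZOBO.rateConst L Lg μg ρ τ M D Δ cμ * (p * s + (1 - α * μg) ^ N) := by
      rw [PZOBO.rateConst, ← hJ, ← hm, ← hldef]
      have r1 : 0 ≤ 3 * PZOBO.biasConst L μg ρ τ M D * (p * s) := by positivity
      have r2 : 0 ≤ (2 * l * Δ + 48 * J + 4 * m ^ 2 + 2 * PZOBO.varConst L μg ρ τ M D cμ)
        * (1 - α * μg) ^ N := by positivity
      linarith
    linarith
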